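/- Let $N\ge 3$, let $\Omega\subset\mathbb R^N$ be a bounded open set, $1<p<N$, $q>0$, $\mu>0$ and $k>N/p$. For $s>-1/\mu$ put $$g(s)=\frac{(p-1)^{q-p+1}}{\mu^{q}}(1+\mu s)^{p-1}|\ln(1+\mu s)|^{q-1}\ln(1+\mu s),\qquad f(s)=\frac{(1+\mu s)^{p-1}}{(p-1)^{p-1}},$$ and $g(s)=f(s)=0$ for $s\le -1/\mu$ (the continuous extension); let $G(s)=\int_0^s g$, $F(s)=\int_0^s f$. Let $W_0^{1,p}(\Omega)$ be equipped with $\|v\|=(\int_\Omega|\nabla v|^p)^{1/p}$, and for $c,h\in L^k(\Omega)$ let $$I(v)=\frac1p\int_\Omega|\nabla v|^p-\int_\Omega c\,G(v)-\int_\Omega h\,F(v),\qquad v\in W_0^{1,p}(\Omega).$$ Say that $I$ has the mountain-pass geometry with constants $\rho,\beta>0$ if $I(v)\ge\beta$ whenever $\|v\|=\rho$ and there is $v_0\in W_0^{1,p}(\Omega)$ with $\|v_0\|>\rho$ and $I(v_0)\le 0$. Theorem 3.1 (second critical point). There are $\delta,\rho_0,\beta_0>0$, depending only on $N,\Omega,p,q,\mu,k$,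 such that for all $c,h\in L^k(\Omega)$ with $c\ge 0$ a.e., $c\not\equiv 0$, $\|c\|_k\le\delta$ and $\|h\|_k\le\delta$ the following holds. The integrals in $I$ converge on $W_0^{1,p}(\Omega)$, and $I$ has the mountain-pass geometry with constants $\rho_0,\beta_0$. Moreover, whenever $I$ has the mountain-pass geometry with constants $\rho,\beta>0$, there is a critical point $v$ of $I$ with $\|v\|<\rho$, $I(v)\le 0$ and $v>-1/\mu$ a.e. in $\Omega$; it is a local minimum of $I$, and $I(v)=\min_{\|u\|\le\rho}I(u)$. For every $v_0$ with $\|v_0\|>\rho$ and $I(v_0)\le 0$, the mountain-pass level $$\tilde c=\inf_{\gamma}\max_{t\in[0,1]}I(\gamma(t)),\qquad \gamma\in C([0,1],W_0^{1,p}(\Omega)),\ \gamma(0)=0,\ \gamma(1)=v_0,$$ is positive, and so every critical point $w$ of $I$ with $I(w)=\tilde c$ is different from $v$. -/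

import Mathlib

open MeasureTheory
open scoped ENNReal ContDiff

noncomputable section

namespace PLaplace

/-- Euclidean space `ℝ^N`. -/
abbrev Space (N : ℕ) : Type := EuclideanSpace ℝ (Fin N)

instance one_le_ofReal (p : ℝ) [hp : Fact (1 < p)] : Fact (1 ≤ ENNReal.ofReal p) :=
  ⟨by simpa using ENNReal.ofReal_le_ofReal hp.out.le⟩

/-- The Banach space `L^p(Ω) × L^p(Ω; ℝ^N)` in which pairs `(u, ∇u)` live. -/
abbrev PairSpace (N : ℕ) (Ω : Set (Space N)) (p : ℝ) : Type :=
  Lp ℝ (ENNReal.ofReal p) (volume.restrict Ω) ×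
    Lp (Space N) (ENNReal.ofReal p) (volume.restrict Ω)

/-- The linear subspace of all pairs `(φ, ∇φ)` with `φ ∈ C_c^∞(Ω)`. -/
def testPairs (N : ℕ) (Ω : Set (Space N)) (p : ℝ) [Fact (1 < p)] :
    Submodule ℝ (PairSpace N Ω p) where
  carrier := {w | ∃ φ : Space N → ℝ, ContDiff ℝ ∞ φ ∧ HasCompactSupport φ ∧ tsupport φ ⊆ Ω ∧
    w.1 =ᵐ[volume.restrict Ω] φ ∧ w.2 =ᵐ[volume.restrict Ω] gradient φ}
  zero_mem' := by
    refine ⟨fun _ => 0, contDiff_const, HasCompactSupport.zero, ?_, ?_, ?_⟩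
    · have h0 : tsupport (fun _ : Space N => (0 : ℝ)) = ∅ := by
        rw [tsupport_eq_empty_iff]; rfl
      rw [h0]; exact Set.empty_subset _
    · exact Lp.coeFn_zero _ _ _
    · filter_upwards [Lp.coeFn_zero (Space N) (ENNReal.ofReal p) (volume.restrict Ω)] with x hx
      simpa [gradient] using hx
  add_mem' := by
    rintro a b ⟨φ, h1, h2, h3, h4, h5⟩ ⟨ψ, g1, g2, g3, g4, g5⟩
    refine ⟨φ + ψ, h1.add g1, h2.add g2, ?_, ?_, ?_⟩
    · exact (tsupport_add φ ψ).trans (Set.union_subset h3 g3)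
    · exact (Lp.coeFn_add a.1 b.1).trans (h4.add g4)
    · refine (Lp.coeFn_add a.2 b.2).trans ((h5.add g5).trans (Filter.Eventually.of_forall ?_))
      intro x
      have e := fderiv_add (h1.differentiable (by simp) x) (g1.differentiable (by simp) x)
      simp [gradient, e]
  smul_mem' := by
    rintro r a ⟨φ, h1, h2, h3, h4, h5⟩
    refine ⟨fun x => r • φ x, h1.const_smul r, h2.smul_left (f := fun _ => r), ?_, ?_, ?_⟩
    · exact (tsupport_smul_subset_right (fun _ => r) φ).trans h3
    · filter_upwards [Lp.coeFn_smul r a.1, h4] with x hx hy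
      rw [Prod.smul_fst, hx, Pi.smul_apply, hy]
    · filter_upwards [Lp.coeFn_smul r a.2, h5] with x hx hy
      have e := fderiv_fun_const_smul (h1.differentiable (by simp) x) r
      rw [Prod.smul_snd, hx, Pi.smul_apply, hy]
      simp only [gradient, e, map_smul]

/-- The Sobolev space `W_0^{1,p}(Ω)`: the closure of `C_c^∞(Ω)` in `W^{1,p}(Ω)`. An element is a
pair `(u, ∇u)`. As a normed space it carries the norm `max (‖u‖_p) (‖∇u‖_p)`; for bounded `Ω`
this is equivalent to the Poincaré norm `gradNorm` below, so it gives the same topology, the same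
continuous paths and the same Fréchet derivatives. -/
def sobolevZero (N : ℕ) (Ω : Set (Space N)) (p : ℝ) [Fact (1 < p)] :
    Submodule ℝ (PairSpace N Ω p) :=
  (testPairs N Ω p).topologicalClosure

section

variable {N : ℕ} {Ω : Set (Space N)} {p : ℝ} [Fact (1 < p)]

/-- The function `u` underlying an element of `W_0^{1,p}(Ω)`. -/
def val (u : sobolevZero N Ω p) : Space N → ℝ := u.1.1

/-- Its weak gradient `∇u`. -/
def grad (u : sobolevZero N Ω p) : Space N → Space N := u.1.2

/-- The Poincaré norm `‖u‖ = (∫_Ω |∇u|^p)^{1/p}` on `W_0^{1,p}(Ω)`. -/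
def gradNorm (u : sobolevZero N Ω p) : ℝ :=
  (∫ x in Ω, ‖grad u x‖ ^ p) ^ (1 / p)

end

/-- The nonlinearity `g`, given by its formula for `s > -1/μ` and continued by its limit `0`. -/
def g (p q μ s : ℝ) : ℝ :=
  if -1 / μ < s then
    (p - 1) ^ (q - p + 1) / μ ^ q * (1 + μ * s) ^ (p - 1) *
      |Real.log (1 + μ * s)| ^ (q - 1) * Real.log (1 + μ * s)
  else 0

/-- The nonlinearity `f`, given by its formula for `s > -1/μ` and continued by its limit `0`. -/
def f (p μ s : ℝ) : ℝ :=
  if -1 / μ < s then (1 + μ * s) ^ (p - 1) / (p - 1) ^ (p - 1) else 0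

/-- The primitive `G(s) = ∫_0^s g`. -/
def G (p q μ s : ℝ) : ℝ := ∫ t in (0 : ℝ)..s, g p q μ t

/-- The primitive `F(s) = ∫_0^s f`. -/
def F (p μ s : ℝ) : ℝ := ∫ t in (0 : ℝ)..s, f p μ t

section

variable {N : ℕ} {Ω : Set (Space N)} {p : ℝ} [Fact (1 < p)]

/-- The functional `I(u) = (1/p) ∫_Ω |∇u|^p - ∫_Ω c G(u) - ∫_Ω h F(u)` on `W_0^{1,p}(Ω)`. -/
def energy (q μ : ℝ) (c h : Space N → ℝ) (u : sobolevZero N Ω p) : ℝ :=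
  1 / p * (∫ x in Ω, ‖grad u x‖ ^ p) - (∫ x in Ω, c x * G p q μ (val u x)) -
    ∫ x in Ω, h x * F p μ (val u x)

/-- A critical point of a functional: its Fréchet derivative exists there and vanishes. -/
def IsCritical (J : sobolevZero N Ω p → ℝ) (u : sobolevZero N Ω p) : Prop :=
  HasFDerivAt J (0 : sobolevZero N Ω p →L[ℝ] ℝ) u

/-- `J ≥ β` on the sphere `∂B(0, ρ)` for the Poincaré norm, and some point outside the ball has
`J ≤ 0`; here `ρ, β > 0`. -/
structure MountainPassGeometry (J : sobolevZero N Ω p → ℝ) (ρ β : ℝ) : Prop where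
  rho_pos : 0 < ρ
  beta_pos : 0 < β
  sphere : ∀ u, gradNorm u = ρ → β ≤ J u
  outside : ∃ u, ρ < gradNorm u ∧ J u ≤ 0

/-- The level `inf_γ max_t J(γ(t))` over continuous paths `γ` in `W_0^{1,p}(Ω)` from `0` to
`v₀`. -/
def mountainPassLevel (J : sobolevZero N Ω p → ℝ) (v₀ : sobolevZero N Ω p) : ℝ :=
  ⨅ γ : Path (0 : sobolevZero N Ω p) v₀, ⨆ t : unitInterval, J (γ t)

end

end PLaplace

end

/-! Write `I(u) = ‖∇u‖_p^p / p - B(u)` with `B(u) = ∫ c G(u) + ∫ h F(u)`. The condition `k > N/p`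
leaves room for an exponent `r > p` with `r k' < p^*`, where `k'` is conjugate to `k`. The
derivatives `g` and `f` vanish below `-1/μ` and are `o(s^{r-1})` at `+∞`, so `B` is controlled by
the `L^r` norms of `u` with respect to the measures with densities `c^±` and `h^±`. By Hölder these
norms are bounded by the `L^{rk'}(Ω)` norm, which is strictly subcritical. Hence `B` is well
defined, differentiable and compact. Differentiability is isolated in `TameGrowth`, a modulus of
continuity of the derivative that also covers `|x|^p` for every `p > 1`. Compactness is Rellich's
theorem in `L^1`, proved by averaging over small cubes, followed by interpolation with the Sobolev
inequality.

Geometry. On the unit sphere the gradient term is `1/p` and `|B|` is at most a constant times `‖c‖_k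
+ ‖h‖_k`, so small coefficients leave `I ≥ 1/(2p)`. Since `G` is superlinear of order `p`, while `F`
and the gradient term grow at most like `T^p`, `I(Tφ)` is eventually nonpositive for a bump function
`φ` equal to `1` on a set charged by `c`.

Minimum on a ball. Weak convergence is not used. Along a minimizing sequence that is Cauchy in
`L^1`, the midpoints stay in the ball, so their energy is at least the infimum, while `B` at the
midpoints and at the points has the same limit. Uniform convexity of the `p`-th power of the `L^p`
norm then makes the gradients Cauchy (`cauchySeq_of_minimizing`). The minimizer `v` satisfies `I(v)
≤ I(0) = 0 < β`, so it is off the sphere; it is an interior minimum and hence critical.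

Lower bound `v > -1/μ`. The minimizer is compared with the competitor `u = v - z`, where `z` is a
smoothed version of the part of `v` below `-t`. The gradient of `v` splits as `a∇v + (1-a)∇v` with
`0 ≤ a ≤ 1`, so the energies of `z` and `u` add up to at most that of `v`; in particular `u` lies in
the same ball. On the negative half line `G` and `F` are Lipschitz, so minimality bounds
`‖∇z‖_p^{p-1}` by `δ |{v ≤ -t}|^κ`. Sobolev and Chebyshev turn this into a superlinear recursion for
the measures of the level sets (`exists_levelSet_decay`), and a De Giorgi iteration from `-1/(2μ)`
down to `-1/μ` gives `|{v ≤ -1/μ}| = 0` if `δ` is small. The threshold depends neither on `v` nor on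
the radius of the ball, so one `δ` serves all geometries.

Finally, every path from `0` to `v₀` crosses the sphere, so the mountain-pass level is at least `β >
0 ≥ I(v)`. -/

open Filter Topology Asymptotics

namespace PLaplace

section

/-! ### The nonlinearities -/

/-- `|y|^{q-1} y` is continuous for `q > 0`. -/
lemma continuous_abs_rpow_sub_one_mul {q : ℝ} (hq : 0 < q) :
    Continuous fun y : ℝ => |y| ^ (q - 1) * y := by
  rw [continuous_iff_continuousAt]
  intro y
  rcases eq_or_ne y 0 with rfl | hy
  · have h1 : Tendsto (fun y : ℝ => |y| ^ q) (𝓝 0) (𝓝 0) := by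
      have : ContinuousAt (fun y : ℝ => |y| ^ q) 0 :=
        (continuous_abs.continuousAt).rpow_const (Or.inr hq.le)
      simpa [ContinuousAt, Real.zero_rpow hq.ne'] using this
    have h2 : ∀ y : ℝ, ‖|y| ^ (q - 1) * y‖ ≤ |y| ^ q := by
      intro y
      rcases eq_or_ne y 0 with rfl | hy
      · simp [Real.zero_rpow hq.ne']
      · have hy' : 0 < |y| := abs_pos.2 hy
        rw [norm_mul, Real.norm_eq_abs, Real.norm_eq_abs,
          abs_of_nonneg (Real.rpow_nonneg hy'.le _), ← Real.rpow_add_one hy'.ne']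
        simp
    have := squeeze_zero_norm h2 h1
    simpa [ContinuousAt] using this
  · exact ((continuous_abs.continuousAt).rpow_const (Or.inl (by simpa using hy))).mul
      continuousAt_id

/-- `x^r log x` is continuous on `[0, ∞)` for `r > 0`. -/
lemma continuous_log_mul_rpow_max {r : ℝ} (hr : 0 < r) :
    Continuous fun x : ℝ => Real.log (max x 0) * (max x 0) ^ r := by
  have h : ContinuousOn (fun x : ℝ => Real.log x * x ^ r) (Set.Ici 0) := by
    intro x hx
    rcases eq_or_lt_of_le (show (0 : ℝ) ≤ x from hx) with rfl | hx
    · rw [← Set.Ioi_insert, continuousWithinAt_insert_self]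
      have := tendsto_log_mul_rpow_nhdsGT_zero hr
      simpa [ContinuousWithinAt] using this
    · exact ((Real.continuousAt_log hx.ne').mul
        (Real.continuousAt_rpow_const _ _ (Or.inl hx.ne'))).continuousWithinAt
  exact h.comp_continuous (continuous_id.max continuous_const) (fun x =>
    Set.mem_Ici.2 (le_max_right _ _))

/-- The power `x^{p-1}` is absorbed into the argument of `y ↦ |y|^{q-1} y`, with `y = x^{(p-1)/q}
log x`. Both maps are continuous up to `x = 0`, also when `q < 1`, and at `x = 0` the value is `0`
because `Real.log 0 = 0`. Truncating `x` by `max` therefore covers both branches. -/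
lemma g_eq {p q μ : ℝ} (hq : 0 < q) (hμ : 0 < μ) (s : ℝ) :
    g p q μ s = (p - 1) ^ (q - p + 1) / μ ^ q *
      (|Real.log (max (1 + μ * s) 0) * (max (1 + μ * s) 0) ^ ((p - 1) / q)| ^ (q - 1) *
        (Real.log (max (1 + μ * s) 0) * (max (1 + μ * s) 0) ^ ((p - 1) / q))) := by
  have hiff : -1 / μ < s ↔ 0 < 1 + μ * s := by
    rw [div_lt_iff₀ hμ]; constructor <;> intro h <;> nlinarith
  unfold g
  split_ifs with h
  · rw [hiff] at h
    rw [max_eq_left h.le]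
    set x := 1 + μ * s
    have hx : 0 < x ^ ((p - 1) / q) := Real.rpow_pos_of_pos h _
    rw [abs_mul, abs_of_pos hx, Real.mul_rpow (abs_nonneg _) hx.le]
    have e : (x ^ ((p - 1) / q)) ^ (q - 1) * x ^ ((p - 1) / q) = x ^ (p - 1) := by
      rw [← Real.rpow_add_one hx.ne', sub_add_cancel, ← Real.rpow_mul h.le,
        div_mul_cancel₀ _ hq.ne']
    rw [← e]; ring
  · rw [hiff, not_lt] at h
    rw [max_eq_right h]; simp

lemma f_eq {p μ : ℝ} (hp : 1 < p) (hμ : 0 < μ) (s : ℝ) :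
    f p μ s = (max (1 + μ * s) 0) ^ (p - 1) / (p - 1) ^ (p - 1) := by
  have hiff : -1 / μ < s ↔ 0 < 1 + μ * s := by
    rw [div_lt_iff₀ hμ]; constructor <;> intro h <;> nlinarith
  unfold f
  split_ifs with h
  · rw [hiff] at h
    rw [max_eq_left h.le]
  · rw [hiff, not_lt] at h
    rw [max_eq_right h, Real.zero_rpow (by linarith)]; simp

lemma continuous_g {p q μ : ℝ} (hp : 1 < p) (hq : 0 < q) (hμ : 0 < μ) :
    Continuous (g p q μ) := by
  rw [funext (g_eq hq hμ)]
  have h1 := continuous_log_mul_rpow_max (r := (p - 1) / q) (by apply div_pos <;> linarith)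
  exact continuous_const.mul ((continuous_abs_rpow_sub_one_mul hq).comp
    (h1.comp (by fun_prop : Continuous fun s : ℝ => 1 + μ * s)))

lemma continuous_f {p μ : ℝ} (hp : 1 < p) (hμ : 0 < μ) : Continuous (f p μ) := by
  rw [funext (f_eq hp hμ)]
  exact ((by fun_prop : Continuous fun s : ℝ => max (1 + μ * s) 0).rpow_const
    (fun _ => Or.inr (by linarith))).div_const _

lemma g_of_le {p q μ s : ℝ} (hs : s ≤ -1 / μ) : g p q μ s = 0 := if_neg hs.not_gt
lemma f_of_le {p μ s : ℝ} (hs : s ≤ -1 / μ) : f p μ s = 0 := if_neg hs.not_gt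

lemma tendsto_one_add_mul {μ : ℝ} (hμ : 0 < μ) :
    Tendsto (fun s : ℝ => 1 + μ * s) atTop atTop :=
  tendsto_atTop_add_const_left _ _ (tendsto_id.const_mul_atTop hμ)

lemma isBigO_one_add_mul {μ : ℝ} (hμ : 0 < μ) :
    (fun s : ℝ => 1 + μ * s) =O[atTop] fun s => s := by
  refine IsBigO.of_bound (1 + μ) ?_
  filter_upwards [eventually_ge_atTop 1] with s hs
  rw [Real.norm_of_nonneg (by positivity), Real.norm_of_nonneg (by positivity)]
  nlinarith

/-- The factor `(log x)^q` is beaten by `x^{r-p}` for every `r > p`, however small the gap. -/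
lemma isLittleO_g {p q μ r : ℝ} (hp : 1 < p) (hμ : 0 < μ) (hr : p < r) :
    g p q μ =o[atTop] fun s => s ^ (r - 1) := by
  have hx := tendsto_one_add_mul hμ
  have h1 : (fun x : ℝ => x ^ (p - 1) * |Real.log x| ^ (q - 1) * Real.log x)
      =o[atTop] fun x : ℝ => x ^ (r - 1) := by
    have hl : (fun x : ℝ => (Real.log x) ^ q) =o[atTop] fun x : ℝ => x ^ (r - p) :=
      isLittleO_log_rpow_rpow_atTop q (by linarith)
    have h2 := (isBigO_refl (fun x : ℝ => x ^ (p - 1)) atTop).mul_isLittleO hl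
    refine h2.congr' ?_ ?_
    · filter_upwards [eventually_gt_atTop 1] with x hx
      have : 0 < Real.log x := Real.log_pos hx
      rw [abs_of_pos this, mul_assoc, ← Real.rpow_add_one this.ne', sub_add_cancel]
    · filter_upwards [eventually_gt_atTop 1] with x hx
      rw [← Real.rpow_add (by linarith)]
      congr 1; ring
  have h3 : (fun s : ℝ => (1 + μ * s) ^ (r - 1)) =O[atTop] fun s => s ^ (r - 1) := by
    refine (isBigO_one_add_mul hμ).rpow (by linarith) (eventually_ge_atTop 0)
  have h4 := ((h1.comp_tendsto hx).trans_isBigO h3).const_mul_left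
    ((p - 1) ^ (q - p + 1) / μ ^ q)
  refine h4.congr' ?_ EventuallyEq.rfl
  filter_upwards [eventually_gt_atTop (-1 / μ)] with s hs
  simp only [g, if_pos hs, Function.comp]
  ring

lemma isLittleO_f {p μ r : ℝ} (hp : 1 < p) (hμ : 0 < μ) (hr : p < r) :
    f p μ =o[atTop] fun s => s ^ (r - 1) := by
  have hx := tendsto_one_add_mul hμ
  have h1 : (fun x : ℝ => x ^ (p - 1)) =o[atTop] fun x : ℝ => x ^ (r - 1) := by
    refine (isLittleO_iff_tendsto' ?_).2 ?_
    · filter_upwards [eventually_gt_atTop 0] with x hx h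
      exact absurd h (Real.rpow_pos_of_pos hx _).ne'
    · refine (tendsto_rpow_neg_atTop (sub_pos.2 hr)).congr' ?_
      filter_upwards [eventually_gt_atTop 0] with x hx
      rw [← Real.rpow_sub hx]
      congr 1; ring
  have h3 : (fun s : ℝ => (1 + μ * s) ^ (r - 1)) =O[atTop] fun s => s ^ (r - 1) := by
    refine (isBigO_one_add_mul hμ).rpow (by linarith) (eventually_ge_atTop 0)
  have h4 := ((h1.comp_tendsto hx).trans_isBigO h3).const_mul_left (1 / (p - 1) ^ (p - 1))
  refine h4.congr' ?_ EventuallyEq.rfl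
  filter_upwards [eventually_gt_atTop (-1 / μ)] with s hs
  simp only [f, if_pos hs, Function.comp]
  ring

lemma hasDerivAt_G {p q μ : ℝ} (hp : 1 < p) (hq : 0 < q) (hμ : 0 < μ) (s : ℝ) :
    HasDerivAt (G p q μ) (g p q μ s) s :=
  ((continuous_g hp hq hμ).integral_hasStrictDerivAt 0 s).hasDerivAt

lemma hasDerivAt_F {p μ : ℝ} (hp : 1 < p) (hμ : 0 < μ) (s : ℝ) :
    HasDerivAt (F p μ) (f p μ s) s :=
  ((continuous_f hp hμ).integral_hasStrictDerivAt 0 s).hasDerivAt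

@[simp] lemma G_zero (p q μ : ℝ) : G p q μ 0 = 0 := by simp [G]
@[simp] lemma F_zero (p μ : ℝ) : F p μ 0 = 0 := by simp [F]

/-- A continuous function vanishing near `-∞` is bounded on the negative half line. -/
lemma exists_bound_nonpos {φ : ℝ → ℝ} (hφ : Continuous φ) {a : ℝ} (ha : ∀ s ≤ a, φ s = 0) :
    ∃ C, 0 < C ∧ ∀ s ≤ 0, |φ s| ≤ C := by
  obtain ⟨C, hC⟩ := isCompact_Icc.exists_bound_of_continuousOn (s := Set.Icc a 0) hφ.continuousOn
  refine ⟨max C 1, by positivity, fun s hs => ?_⟩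
  rcases le_total s a with h | h
  · rw [ha s h]; simp
  · exact (hC s ⟨h, hs⟩).trans (le_max_left _ _)

/-- The primitive of a function bounded on the negative half line is Lipschitz there. -/
lemma abs_sub_le_of_bound_nonpos {Φ φ : ℝ → ℝ} (h : ∀ s, HasDerivAt Φ (φ s) s) {C : ℝ}
    (hC : ∀ s ≤ 0, |φ s| ≤ C) {s t : ℝ} (hs : s ≤ 0) (ht : t ≤ 0) :
    |Φ t - Φ s| ≤ C * |t - s| :=
  (convex_Iic (0 : ℝ)).norm_image_sub_le_of_norm_hasDerivWithin_le
    (fun x _ => (h x).hasDerivWithinAt) (fun x hx => hC x hx) hs ht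

lemma f_nonneg {p μ : ℝ} (hp : 1 < p) (hμ : 0 < μ) (s : ℝ) : 0 ≤ f p μ s := by
  rw [f_eq hp hμ]; have : 0 < p - 1 := by linarith
  positivity

lemma g_nonneg {p q μ s : ℝ} (hp : 1 < p) (hμ : 0 < μ) (hs : 0 ≤ s) : 0 ≤ g p q μ s := by
  have : 0 < p - 1 := by linarith
  have h1 : 0 ≤ Real.log (1 + μ * s) := Real.log_nonneg (by nlinarith)
  unfold g
  split_ifs
  · positivity
  · rfl

lemma G_nonneg {p q μ s : ℝ} (hp : 1 < p) (hμ : 0 < μ) (hs : 0 ≤ s) : 0 ≤ G p q μ s :=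
  intervalIntegral.integral_nonneg hs fun _ hx => g_nonneg hp hμ hx.1

/-- `F` grows at most like `s^p`. -/
lemma exists_F_le {p μ : ℝ} (hp : 1 < p) (hμ : 0 < μ) :
    ∃ C, 0 ≤ C ∧ ∀ T, 1 ≤ T → ∀ s, 0 ≤ s → s ≤ T → |F p μ s| ≤ C * T ^ p := by
  have hp1 : 0 < p - 1 := by linarith
  refine ⟨(1 + μ) ^ (p - 1) / (p - 1) ^ (p - 1), by positivity, fun T hT s hs hsT => ?_⟩
  have h := intervalIntegral.norm_integral_le_of_norm_le_const (a := 0) (b := s) (f := f p μ)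
    (C := (1 + μ) ^ (p - 1) / (p - 1) ^ (p - 1) * T ^ (p - 1)) (fun x hx => by
      rw [Set.uIoc_of_le hs] at hx
      rw [Real.norm_of_nonneg (f_nonneg hp hμ x), f_eq hp hμ, div_mul_eq_mul_div,
        ← Real.mul_rpow (by positivity) (by positivity)]
      have : 0 ≤ μ * x := by nlinarith [hx.1]
      gcongr
      rw [max_eq_left (by linarith)]
      nlinarith [hx.1, hx.2])
  refine h.trans ?_
  rw [sub_zero, abs_of_nonneg hs]
  have e : T ^ p = T ^ (p - 1) * T := by
    rw [← Real.rpow_add_one (by linarith), sub_add_cancel]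
  rw [e, ← mul_assoc]
  gcongr

/-- `G` is superlinear of order `p`. -/
lemma eventually_mul_rpow_le_G {p q μ : ℝ} (hp : 1 < p) (hq : 0 < q) (hμ : 0 < μ) (M : ℝ) :
    ∀ᶠ s in atTop, M * s ^ p ≤ G p q μ s := by
  have hp1 : 0 < p - 1 := by linarith
  set K := (p - 1) ^ (q - p + 1) / μ ^ q with hK
  have hK0 : 0 < K := by positivity
  have hlog : Tendsto (fun s : ℝ => (Real.log (1 + μ * (s / 2))) ^ q) atTop atTop :=
    (tendsto_rpow_atTop hq).comp (Real.tendsto_log_atTop.comp ((tendsto_one_add_mul hμ).comp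
      (tendsto_id.atTop_div_const (by norm_num))))
  -- Only the upper half `[s/2, s]` of the integral is used, where `g` is at least `K (μs/2)^{p-1}
  -- (log(1+μs/2))^q`. The threshold is chosen so that this bound times the length `s/2` reaches `M
  -- s^p`.
  filter_upwards [hlog.eventually_ge_atTop (M * 2 / (K * (μ / 2) ^ (p - 1))),
    eventually_gt_atTop 0] with s hs hs0
  have hlow : ∀ t ∈ Set.Icc (s / 2) s, K * (μ * (s / 2)) ^ (p - 1) *
      (Real.log (1 + μ * (s / 2))) ^ q ≤ g p q μ t := by
    intro t ht
    have ht0 : 0 < t := by linarith [ht.1]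
    have h1 : 0 < Real.log (1 + μ * t) := Real.log_pos (by nlinarith)
    have h2 : 0 < Real.log (1 + μ * (s / 2)) := Real.log_pos (by nlinarith)
    have hlt : -1 / μ < t := lt_trans (by rw [neg_div]; simpa using hμ) ht0
    rw [g, if_pos hlt, abs_of_pos h1, mul_assoc _ (_ ^ (q - 1)), ← Real.rpow_add_one h1.ne',
      sub_add_cancel]
    have h4 : μ * (s / 2) ≤ μ * t := by nlinarith [ht.1]
    gcongr
    linarith
  have hc := continuous_g (q := q) hp hq hμ
  have h3 : G p q μ s = G p q μ (s / 2) + ∫ t in (s / 2)..s, g p q μ t := by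
    simp only [G]
    rw [intervalIntegral.integral_add_adjacent_intervals] <;>
      exact hc.intervalIntegrable _ _
  have h4 := intervalIntegral.integral_mono_on (μ := volume) (by linarith : s / 2 ≤ s)
    intervalIntegrable_const (hc.intervalIntegrable _ _) hlow
  rw [intervalIntegral.integral_const, smul_eq_mul] at h4
  have h5 := G_nonneg (q := q) hp hμ (by linarith : 0 ≤ s / 2)
  have e : s ^ p = s ^ (p - 1) * s := by
    rw [← Real.rpow_add_one hs0.ne', sub_add_cancel]
  rw [div_le_iff₀ (by positivity)] at hs
  have h6 : K * (μ * (s / 2)) ^ (p - 1) = K * (μ / 2) ^ (p - 1) * s ^ (p - 1) := by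
    rw [mul_assoc, ← Real.mul_rpow (by positivity) (by positivity)]; congr 2; ring
  rw [h6] at h4
  have h7 : M * s ^ p ≤ (s - s / 2) * (K * (μ / 2) ^ (p - 1) * s ^ (p - 1) *
      Real.log (1 + μ * (s / 2)) ^ q) := by
    rw [e]
    have : 0 < s ^ (p - 1) * s := by positivity
    nlinarith
  linarith

end

section

/-! ### Integral functionals on `L^r` -/

/-- `Φ` is differentiable, and its derivative has the modulus of continuity that makes
`ξ ↦ ∫ Φ(ξ)` differentiable on `L^r` of a finite measure. -/
structure TameGrowth {E : Type*} [NormedAddCommGroup E] [NormedSpace ℝ E] (r : ℝ)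
    (Φ : E → ℝ) (Φ' : E → E →L[ℝ] ℝ) : Prop where
  hasFDerivAt : ∀ s, HasFDerivAt Φ (Φ' s) s
  modulus : ∀ ε > 0, ∃ C, 0 ≤ C ∧ ∀ s t,
    ‖Φ' (s + t) - Φ' s‖ ≤ ε * (1 + ‖s‖) ^ (r - 1) + C * ‖t‖ ^ (r - 1)

/-- The sum is at most twice the maximum. The constant is crude but valid for all `x ≥ 0`, including
`x < 1`, where convexity is not available. -/
lemma add_rpow_le_two_rpow_mul {a b x : ℝ} (ha : 0 ≤ a) (hb : 0 ≤ b) (hx : 0 ≤ x) :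
    (a + b) ^ x ≤ 2 ^ x * (a ^ x + b ^ x) := by
  have h1 : (a + b) ^ x ≤ (2 * max a b) ^ x := by
    gcongr
    linarith [le_max_left a b, le_max_right a b]
  refine h1.trans ?_
  rw [Real.mul_rpow (by norm_num) (le_max_of_le_left ha)]
  gcongr
  have := Real.rpow_nonneg ha x
  have := Real.rpow_nonneg hb x
  rcases max_choice a b with h | h <;> rw [h] <;> linarith

/-- A crude Young inequality: replace the smaller of the two numbers by the larger one. -/
lemma rpow_sub_one_mul_le {a b r : ℝ} (ha : 0 ≤ a) (hb : 0 ≤ b) (hr : 1 < r) :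
    a ^ (r - 1) * b ≤ a ^ r + b ^ r := by
  have ea : a ^ r = a ^ (r - 1) * a := by
    conv_lhs => rw [← sub_add_cancel r 1]
    rw [Real.rpow_add_one' ha (by linarith)]
  have eb : b ^ r = b ^ (r - 1) * b := by
    conv_lhs => rw [← sub_add_cancel r 1]
    rw [Real.rpow_add_one' hb (by linarith)]
  have h0 := Real.rpow_nonneg ha (r - 1)
  have h1 := Real.rpow_nonneg hb (r - 1)
  rcases le_total a b with h | h
  · have : a ^ (r - 1) ≤ b ^ (r - 1) := by gcongr
    nlinarith
  · nlinarith

/-- The free scale `τ` makes the bound linear in `b` after integration, when `τ` is taken to be the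
`L^r` norm of `b`. -/
lemma rpow_sub_one_mul_le_scaled {a b r τ : ℝ} (ha : 0 ≤ a) (hb : 0 ≤ b) (hr : 1 < r)
    (hτ : 0 < τ) : a ^ (r - 1) * b ≤ τ * (a ^ r + b ^ r / τ ^ r) := by
  have h := rpow_sub_one_mul_le ha (div_nonneg hb hτ.le) hr
  rw [Real.div_rpow hb hτ.le] at h
  calc a ^ (r - 1) * b = τ * (a ^ (r - 1) * (b / τ)) := by field_simp
    _ ≤ _ := by gcongr

namespace TameGrowth

variable {E : Type*} [NormedAddCommGroup E] [NormedSpace ℝ E] {r : ℝ}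
  {Φ : E → ℝ} {Φ' : E → E →L[ℝ] ℝ}

lemma continuous (h : TameGrowth r Φ Φ') : Continuous Φ :=
  continuous_iff_continuousAt.2 fun s => (h.hasFDerivAt s).continuousAt

lemma continuous_deriv (h : TameGrowth r Φ Φ') (hr : 1 < r) : Continuous Φ' := by
  rw [continuous_iff_continuousAt]
  intro s
  rw [Metric.continuousAt_iff]
  intro ε hε
  have hs : 0 < (1 + ‖s‖) ^ (r - 1) := by positivity
  obtain ⟨C, hC0, hC⟩ := h.modulus (ε / 2 / (1 + ‖s‖) ^ (r - 1)) (by positivity)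
  have ht : Tendsto (fun x : ℝ => C * |x| ^ (r - 1)) (𝓝 0) (𝓝 0) := by
    have : Continuous (fun x : ℝ => C * |x| ^ (r - 1)) :=
      continuous_const.mul (continuous_abs.rpow_const fun _ => Or.inr (by linarith))
    simpa [Real.zero_rpow (by linarith : r - 1 ≠ 0)] using this.tendsto 0
  obtain ⟨η, hη, hη'⟩ := Metric.tendsto_nhds_nhds.1 ht (ε / 2) (by positivity)
  refine ⟨η, hη, fun {y} hy => ?_⟩
  have h1 := hC s (y - s)
  rw [add_sub_cancel] at h1
  have h2 := @hη' ‖y - s‖ (by simpa [dist_eq_norm] using hy)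
  rw [Real.dist_0_eq_abs, abs_norm] at h2
  rw [div_mul_cancel₀ _ hs.ne'] at h1
  rw [dist_eq_norm]
  linarith [le_abs_self (C * ‖y - s‖ ^ (r - 1))]

lemma exists_norm_deriv_le (h : TameGrowth r Φ Φ') (hr : 1 < r) :
    ∃ C, 0 ≤ C ∧ ∀ s, ‖Φ' s‖ ≤ C * (1 + ‖s‖) ^ (r - 1) := by
  obtain ⟨C, hC0, hC⟩ := h.modulus 1 one_pos
  refine ⟨‖Φ' 0‖ + 1 + C, by positivity, fun s => ?_⟩
  have h1 := hC 0 s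
  rw [zero_add, norm_zero, add_zero, Real.one_rpow, mul_one] at h1
  have h2 : ‖Φ' s‖ ≤ ‖Φ' 0‖ + 1 + C * ‖s‖ ^ (r - 1) := by
    have := norm_le_norm_add_norm_sub' (Φ' s) (Φ' 0)
    linarith
  have h3 : (1 : ℝ) ≤ (1 + ‖s‖) ^ (r - 1) :=
    Real.one_le_rpow (by linarith [norm_nonneg s]) (by linarith)
  have h4 : ‖s‖ ^ (r - 1) ≤ (1 + ‖s‖) ^ (r - 1) := by gcongr; linarith
  nlinarith [norm_nonneg (Φ' 0)]

/-- The mean value inequality for `Φ - Φ'(s)` on the segment from `s` to `s + t`: the modulus of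
`Φ'` is monotone in the size of the increment, so its value at `t` serves on the whole segment. -/
lemma exists_remainder_le (h : TameGrowth r Φ Φ') (hr : 1 < r) {ε : ℝ} (hε : 0 < ε) :
    ∃ C, 0 ≤ C ∧ ∀ s t,
      |Φ (s + t) - Φ s - Φ' s t| ≤ ε * ((1 + ‖s‖) ^ (r - 1) * ‖t‖) + C * ‖t‖ ^ r := by
  obtain ⟨C, hC0, hC⟩ := h.modulus ε hε
  refine ⟨C, hC0, fun s t => ?_⟩
  have h1 := (convex_segment s (s + t)).norm_image_sub_le_of_norm_hasFDerivWithin_le' (f := Φ)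
    (f' := Φ') (φ := Φ' s) (C := ε * (1 + ‖s‖) ^ (r - 1) + C * ‖t‖ ^ (r - 1))
    (x := s) (y := s + t) (fun x _ => (h.hasFDerivAt x).hasFDerivWithinAt)
    (fun x hx => by
      rw [segment_eq_image'] at hx
      obtain ⟨θ, hθ, rfl⟩ := hx
      refine (hC _ _).trans ?_
      have : ‖θ • (s + t - s)‖ ≤ ‖t‖ := by
        rw [add_sub_cancel_left, norm_smul, Real.norm_of_nonneg hθ.1]
        exact mul_le_of_le_one_left (norm_nonneg _) hθ.2
      gcongr)
    (left_mem_segment _ _ _) (right_mem_segment _ _ _)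
  rw [add_sub_cancel_left, Real.norm_eq_abs] at h1
  have e : ‖t‖ ^ r = ‖t‖ ^ (r - 1) * ‖t‖ := by
    conv_lhs => rw [← sub_add_cancel r 1]
    rw [Real.rpow_add_one' (norm_nonneg _) (by linarith)]
  rw [e]
  linarith

lemma exists_abs_le (h : TameGrowth r Φ Φ') (hr : 1 < r) :
    ∃ C, 0 ≤ C ∧ ∀ s, |Φ s - Φ 0| ≤ C * (1 + ‖s‖) ^ r := by
  obtain ⟨C, hC0, hC⟩ := h.exists_remainder_le hr one_pos
  refine ⟨1 + C + ‖Φ' 0‖, by positivity, fun s => ?_⟩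
  have h1 := hC 0 s
  rw [zero_add, norm_zero, add_zero, Real.one_rpow, one_mul, one_mul] at h1
  have h2 := (Φ' 0).le_opNorm s
  have h3 : |Φ s - Φ 0| ≤ |Φ s - Φ 0 - Φ' 0 s| + ‖Φ' 0 s‖ := by
    have := abs_add_le (Φ s - Φ 0 - Φ' 0 s) (Φ' 0 s)
    simpa using this
  have h4 : ‖s‖ ^ r ≤ (1 + ‖s‖) ^ r := by gcongr; linarith
  have h5 : ‖s‖ ≤ (1 + ‖s‖) ^ r :=
    le_trans (by linarith) (Real.self_le_rpow_of_one_le (by linarith [norm_nonneg s]) hr.le)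
  nlinarith [norm_nonneg (Φ' 0)]

end TameGrowth

/-- A continuous scalar derivative of order `o(|s|^{r-1})` has tame growth. -/
lemma tameGrowth_of_small {Φ φ : ℝ → ℝ} {r : ℝ} (hr : 1 < r)
    (hd : ∀ s, HasDerivAt Φ (φ s) s) (hc : Continuous φ)
    (hs : ∀ ε > 0, ∃ R, ∀ s, R ≤ |s| → |φ s| ≤ ε * (1 + |s|) ^ (r - 1)) :
    TameGrowth r Φ (fun s => ContinuousLinearMap.toSpanSingleton ℝ (φ s)) := by
  refine ⟨fun s => (hd s).hasFDerivAt, fun ε hε => ?_⟩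
  have hr1 : 0 ≤ r - 1 := by linarith
  have hK : (0 : ℝ) < 2 ^ (r - 1) := by positivity
  have hK1 : (1 : ℝ) ≤ 2 ^ (r - 1) := Real.one_le_rpow (by norm_num) hr1
  set K : ℝ := 2 ^ (r - 1)
  set δ := ε / (2 * K) with hδ
  have hδ0 : 0 < δ := by positivity
  have hδε : δ * (2 * K) = ε := div_mul_cancel₀ _ (by positivity)
  obtain ⟨R', hR'⟩ := hs δ hδ0
  set R := max R' 0
  have hR0 : 0 ≤ R := le_max_right _ _
  have hR : ∀ s, R ≤ |s| → |φ s| ≤ δ * (1 + |s|) ^ (r - 1) :=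
    fun s h => hR' s ((le_max_left _ _).trans h)
  obtain ⟨M', hM'⟩ := isCompact_Icc.exists_bound_of_continuousOn (s := Set.Icc (-R) R)
    hc.continuousOn
  set M := max M' 0
  have hM0 : 0 ≤ M := le_max_right _ _
  have hM : ∀ s, |φ s| ≤ M + δ * (1 + |s|) ^ (r - 1) := by
    intro s
    have : 0 ≤ δ * (1 + |s|) ^ (r - 1) := by positivity
    rcases le_total R |s| with h | h
    · linarith [hR s h]
    · have h1 := hM' s (abs_le.1 h)
      rw [Real.norm_eq_abs] at h1
      linarith [le_max_left M' 0]
  -- The margin `2` is one unit for `|s| ≤ R + 1` and one for `|t| ≤ 1`, so that `s + t` stays in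
  -- the interval.
  have huc := isCompact_Icc.uniformContinuousOn_of_continuous (s := Set.Icc (-(R + 2)) (R + 2))
    hc.continuousOn
  obtain ⟨η', hη', hη⟩ := Metric.uniformContinuousOn_iff.1 huc ε hε
  set η := min η' 1
  have hη0 : 0 < η := lt_min hη' one_pos
  -- For `|t| ≥ η` the first summand absorbs the bounded parts of `φ(s)` and `φ(s+t)`, and `ε`
  -- absorbs their growth. For `|t| < η` the `C`-term is not needed: either `|s| ≤ R + 1` and
  -- uniform continuity applies, or both `s` and `s + t` lie where `φ` is already small relative to
  -- `(1+|s|)^{r-1}`.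
  refine ⟨2 * M / η ^ (r - 1) + ε, by positivity, fun s t => ?_⟩
  have hsub' : ContinuousLinearMap.toSpanSingleton ℝ (φ (s + t)) -
      ContinuousLinearMap.toSpanSingleton ℝ (φ s) =
      ContinuousLinearMap.toSpanSingleton ℝ (φ (s + t) - φ s) := by ext; simp
  rw [hsub', ContinuousLinearMap.norm_toSpanSingleton]
  simp only [Real.norm_eq_abs]
  have hone : (1 : ℝ) ≤ (1 + |s|) ^ (r - 1) :=
    Real.one_le_rpow (by linarith [abs_nonneg s]) hr1
  have ht0 : 0 ≤ |t| ^ (r - 1) := by positivity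
  have hsub : |φ (s + t) - φ s| ≤ |φ (s + t)| + |φ s| := abs_sub _ _
  rcases lt_or_ge |t| η with ht | ht
  · have ht1 : |t| ≤ 1 := ht.le.trans (min_le_right _ _)
    have hpos : 0 ≤ (2 * M / η ^ (r - 1) + ε) * |t| ^ (r - 1) := by positivity
    suffices |φ (s + t) - φ s| ≤ ε * (1 + |s|) ^ (r - 1) by linarith
    have hst : |s + t| ≤ |s| + 1 := (abs_add_le _ _).trans (by linarith)
    have hst' : |s| - 1 ≤ |s + t| := by
      have := abs_sub_abs_le_abs_sub s (-t)
      rw [abs_neg, sub_neg_eq_add] at this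
      linarith
    rcases le_total |s| (R + 1) with h | h
    · have h1 := hη (s + t) (abs_le.1 (by linarith)) s (abs_le.1 (by linarith)) (by
        rw [dist_eq_norm, add_sub_cancel_left]
        exact lt_of_lt_of_le ht (min_le_left _ _))
      rw [dist_eq_norm, Real.norm_eq_abs] at h1
      nlinarith
    · have h1 := hR (s + t) (by linarith)
      have h2 := hR s (by linarith)
      have h3 : (1 + |s + t|) ^ (r - 1) ≤ K * (1 + |s|) ^ (r - 1) := by
        rw [← Real.mul_rpow (by norm_num) (by positivity)]
        gcongr
        linarith [abs_nonneg s]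
      have h4 : (1 + |s|) ^ (r - 1) ≤ K * (1 + |s|) ^ (r - 1) := by nlinarith
      calc |φ (s + t) - φ s| ≤ δ * (1 + |s + t|) ^ (r - 1) + δ * (1 + |s|) ^ (r - 1) := by
            linarith
        _ ≤ δ * (K * (1 + |s|) ^ (r - 1)) + δ * (K * (1 + |s|) ^ (r - 1)) := by gcongr
        _ = δ * (2 * K) * (1 + |s|) ^ (r - 1) := by ring
        _ = _ := by rw [hδε]
  · have h1 := hM (s + t)
    have h2 := hM s
    have h3 : (1 + |s + t|) ^ (r - 1) ≤ K * ((1 + |s|) ^ (r - 1) + |t| ^ (r - 1)) := by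
      refine le_trans ?_ (add_rpow_le_two_rpow_mul (by positivity) (abs_nonneg t) hr1)
      exact Real.rpow_le_rpow (by positivity) (by linarith [abs_add_le s t]) hr1
    have h4 : (1 + |s|) ^ (r - 1) ≤ K * (1 + |s|) ^ (r - 1) := by nlinarith
    have h5 : 2 * M ≤ 2 * M / η ^ (r - 1) * |t| ^ (r - 1) := by
      have : η ^ (r - 1) ≤ |t| ^ (r - 1) := by gcongr
      have hη1 : 0 < η ^ (r - 1) := by positivity
      rw [div_mul_eq_mul_div, le_div_iff₀ hη1]
      gcongr
    calc |φ (s + t) - φ s| ≤ 2 * M + δ * (1 + |s + t|) ^ (r - 1) + δ * (1 + |s|) ^ (r - 1) := by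
          linarith
      _ ≤ 2 * M / η ^ (r - 1) * |t| ^ (r - 1) + δ * (K * ((1 + |s|) ^ (r - 1) + |t| ^ (r - 1)))
          + δ * (K * (1 + |s|) ^ (r - 1)) := by gcongr
      _ ≤ 2 * M / η ^ (r - 1) * |t| ^ (r - 1) + δ * (2 * K) * (1 + |s|) ^ (r - 1) +
          δ * (2 * K) * |t| ^ (r - 1) := by
          have : 0 ≤ δ * K * |t| ^ (r - 1) := by positivity
          linarith
      _ = _ := by rw [hδε]; ring

/-- Only `+∞` needs the growth condition; near `-∞` the function is zero. -/
lemma small_of_isLittleO {φ : ℝ → ℝ} {r a : ℝ} (hr : 1 < r)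
    (h : φ =o[atTop] fun s => s ^ (r - 1)) (ha : ∀ s ≤ a, φ s = 0) :
    ∀ ε > 0, ∃ R, ∀ s, R ≤ |s| → |φ s| ≤ ε * (1 + |s|) ^ (r - 1) := by
  intro ε hε
  obtain ⟨R, hR⟩ := eventually_atTop.1 (h.bound hε)
  refine ⟨max (max R 0) (-a), fun s hs => ?_⟩
  have h1 : max R 0 ≤ |s| := (le_max_left _ _).trans hs
  rcases le_total 0 s with h0 | h0
  · rw [abs_of_nonneg h0] at h1 ⊢
    have h2 := hR s ((le_max_left _ _).trans h1)
    rw [Real.norm_eq_abs, Real.norm_of_nonneg (by positivity)] at h2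
    refine h2.trans ?_
    gcongr
    linarith
  · rw [ha s (by rw [abs_of_nonpos h0] at hs; linarith [le_max_right (max R 0) (-a)]), abs_zero]
    positivity

lemma tameGrowth_G {p q μ r : ℝ} (hp : 1 < p) (hq : 0 < q) (hμ : 0 < μ) (hr : p < r) :
    TameGrowth r (G p q μ) (fun s => ContinuousLinearMap.toSpanSingleton ℝ (g p q μ s)) :=
  tameGrowth_of_small (by linarith) (hasDerivAt_G hp hq hμ) (continuous_g hp hq hμ)
    (small_of_isLittleO (by linarith) (isLittleO_g hp hμ hr) fun _ => g_of_le)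

lemma tameGrowth_F {p μ r : ℝ} (hp : 1 < p) (hμ : 0 < μ) (hr : p < r) :
    TameGrowth r (F p μ) (fun s => ContinuousLinearMap.toSpanSingleton ℝ (f p μ s)) :=
  tameGrowth_of_small (by linarith) (hasDerivAt_F hp hμ) (continuous_f hp hμ)
    (small_of_isLittleO (by linarith) (isLittleO_f hp hμ hr) fun _ => f_of_le)

end

section

/-! ### Tame growth and uniform convexity of `|x|^p` -/

section power

variable {E : Type*} [NormedAddCommGroup E] [InnerProductSpace ℝ E]

/-- The derivative of a `p`-homogeneous function is homogeneous of degree `p - 1`. This reduces its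
modulus of continuity to points of norm one. -/
lemma fderiv_norm_rpow_smul {p : ℝ} (hp : 1 < p) {c : ℝ} (hc : 0 < c) (x : E) :
    fderiv ℝ (fun y : E => ‖y‖ ^ p) (c • x) = c ^ (p - 1) • fderiv ℝ (fun y : E => ‖y‖ ^ p) x := by
  rw [fderiv_norm_rpow _ hp, fderiv_norm_rpow _ hp, map_smul, norm_smul, Real.norm_of_nonneg hc.le,
    Real.mul_rpow hc.le (norm_nonneg _), smul_smul, smul_smul]
  congr 1
  have : c ^ (p - 1) = c ^ (p - 2) * c := by
    rw [← Real.rpow_add_one hc.ne']; congr 1; ring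
  rw [this]; ring

lemma norm_fderiv_norm_rpow_eq {p : ℝ} (hp : 1 < p) (x : E) :
    ‖fderiv ℝ (fun y : E => ‖y‖ ^ p) x‖ = p * ‖x‖ ^ (p - 1) := by
  rw [fderiv_norm_rpow _ hp, norm_smul, innerSL_apply_norm, norm_mul,
    Real.norm_of_nonneg (by linarith),
    Real.norm_of_nonneg (by positivity)]
  rcases eq_or_ne x 0 with rfl | hx
  · simp [Real.zero_rpow (by linarith : p - 1 ≠ 0)]
  · rw [mul_assoc, ← Real.rpow_add_one (norm_ne_zero_iff.2 hx)]
    congr 2; ring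

/-- The `p`-th power of the norm has tame growth. -/
lemma tameGrowth_norm_rpow [FiniteDimensional ℝ E] {p : ℝ} (hp : 1 < p) :
    TameGrowth p (fun x : E => ‖x‖ ^ p) (fderiv ℝ fun x : E => ‖x‖ ^ p) := by
  refine ⟨fun s => (differentiable_norm_rpow hp s).hasFDerivAt, fun ε hε => ?_⟩
  have hp1 : 0 < p - 1 := by linarith
  have hc : Continuous (fderiv ℝ fun x : E => ‖x‖ ^ p) :=
    (contDiff_norm_rpow hp).continuous_fderiv one_ne_zero
  obtain ⟨η', hη', huc⟩ := Metric.uniformContinuousOn_iff.1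
    ((isCompact_closedBall (0 : E) 2).uniformContinuousOn_of_continuous hc.continuousOn) ε hε
  set η := min (η' / 2) 1
  have hη0 : 0 < η := lt_min (by positivity) one_pos
  have hη1 : η ≤ 1 := min_le_right _ _
  set D := fderiv ℝ fun x : E => ‖x‖ ^ p with hD
  refine ⟨p * (1 / η + 1) ^ (p - 1) + p * (1 / η) ^ (p - 1), by positivity, fun s t => ?_⟩
  have ht0 : 0 ≤ ‖t‖ ^ (p - 1) := by positivity
  have hC : 0 ≤ (p * (1 / η + 1) ^ (p - 1) + p * (1 / η) ^ (p - 1)) * ‖t‖ ^ (p - 1) := by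
    positivity
  have hs0 : 0 ≤ ε * (1 + ‖s‖) ^ (p - 1) := by positivity
  -- A small relative increment is rescaled to a base point of norm one, where uniform continuity on
  -- the ball of radius `2` gives `ε ‖s‖^{p-1}`. Otherwise `‖s‖ ≤ ‖t‖ / η`, and both derivatives are
  -- separately of order `‖t‖^{p-1}`.
  rcases le_or_gt ‖t‖ (η * ‖s‖) with h | h
  · rcases eq_or_ne s 0 with rfl | hs
    · have : t = 0 := by simpa using h
      subst this
      simp only [add_zero, sub_self, norm_zero] at hs0 hC ⊢
      linarith
    · have hs' : 0 < ‖s‖ := norm_pos_iff.2 hs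
      set a := ‖s‖⁻¹ • s
      set b := ‖s‖⁻¹ • t
      have ha : s = ‖s‖ • a := (smul_inv_smul₀ hs'.ne' s).symm
      have hb : s + t = ‖s‖ • (a + b) := by
        rw [smul_add, ← ha, smul_inv_smul₀ hs'.ne' t]
      have hna : ‖a‖ = 1 := norm_smul_inv_norm hs
      have hnb : ‖b‖ ≤ η := by
        rw [norm_smul, norm_inv, norm_norm, inv_mul_le_iff₀ hs', mul_comm]
        exact h
      have h1 := huc (a + b) (by
        rw [mem_closedBall_zero_iff]
        exact (norm_add_le _ _).trans (by linarith)) a (by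
        rw [mem_closedBall_zero_iff, hna]; norm_num) (by
        rw [dist_eq_norm, add_sub_cancel_left]
        exact hnb.trans_lt (lt_of_le_of_lt (min_le_left _ _) (by linarith)))
      have h2 : D (s + t) - D s = ‖s‖ ^ (p - 1) • (D (a + b) - D a) := by
        rw [hb, smul_sub, hD, fderiv_norm_rpow_smul hp hs', ← fderiv_norm_rpow_smul hp hs' a, ← ha]
      rw [dist_eq_norm] at h1
      rw [h2, norm_smul, Real.norm_of_nonneg (by positivity)]
      have h3 : ‖s‖ ^ (p - 1) ≤ (1 + ‖s‖) ^ (p - 1) := by gcongr; linarith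
      calc ‖s‖ ^ (p - 1) * ‖D (a + b) - D a‖ ≤ (1 + ‖s‖) ^ (p - 1) * ε := by gcongr
        _ ≤ _ := by linarith
  · have hst : ‖s‖ ≤ 1 / η * ‖t‖ := by
      rw [div_mul_eq_mul_div, le_div_iff₀ hη0]; linarith
    have hst' : ‖s + t‖ ≤ (1 / η + 1) * ‖t‖ := (norm_add_le _ _).trans (by linarith)
    refine (norm_sub_le _ _).trans ?_
    rw [hD, norm_fderiv_norm_rpow_eq hp, norm_fderiv_norm_rpow_eq hp]
    have h1 : ‖s‖ ^ (p - 1) ≤ (1 / η) ^ (p - 1) * ‖t‖ ^ (p - 1) := by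
      rw [← Real.mul_rpow (by positivity) (norm_nonneg _)]; gcongr
    have h2 : ‖s + t‖ ^ (p - 1) ≤ (1 / η + 1) ^ (p - 1) * ‖t‖ ^ (p - 1) := by
      rw [← Real.mul_rpow (by positivity) (norm_nonneg _)]; gcongr
    calc p * ‖s + t‖ ^ (p - 1) + p * ‖s‖ ^ (p - 1)
        ≤ p * ((1 / η + 1) ^ (p - 1) * ‖t‖ ^ (p - 1)) +
          p * ((1 / η) ^ (p - 1) * ‖t‖ ^ (p - 1)) := by gcongr
      _ ≤ _ := by linarith

/-- The `p`-th power of the norm is strictly midpoint convex. -/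
lemma norm_midpoint_rpow_lt {p : ℝ} (hp : 1 < p) {a b : E} (hab : a ≠ b) :
    ‖(1 / 2 : ℝ) • (a + b)‖ ^ p < 1 / 2 * ‖a‖ ^ p + 1 / 2 * ‖b‖ ^ p := by
  have hle : ‖(1 / 2 : ℝ) • (a + b)‖ ≤ 1 / 2 * ‖a‖ + 1 / 2 * ‖b‖ := by
    rw [norm_smul, Real.norm_of_nonneg (by norm_num)]
    linarith [norm_add_le a b]
  -- For equal norms the strictness comes from the triangle inequality, whose equality case would
  -- put `a` and `b` on one ray; for different norms it comes from strict convexity of `x ↦ x^p`.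
  rcases eq_or_ne ‖a‖ ‖b‖ with h | h
  · have hlt : ‖(1 / 2 : ℝ) • (a + b)‖ < ‖b‖ := by
      rw [norm_smul, Real.norm_of_nonneg (by norm_num)]
      have : ‖a + b‖ < ‖a‖ + ‖b‖ := by
        refine lt_of_le_of_ne (norm_add_le _ _) fun he => hab ?_
        exact (sameRay_iff_norm_add.2 he).eq_of_norm_eq h
      linarith
    rw [h]
    have : ‖(1 / 2 : ℝ) • (a + b)‖ ^ p < ‖b‖ ^ p := by gcongr
    linarith
  · have h1 := (strictConvexOn_rpow hp).2 (norm_nonneg a) (norm_nonneg b) h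
      (by norm_num : (0 : ℝ) < 1 / 2) (by norm_num : (0 : ℝ) < 1 / 2) (by norm_num)
    simp only [smul_eq_mul] at h1
    refine lt_of_le_of_lt ?_ h1
    gcongr

/-- Uniform convexity of the `p`-th power of the norm, in pointwise form. -/
lemma exists_norm_sub_rpow_le [FiniteDimensional ℝ E] {p : ℝ} (hp : 1 < p) {ε : ℝ} (hε : 0 < ε) :
    ∃ C, 0 ≤ C ∧ ∀ a b : E, ‖a - b‖ ^ p ≤ ε * (‖a‖ ^ p + ‖b‖ ^ p) +
      C * (1 / 2 * ‖a‖ ^ p + 1 / 2 * ‖b‖ ^ p - ‖(1 / 2 : ℝ) • (a + b)‖ ^ p) := by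
  have hp0 : 0 < p := by linarith
  let gap : E × E → ℝ := fun z =>
    1 / 2 * ‖z.1‖ ^ p + 1 / 2 * ‖z.2‖ ^ p - ‖(1 / 2 : ℝ) • (z.1 + z.2)‖ ^ p
  have hgap0 : ∀ z, 0 ≤ gap z := by
    rintro ⟨a, b⟩
    rcases eq_or_ne a b with rfl | h
    · have : (1 / 2 : ℝ) • (a + a) = a := by rw [← two_smul ℝ, smul_smul]; norm_num
      simp only [gap, this]; linarith
    · exact (sub_pos.2 (norm_midpoint_rpow_lt hp h)).le
  have hcn : Continuous fun x : E => ‖x‖ ^ p := continuous_norm.rpow_const fun _ => Or.inr hp0.le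
  have hgapc : Continuous gap := by
    refine ((continuous_const.mul (hcn.comp continuous_fst)).add
      (continuous_const.mul (hcn.comp continuous_snd))).sub
      (hcn.comp ((continuous_fst.add continuous_snd).const_smul _))
  -- On this compact set of normalized, well separated pairs the convexity gap has a positive
  -- minimum `η`. Homogeneity carries this bound to all pairs with `‖a - b‖^p ≥ ε n^p`, where `n` is
  -- the maximum of the two norms; the remaining pairs are covered by the `ε`-term.
  let S : Set (E × E) := Metric.sphere 0 1 ∩ {z | ε ≤ ‖z.1 - z.2‖ ^ p}
  have hS : IsCompact S := (isCompact_sphere _ _).inter_right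
    (isClosed_le continuous_const (hcn.comp (continuous_fst.sub continuous_snd)))
  obtain ⟨η, hη0, hη⟩ : ∃ η, 0 < η ∧ ∀ z ∈ S, η ≤ gap z := by
    rcases S.eq_empty_or_nonempty with h | h
    · exact ⟨1, one_pos, by simp [h]⟩
    · obtain ⟨z, hz, hmin⟩ := hS.exists_isMinOn h hgapc.continuousOn
      refine ⟨gap z, sub_pos.2 (norm_midpoint_rpow_lt hp ?_), fun y hy => hmin hy⟩
      intro he
      have := hz.2
      simp only [Set.mem_ofPred_eq, he, sub_self, norm_zero, Real.zero_rpow hp0.ne'] at this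
      linarith
  refine ⟨2 ^ p / η, by positivity, fun a b => ?_⟩
  change ‖a - b‖ ^ p ≤ ε * (‖a‖ ^ p + ‖b‖ ^ p) + 2 ^ p / η * gap (a, b)
  set n := ‖((a, b) : E × E)‖ with hn
  rcases eq_or_ne n 0 with h0 | h0
  · rw [hn, norm_eq_zero, Prod.mk_eq_zero] at h0
    obtain ⟨rfl, rfl⟩ := h0
    simp [gap, Real.zero_rpow hp0.ne']
  · have hn0 : 0 < n := lt_of_le_of_ne (norm_nonneg _) h0.symm
    have hnp : 0 < n ^ p := by positivity
    have hnn : n ^ p ≤ ‖a‖ ^ p + ‖b‖ ^ p := by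
      have : n = max ‖a‖ ‖b‖ := rfl
      have h1 := Real.rpow_nonneg (norm_nonneg a) p
      have h2 := Real.rpow_nonneg (norm_nonneg b) p
      rw [this]
      rcases max_choice ‖a‖ ‖b‖ with h | h <;> rw [h] <;> linarith
    have hg := hgap0 (a, b)
    rcases lt_or_ge (‖a - b‖ ^ p) (ε * n ^ p) with h | h
    · have h1 : 0 ≤ 2 ^ p / η * gap (a, b) := by positivity
      have h2 : ε * n ^ p ≤ ε * (‖a‖ ^ p + ‖b‖ ^ p) := by gcongr
      linarith
    · have hscale : ∀ x : E, ‖n⁻¹ • x‖ ^ p = (n ^ p)⁻¹ * ‖x‖ ^ p := by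
        intro x
        rw [norm_smul, Real.mul_rpow (norm_nonneg _) (norm_nonneg _),
          Real.norm_of_nonneg (by positivity), Real.inv_rpow hn0.le]
      have hmem : (n⁻¹ • a, n⁻¹ • b) ∈ S := by
        refine ⟨?_, ?_⟩
        · rw [mem_sphere_zero_iff_norm, ← Prod.smul_mk, norm_smul, norm_inv, ← hn,
            Real.norm_of_nonneg hn0.le, inv_mul_cancel₀ h0]
        · simp only [Set.mem_ofPred_eq]
          rw [← smul_sub, hscale, ← div_eq_inv_mul, le_div_iff₀ hnp]
          exact h
      have h1 := hη _ hmem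
      have h2 : gap (n⁻¹ • a, n⁻¹ • b) = (n ^ p)⁻¹ * gap (a, b) := by
        simp only [gap]
        rw [← smul_add, smul_comm, hscale, hscale, hscale]; ring
      rw [h2, ← div_eq_inv_mul, le_div_iff₀ hnp] at h1
      have h3 : ‖a - b‖ ^ p ≤ 2 ^ p * n ^ p := by
        rw [← Real.mul_rpow (by norm_num) hn0.le]
        gcongr
        have h4 : ‖a‖ ≤ n := norm_fst_le (a, b)
        have h5 : ‖b‖ ≤ n := norm_snd_le (a, b)
        linarith [norm_sub_le a b]
      have h4 : 2 ^ p * n ^ p ≤ 2 ^ p / η * gap (a, b) := by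
        rw [div_mul_eq_mul_div, le_div_iff₀ hη0]
        nlinarith [Real.rpow_nonneg (by norm_num : (0 : ℝ) ≤ 2) p]
      have h5 : 0 ≤ ε * (‖a‖ ^ p + ‖b‖ ^ p) := by positivity
      linarith

end power

end

section

/-! ### Differentiability of integral functionals and convexity in `L^p` -/

section integralFunctional

variable {α : Type*} {mα : MeasurableSpace α} {ν : Measure α}
  {E : Type*} [NormedAddCommGroup E] {r : ℝ} [hr : Fact (1 < r)]

lemma integrable_norm_rpow_Lp (ξ : Lp E (ENNReal.ofReal r) ν) :
    Integrable (fun x => ‖ξ x‖ ^ r) ν := by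
  have h0 : 0 < r := zero_lt_one.trans hr.out
  have := (Lp.memLp ξ).integrable_norm_rpow (by simpa using h0) ENNReal.ofReal_ne_top
  rwa [ENNReal.toReal_ofReal h0.le] at this

lemma norm_rpow_Lp (ξ : Lp E (ENNReal.ofReal r) ν) : ‖ξ‖ ^ r = ∫ x, ‖ξ x‖ ^ r ∂ν := by
  have h0 : 0 < r := zero_lt_one.trans hr.out
  have hi : 0 ≤ ∫ x, ‖ξ x‖ ^ r ∂ν := integral_nonneg fun x => by positivity
  rw [Lp.norm_def, (Lp.memLp ξ).eLpNorm_eq_integral_rpow_norm (by simpa using h0)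
    ENNReal.ofReal_ne_top, ENNReal.toReal_ofReal h0.le, ENNReal.toReal_ofReal (by positivity),
    ← Real.rpow_mul hi, inv_mul_cancel₀ h0.ne', Real.rpow_one]

variable [IsFiniteMeasure ν]

lemma integrable_one_add_norm_rpow_Lp (ξ : Lp E (ENNReal.ofReal r) ν) :
    Integrable (fun x => (1 + ‖ξ x‖) ^ r) ν := by
  have h0 : 0 < r := zero_lt_one.trans hr.out
  have h1 : MemLp (fun x => 1 + ‖ξ x‖) (ENNReal.ofReal r) ν :=
    MemLp.add (memLp_const (1 : ℝ)) (Lp.memLp ξ).norm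
  have h2 := h1.integrable_norm_rpow (by simpa using h0) ENNReal.ofReal_ne_top
  rw [ENNReal.toReal_ofReal h0.le] at h2
  have h3 : ∀ x, ‖1 + ‖ξ x‖‖ = 1 + ‖ξ x‖ := fun x => Real.norm_of_nonneg (by positivity)
  simpa only [h3] using h2

lemma integrable_weight_mul_norm (ξ η : Lp E (ENNReal.ofReal r) ν) :
    Integrable (fun x => (1 + ‖ξ x‖) ^ (r - 1) * ‖η x‖) ν := by
  have h0 : 0 < r := zero_lt_one.trans hr.out
  refine ((integrable_one_add_norm_rpow_Lp ξ).add (integrable_norm_rpow_Lp η)).mono ?_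
    (.of_forall fun x => ?_)
  · refine AEStronglyMeasurable.mul ?_ (Lp.aestronglyMeasurable η).norm
    have hc : Continuous fun y : E => (1 + ‖y‖) ^ (r - 1) :=
      (by fun_prop : Continuous fun y : E => 1 + ‖y‖).rpow_const
        fun _ => Or.inr (by linarith [hr.out])
    exact hc.comp_aestronglyMeasurable (Lp.aestronglyMeasurable ξ)
  · rw [Real.norm_of_nonneg (by positivity)]
    refine (rpow_sub_one_mul_le (by positivity) (norm_nonneg _) hr.out).trans (le_abs_self _)

/-- This plays the role of Hölder's inequality: the scaled pointwise bound is integrated with `τ =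
‖η‖`, for which the normalized term `∫ ‖η‖^r / τ^r` equals `1`. -/
lemma integral_weight_mul_norm_le (ξ η : Lp E (ENNReal.ofReal r) ν) :
    ∫ x, (1 + ‖ξ x‖) ^ (r - 1) * ‖η x‖ ∂ν ≤ (∫ x, (1 + ‖ξ x‖) ^ r ∂ν + 1) * ‖η‖ := by
  have h0 : 0 < r := zero_lt_one.trans hr.out
  rcases eq_or_ne η 0 with rfl | hη
  · rw [norm_zero, mul_zero]
    refine (integral_eq_zero_of_ae ?_).le
    filter_upwards [Lp.coeFn_zero E (ENNReal.ofReal r) ν] with x hx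
    rw [hx]; simp
  · have hτ : 0 < ‖η‖ := norm_pos_iff.2 hη
    calc ∫ x, (1 + ‖ξ x‖) ^ (r - 1) * ‖η x‖ ∂ν
        ≤ ∫ x, ‖η‖ * ((1 + ‖ξ x‖) ^ r + ‖η x‖ ^ r / ‖η‖ ^ r) ∂ν := by
          refine integral_mono (integrable_weight_mul_norm ξ η)
            (((integrable_one_add_norm_rpow_Lp ξ).add
              ((integrable_norm_rpow_Lp η).div_const _)).const_mul _) fun x => ?_
          exact rpow_sub_one_mul_le_scaled (by positivity) (norm_nonneg _) hr.out hτ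
      _ = _ := by
          rw [integral_const_mul, integral_add (integrable_one_add_norm_rpow_Lp ξ)
            ((integrable_norm_rpow_Lp η).div_const _), integral_div, ← norm_rpow_Lp,
            div_self (by positivity)]
          ring

variable [NormedSpace ℝ E] {Φ : E → ℝ} {Φ' : E → E →L[ℝ] ℝ}

namespace TameGrowth

lemma integrable_comp (h : TameGrowth r Φ Φ') (ξ : Lp E (ENNReal.ofReal r) ν) :
    Integrable (fun x => Φ (ξ x)) ν := by
  obtain ⟨C, hC0, hC⟩ := h.exists_abs_le hr.out
  refine (((integrable_one_add_norm_rpow_Lp ξ).const_mul C).add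
    (integrable_const |Φ 0|)).mono
    (h.continuous.comp_aestronglyMeasurable (Lp.aestronglyMeasurable ξ)) (.of_forall fun x => ?_)
  rw [Real.norm_eq_abs]
  refine le_trans ?_ (le_abs_self _)
  have := abs_add_le (Φ (ξ x) - Φ 0) (Φ 0)
  rw [sub_add_cancel] at this
  simp only [Pi.add_apply]
  linarith [hC (ξ x)]

omit hr in
lemma norm_deriv_apply_le {C : ℝ} (hC : ∀ s, ‖Φ' s‖ ≤ C * (1 + ‖s‖) ^ (r - 1)) (s t : E) :
    ‖Φ' s t‖ ≤ C * ((1 + ‖s‖) ^ (r - 1) * ‖t‖) := by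
  refine ((Φ' s).le_opNorm t).trans ?_
  rw [← mul_assoc]
  gcongr
  exact hC s

lemma integrable_deriv_apply (h : TameGrowth r Φ Φ') (ξ η : Lp E (ENNReal.ofReal r) ν) :
    Integrable (fun x => Φ' (ξ x) (η x)) ν := by
  obtain ⟨C, hC0, hC⟩ := h.exists_norm_deriv_le hr.out
  refine ((integrable_weight_mul_norm ξ η).const_mul C).mono ?_ (.of_forall fun x => ?_)
  · have hc : Continuous fun z : E × E => Φ' z.1 z.2 :=
      ((h.continuous_deriv hr.out).comp continuous_fst).clm_apply continuous_snd
    exact hc.comp_aestronglyMeasurable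
      ((Lp.aestronglyMeasurable ξ).prodMk (Lp.aestronglyMeasurable η))
  · exact (norm_deriv_apply_le hC _ _).trans (le_abs_self _)

/-- The derivative of `ξ ↦ ∫ Φ(ξ)` at `ξ`. -/
noncomputable def integralDeriv (h : TameGrowth r Φ Φ') (ξ : Lp E (ENNReal.ofReal r) ν) :
    Lp E (ENNReal.ofReal r) ν →L[ℝ] ℝ :=
  LinearMap.mkContinuousOfExistsBound
    { toFun := fun η => ∫ x, Φ' (ξ x) (η x) ∂ν
      map_add' := fun η ζ => by
        rw [← integral_add (h.integrable_deriv_apply ξ η) (h.integrable_deriv_apply ξ ζ)]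
        refine integral_congr_ae ?_
        filter_upwards [Lp.coeFn_add η ζ] with x hx
        rw [hx, Pi.add_apply, map_add]
      map_smul' := fun c η => by
        rw [RingHom.id_apply, smul_eq_mul, ← integral_const_mul]
        refine integral_congr_ae ?_
        filter_upwards [Lp.coeFn_smul c η] with x hx
        rw [hx, Pi.smul_apply, map_smul, smul_eq_mul] }
    (by
      obtain ⟨C, hC0, hC⟩ := h.exists_norm_deriv_le hr.out
      refine ⟨C * (∫ x, (1 + ‖ξ x‖) ^ r ∂ν + 1), fun η => ?_⟩
      calc ‖∫ x, Φ' (ξ x) (η x) ∂ν‖ ≤ ∫ x, C * ((1 + ‖ξ x‖) ^ (r - 1) * ‖η x‖) ∂ν :=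
            norm_integral_le_of_norm_le ((integrable_weight_mul_norm ξ η).const_mul C)
              (.of_forall fun x => norm_deriv_apply_le hC _ _)
        _ ≤ _ := by
            rw [integral_const_mul, mul_assoc]
            gcongr
            exact integral_weight_mul_norm_le ξ η)

lemma integralDeriv_apply (h : TameGrowth r Φ Φ') (ξ η : Lp E (ENNReal.ofReal r) ν) :
    h.integralDeriv ξ η = ∫ x, Φ' (ξ x) (η x) ∂ν := rfl

/-- Integral functionals with tame growth are Fréchet differentiable on `L^r`. -/
theorem hasFDerivAt_integral (h : TameGrowth r Φ Φ') (ξ : Lp E (ENNReal.ofReal r) ν) :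
    HasFDerivAt (fun ζ : Lp E (ENNReal.ofReal r) ν => ∫ x, Φ (ζ x) ∂ν) (h.integralDeriv ξ) ξ := by
  have hr0 : 0 < r := zero_lt_one.trans hr.out
  rw [hasFDerivAt_iff_isLittleO_nhds_zero, isLittleO_iff]
  intro c hc
  set A := ∫ x, (1 + ‖ξ x‖) ^ r ∂ν with hA
  have hA0 : 0 ≤ A := integral_nonneg fun x => by positivity
  -- With this `ε` the weighted part of the remainder integrates to at most `c/2 ‖η‖`; the other
  -- part is `C ‖η‖^{r-1} ‖η‖`, which is of higher order because `r > 1`.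
  obtain ⟨C, hC0, hC⟩ := h.exists_remainder_le hr.out (ε := c / 2 / (A + 1)) (by positivity)
  have hsmall : ∀ᶠ η : Lp E (ENNReal.ofReal r) ν in 𝓝 0, C * ‖η‖ ^ (r - 1) ≤ c / 2 := by
    have hcont : Continuous fun η : Lp E (ENNReal.ofReal r) ν => C * ‖η‖ ^ (r - 1) :=
      continuous_const.mul (continuous_norm.rpow_const fun _ => Or.inr (by linarith [hr.out]))
    have h0 := hcont.tendsto 0
    rw [norm_zero, Real.zero_rpow (by linarith [hr.out] : r - 1 ≠ 0), mul_zero] at h0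
    filter_upwards [h0.eventually (gt_mem_nhds (half_pos hc))] with η hη using hη.le
  filter_upwards [hsmall] with η hη
  have e : ∫ x, Φ ((ξ + η) x) ∂ν - ∫ x, Φ (ξ x) ∂ν - h.integralDeriv ξ η =
      ∫ x, (Φ (ξ x + η x) - Φ (ξ x) - Φ' (ξ x) (η x)) ∂ν := by
    have hae : (fun x => Φ ((ξ + η) x)) =ᵐ[ν] fun x => Φ (ξ x + η x) := by
      filter_upwards [Lp.coeFn_add ξ η] with x hx
      rw [hx, Pi.add_apply]
    have hi := (h.integrable_comp (ξ + η)).congr hae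
    have hi' : Integrable (fun x => Φ (ξ x + η x) - Φ (ξ x)) ν := hi.sub (h.integrable_comp ξ)
    rw [integral_congr_ae hae, integralDeriv_apply,
      integral_sub hi' (h.integrable_deriv_apply ξ η),
      integral_sub hi (h.integrable_comp ξ)]
  rw [e]
  have hw := integrable_weight_mul_norm ξ η
  have hn := integrable_norm_rpow_Lp η
  calc ‖∫ x, (Φ (ξ x + η x) - Φ (ξ x) - Φ' (ξ x) (η x)) ∂ν‖
      ≤ ∫ x, (c / 2 / (A + 1) * ((1 + ‖ξ x‖) ^ (r - 1) * ‖η x‖) + C * ‖η x‖ ^ r) ∂ν :=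
        norm_integral_le_of_norm_le ((hw.const_mul _).add (hn.const_mul _))
          (.of_forall fun x => hC _ _)
    _ = c / 2 / (A + 1) * ∫ x, (1 + ‖ξ x‖) ^ (r - 1) * ‖η x‖ ∂ν + C * ‖η‖ ^ r := by
        rw [integral_add (hw.const_mul _) (hn.const_mul _), integral_const_mul,
          integral_const_mul, norm_rpow_Lp]
    _ ≤ c / 2 / (A + 1) * ((A + 1) * ‖η‖) + C * ‖η‖ ^ r := by
        gcongr
        exact integral_weight_mul_norm_le ξ η
    _ = c / 2 * ‖η‖ + C * ‖η‖ ^ (r - 1) * ‖η‖ := by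
        have : ‖η‖ ^ r = ‖η‖ ^ (r - 1) * ‖η‖ := by
          rw [← Real.rpow_add_one' (norm_nonneg _) (by linarith), sub_add_cancel]
        rw [this, ← mul_assoc, div_mul_cancel₀ _ (by positivity), mul_assoc]
    _ ≤ c / 2 * ‖η‖ + c / 2 * ‖η‖ := by gcongr
    _ = c * ‖η‖ := by ring

lemma continuous_integral (h : TameGrowth r Φ Φ') :
    Continuous (fun ζ : Lp E (ENNReal.ofReal r) ν => ∫ x, Φ (ζ x) ∂ν) :=
  continuous_iff_continuousAt.2 fun ξ => (h.hasFDerivAt_integral ξ).continuousAt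

end TameGrowth

end integralFunctional

/-- Uniform convexity of the `p`-th power of the `L^p` norm. -/
lemma exists_Lp_norm_sub_rpow_le {α : Type*} {mα : MeasurableSpace α} (ν : Measure α)
    (E : Type*) [NormedAddCommGroup E] [InnerProductSpace ℝ E] [FiniteDimensional ℝ E]
    (p : ℝ) [hp : Fact (1 < p)] {ε : ℝ} (hε : 0 < ε) :
    ∃ C, 0 ≤ C ∧ ∀ a b : Lp E (ENNReal.ofReal p) ν, ‖a - b‖ ^ p ≤ ε * (‖a‖ ^ p + ‖b‖ ^ p) +
      C * (1 / 2 * ‖a‖ ^ p + 1 / 2 * ‖b‖ ^ p - ‖(1 / 2 : ℝ) • (a + b)‖ ^ p) := by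
  obtain ⟨C, hC0, hC⟩ := exists_norm_sub_rpow_le (E := E) hp.out hε
  refine ⟨C, hC0, fun a b => ?_⟩
  have ia := integrable_norm_rpow_Lp a
  have ib := integrable_norm_rpow_Lp b
  have im := integrable_norm_rpow_Lp ((1 / 2 : ℝ) • (a + b))
  simp only [norm_rpow_Lp]
  have iab : Integrable (fun x => ‖a x‖ ^ p + ‖b x‖ ^ p) ν := ia.add ib
  have ih : Integrable (fun x => 1 / 2 * ‖a x‖ ^ p + 1 / 2 * ‖b x‖ ^ p) ν :=
    (ia.const_mul _).add (ib.const_mul _)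
  have ig : Integrable (fun x => 1 / 2 * ‖a x‖ ^ p + 1 / 2 * ‖b x‖ ^ p -
      ‖((1 / 2 : ℝ) • (a + b)) x‖ ^ p) ν := ih.sub im
  rw [← integral_add ia ib, ← integral_const_mul, ← integral_const_mul, ← integral_const_mul,
    ← integral_add (ia.const_mul _) (ib.const_mul _), ← integral_sub ih im,
    ← integral_const_mul, ← integral_add (iab.const_mul _) (ig.const_mul _)]
  refine integral_mono_ae (integrable_norm_rpow_Lp _)
    ((iab.const_mul _).add (ig.const_mul _)) ?_
  filter_upwards [Lp.coeFn_sub a b, Lp.coeFn_smul (1 / 2 : ℝ) (a + b), Lp.coeFn_add a b]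
    with x h1 h2 h3
  have := hC (a x) (b x)
  simp only [h1, h2, h3, Pi.sub_apply, Pi.smul_apply, Pi.add_apply]
  exact this

end

section

/-! ### The space `W_0^{1,p}` -/

/-- `φ ∈ C_c^∞(Ω)`. -/
structure IsTest {N : ℕ} (Ω : Set (Space N)) (φ : Space N → ℝ) : Prop where
  contDiff : ContDiff ℝ ∞ φ
  hasCompactSupport : HasCompactSupport φ
  tsupport_subset : tsupport φ ⊆ Ω

lemma norm_gradient {N : ℕ} (φ : Space N → ℝ) (x : Space N) : ‖gradient φ x‖ = ‖fderiv ℝ φ x‖ :=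
  LinearIsometryEquiv.norm_map _ _

namespace IsTest

variable {N : ℕ} {Ω : Set (Space N)} {φ : Space N → ℝ}

lemma continuous_gradient (h : IsTest Ω φ) : Continuous (gradient φ) :=
  (LinearIsometryEquiv.continuous _).comp (h.contDiff.continuous_fderiv (by simp))

lemma hasCompactSupport_gradient (h : IsTest Ω φ) : HasCompactSupport (gradient φ) :=
  (h.hasCompactSupport.fderiv (𝕜 := ℝ)).comp_left (map_zero _)

lemma support_subset (h : IsTest Ω φ) : Function.support φ ⊆ Ω :=
  (subset_tsupport φ).trans h.tsupport_subset

lemma support_gradient_subset (h : IsTest Ω φ) : Function.support (gradient φ) ⊆ Ω := by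
  refine subset_trans (fun x hx => ?_) ((support_fderiv_subset ℝ).trans h.tsupport_subset)
  rw [Function.mem_support, ← norm_ne_zero_iff, norm_gradient, norm_ne_zero_iff] at hx
  exact hx

lemma memLp (h : IsTest Ω φ) (r : ℝ≥0∞) (ν : Measure (Space N)) [IsFiniteMeasureOnCompacts ν] :
    MemLp φ r ν :=
  h.contDiff.continuous.memLp_of_hasCompactSupport h.hasCompactSupport

lemma memLp_gradient (h : IsTest Ω φ) (r : ℝ≥0∞) (ν : Measure (Space N))
    [IsFiniteMeasureOnCompacts ν] : MemLp (gradient φ) r ν :=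
  h.continuous_gradient.memLp_of_hasCompactSupport h.hasCompactSupport_gradient

end IsTest

variable {N : ℕ} {Ω : Set (Space N)} {p : ℝ} [hp : Fact (1 < p)]

instance : CompleteSpace (sobolevZero N Ω p) :=
  (Submodule.isClosed_topologicalClosure (testPairs N Ω p)).completeSpace_coe

/-- The element of `W_0^{1,p}(Ω)` given by a test function. -/
lemma IsTest.exists_sobolevZero {φ : Space N → ℝ} (h : IsTest Ω φ) :
    ∃ u : sobolevZero N Ω p, val u =ᵐ[volume.restrict Ω] φ ∧
      grad u =ᵐ[volume.restrict Ω] gradient φ := by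
  have h1 := h.memLp (ENNReal.ofReal p) (volume.restrict Ω)
  have h2 := h.memLp_gradient (ENNReal.ofReal p) (volume.restrict Ω)
  refine ⟨⟨(h1.toLp φ, h2.toLp _), Submodule.le_topologicalClosure _ ?_⟩, h1.coeFn_toLp,
    h2.coeFn_toLp⟩
  exact ⟨φ, h.contDiff, h.hasCompactSupport, h.tsupport_subset, h1.coeFn_toLp, h2.coeFn_toLp⟩

lemma memLp_val (u : sobolevZero N Ω p) :
    MemLp (val u) (ENNReal.ofReal p) (volume.restrict Ω) := Lp.memLp _

lemma memLp_grad (u : sobolevZero N Ω p) :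
    MemLp (grad u) (ENNReal.ofReal p) (volume.restrict Ω) := Lp.memLp _

lemma gradNorm_eq (u : sobolevZero N Ω p) : gradNorm u = ‖u.1.2‖ := by
  have h0 : 0 < p := zero_lt_one.trans hp.out
  have := norm_rpow_Lp u.1.2
  rw [gradNorm, one_div]
  change (∫ x in Ω, ‖u.1.2 x‖ ^ p) ^ p⁻¹ = _
  rw [← this, Real.rpow_rpow_inv (norm_nonneg _) h0.ne']

lemma integral_grad_rpow (u : sobolevZero N Ω p) :
    ∫ x in Ω, ‖grad u x‖ ^ p = ‖u.1.2‖ ^ p := (norm_rpow_Lp u.1.2).symm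

lemma eLpNorm_grad (u : sobolevZero N Ω p) :
    eLpNorm (grad u) (ENNReal.ofReal p) (volume.restrict Ω) = ENNReal.ofReal (gradNorm u) := by
  rw [gradNorm_eq, Lp.norm_def, ENNReal.ofReal_toReal (Lp.eLpNorm_ne_top _)]; rfl

lemma gradNorm_nonneg (u : sobolevZero N Ω p) : 0 ≤ gradNorm u := by
  rw [gradNorm_eq]; exact norm_nonneg _

lemma gradNorm_le_norm (u : sobolevZero N Ω p) : gradNorm u ≤ ‖u‖ := by
  rw [gradNorm_eq]; exact norm_snd_le u.1

lemma continuous_gradNorm : Continuous (gradNorm : sobolevZero N Ω p → ℝ) := by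
  rw [funext gradNorm_eq]
  exact continuous_norm.comp (continuous_snd.comp continuous_subtype_val)

@[simp] lemma gradNorm_zero : gradNorm (0 : sobolevZero N Ω p) = 0 := by
  rw [gradNorm_eq]; simp

lemma gradNorm_smul (c : ℝ) (u : sobolevZero N Ω p) : gradNorm (c • u) = |c| * gradNorm u := by
  rw [gradNorm_eq, gradNorm_eq]; exact norm_smul c u.1.2

lemma gradNorm_add_le (u v : sobolevZero N Ω p) : gradNorm (u + v) ≤ gradNorm u + gradNorm v := by
  simp only [gradNorm_eq]; exact norm_add_le u.1.2 v.1.2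

lemma gradNorm_sub (u v : sobolevZero N Ω p) : gradNorm (u - v) = ‖u.1.2 - v.1.2‖ := by
  rw [gradNorm_eq]; rfl

lemma val_add (u v : sobolevZero N Ω p) :
    val (u + v) =ᵐ[volume.restrict Ω] val u + val v := Lp.coeFn_add _ _

lemma val_smul (c : ℝ) (u : sobolevZero N Ω p) :
    val (c • u) =ᵐ[volume.restrict Ω] c • val u := Lp.coeFn_smul _ _

lemma val_zero : val (0 : sobolevZero N Ω p) =ᵐ[volume.restrict Ω] 0 := Lp.coeFn_zero _ _ _

/-- A closed property of all test functions holds on `W_0^{1,p}(Ω)`. -/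
lemma sobolevZero_induction {P : sobolevZero N Ω p → Prop} (hP : IsClosed {u | P u})
    (htest : ∀ φ, IsTest Ω φ → ∀ u : sobolevZero N Ω p, val u =ᵐ[volume.restrict Ω] φ →
      grad u =ᵐ[volume.restrict Ω] gradient φ → P u) (u : sobolevZero N Ω p) : P u := by
  obtain ⟨w, hw, hlim⟩ := mem_closure_iff_seq_limit.1 u.2
  let w' : ℕ → sobolevZero N Ω p := fun n => ⟨w n, Submodule.le_topologicalClosure _ (hw n)⟩
  have h1 : Tendsto w' atTop (𝓝 u) := tendsto_subtype_rng.2 hlim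
  refine hP.mem_of_tendsto h1 (.of_forall fun n => ?_)
  obtain ⟨φ, h1, h2, h3, h4, h5⟩ := hw n
  exact htest φ ⟨h1, h2, h3⟩ (w' n) h4 h5

/-- Convergence in `W_0^{1,p}(Ω)` gives a.e. convergence of a subsequence. -/
lemma exists_subseq_tendsto_ae {u : ℕ → sobolevZero N Ω p} {v : sobolevZero N Ω p}
    (h : Tendsto u atTop (𝓝 v)) : ∃ ns : ℕ → ℕ, StrictMono ns ∧
      (∀ᵐ x ∂volume.restrict Ω, Tendsto (fun n => val (u (ns n)) x) atTop (𝓝 (val v x))) := by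
  have h1 : Tendsto (fun n => (u n).1.1) atTop (𝓝 v.1.1) :=
    (continuous_fst.comp continuous_subtype_val).continuousAt.tendsto.comp h
  exact (tendstoInMeasure_of_tendsto_Lp h1).exists_seq_tendsto_ae

/-- Fatou's lemma along an a.e. convergent subsequence. Since the topology only controls `L^p`,
lower semicontinuity is what allows exponents `r` for which integrability is not yet known. -/
lemma isClosed_eLpNorm_val_le (r : ℝ≥0∞) (C : ℝ) :
    IsClosed {u : sobolevZero N Ω p |
      eLpNorm (val u) r (volume.restrict Ω) ≤ ENNReal.ofReal (C * gradNorm u)} := by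
  refine IsSeqClosed.isClosed fun u v hu hlim => ?_
  obtain ⟨ns, hns, hae⟩ := exists_subseq_tendsto_ae hlim
  have h1 := Lp.eLpNorm_lim_le_liminf_eLpNorm (p := r) (f := fun n => val (u (ns n)))
    (fun n => (memLp_val _).aestronglyMeasurable) _ hae
  have h2 : Tendsto (fun n => ENNReal.ofReal (C * gradNorm (u (ns n)))) atTop
      (𝓝 (ENNReal.ofReal (C * gradNorm v))) :=
    ENNReal.tendsto_ofReal (((continuous_gradNorm.tendsto v).comp
      (hlim.comp hns.tendsto_atTop)).const_mul C)
  refine h1.trans ((liminf_le_liminf (.of_forall fun n => hu (ns n))).trans h2.liminf_eq.le)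

/-- The Sobolev inequality on `W_0^{1,p}(Ω)`. -/
theorem exists_eLpNorm_val_le (hpN : p < N) :
    ∃ C, 0 ≤ C ∧ ∀ u : sobolevZero N Ω p,
      eLpNorm (val u) (ENNReal.ofReal (N * p / (N - p))) (volume.restrict Ω) ≤
        ENNReal.ofReal (C * gradNorm u) := by
  have h0 : 0 < p := zero_lt_one.trans hp.out
  have hN : (0 : ℝ) < N := h0.trans hpN
  have hps : 0 ≤ N * p / (N - p) := div_nonneg (by positivity) (by linarith)
  set K := SNormLESNormFDerivOfEqConst (E := Space N) ℝ volume p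
  -- For test functions this is the Gagliardo–Nirenberg–Sobolev inequality on the whole space; the
  -- support condition turns the integral of the gradient into one over `Ω`.
  refine ⟨K, K.2, sobolevZero_induction (isClosed_eLpNorm_val_le _ _) ?_⟩
  intro φ hφ u hu hgu
  have h1 := eLpNorm_le_eLpNorm_fderiv_of_eq (μ := (volume : Measure (Space N))) (F := ℝ)
    (u := φ) (hφ.contDiff.of_le (by simp)) hφ.hasCompactSupport (p := p.toNNReal)
    (p' := (N * p / (N - p)).toNNReal) (by simpa using hp.out.le)
    (by rw [finrank_euclideanSpace_fin]; exact_mod_cast hN) (by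
      rw [Real.coe_toNNReal _ hps, NNReal.coe_inv, Real.coe_toNNReal _ h0.le,
        finrank_euclideanSpace_fin]
      have : (N : ℝ) - p ≠ 0 := by linarith
      field_simp)
  rw [Real.coe_toNNReal _ h0.le] at h1
  calc eLpNorm (val u) (ENNReal.ofReal (N * p / (N - p))) (volume.restrict Ω)
      = eLpNorm φ (ENNReal.ofReal (N * p / (N - p))) (volume.restrict Ω) := eLpNorm_congr_ae hu
    _ ≤ eLpNorm φ (ENNReal.ofReal (N * p / (N - p))) volume := eLpNorm_restrict_le _ _ _ _
    _ ≤ K * eLpNorm (fderiv ℝ φ) (ENNReal.ofReal p) volume := h1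
    _ = K * eLpNorm (gradient φ) (ENNReal.ofReal p) volume := by
        rw [eLpNorm_congr_norm_ae (.of_forall fun x => norm_gradient φ x)]
    _ = K * eLpNorm (gradient φ) (ENNReal.ofReal p) (volume.restrict Ω) := by
        rw [eLpNorm_restrict_eq_of_support_subset hφ.support_gradient_subset]
    _ = K * ENNReal.ofReal (gradNorm u) := by rw [← eLpNorm_congr_ae hgu, eLpNorm_grad]
    _ = _ := by rw [ENNReal.ofReal_mul K.coe_nonneg, ENNReal.ofReal_coe_nnreal]

/-- A bound on `‖u‖_{L^r(ν)}` gives a continuous embedding into `L^r(ν)`. -/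
lemma exists_embedding {r : ℝ≥0∞} [Fact (1 ≤ r)] {ν : Measure (Space N)}
    (hν : ν ≪ volume.restrict Ω) {K : ℝ} (hK0 : 0 ≤ K)
    (hK : ∀ u : sobolevZero N Ω p, eLpNorm (val u) r ν ≤ ENNReal.ofReal (K * gradNorm u)) :
    ∃ T : sobolevZero N Ω p →L[ℝ] Lp ℝ r ν, (∀ u, T u =ᵐ[ν] val u) ∧
      ∀ u, ‖T u‖ ≤ K * gradNorm u := by
  have hmem : ∀ u : sobolevZero N Ω p, MemLp (val u) r ν := fun u =>
    ⟨(memLp_val u).aestronglyMeasurable.mono_ac hν, (hK u).trans_lt ENNReal.ofReal_lt_top⟩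
  have hle : ∀ u, ‖(hmem u).toLp (val u)‖ ≤ K * gradNorm u := fun u => by
    rw [Lp.norm_toLp]
    exact ENNReal.toReal_le_of_le_ofReal (mul_nonneg hK0 (gradNorm_nonneg u)) (hK u)
  let L : sobolevZero N Ω p →ₗ[ℝ] Lp ℝ r ν :=
    { toFun := fun u => (hmem u).toLp (val u)
      map_add' := fun u v => by
        rw [← MemLp.toLp_add]
        exact MemLp.toLp_congr _ _ (hν.ae_le (val_add u v))
      map_smul' := fun c u => by
        rw [RingHom.id_apply, ← MemLp.toLp_const_smul]
        exact MemLp.toLp_congr _ _ (hν.ae_le (val_smul c u)) }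
  exact ⟨L.mkContinuous K fun u => (hle u).trans (by gcongr; exact gradNorm_le_norm u),
    fun u => (hmem u).coeFn_toLp, hle⟩

end

section

/-! ### Rellich compactness -/

/-! ### Translations in `L^1` -/

section translation

variable {N : ℕ}

/-- The fundamental theorem of calculus along the segment from `x` to `x + z`. -/
lemma enorm_sub_le_lintegral_gradient {φ : Space N → ℝ} (h : ContDiff ℝ 1 φ) (x z : Space N) :
    ‖φ (x + z) - φ x‖ₑ ≤ ‖z‖ₑ * ∫⁻ s in Set.Ioc (0 : ℝ) 1, ‖gradient φ (x + s • z)‖ₑ := by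
  have hd : ∀ s : ℝ, HasDerivAt (fun s : ℝ => φ (x + s • z)) (fderiv ℝ φ (x + s • z) z) s := by
    intro s
    have h1 : HasDerivAt (fun s : ℝ => x + s • z) z s := by
      simpa using ((hasDerivAt_id s).smul_const z).const_add x
    exact ((h.differentiable one_ne_zero _).hasFDerivAt).comp_hasDerivAt s h1
  have hc : Continuous fun s : ℝ => fderiv ℝ φ (x + s • z) z :=
    ((h.continuous_fderiv one_ne_zero).comp (by fun_prop)).clm_apply continuous_const
  have h2 := intervalIntegral.integral_eq_sub_of_hasDerivAt (fun s _ => hd s)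
    (hc.intervalIntegrable 0 1)
  simp only [one_smul, zero_smul, add_zero] at h2
  rw [← h2, intervalIntegral.integral_of_le zero_le_one]
  refine (enorm_integral_le_lintegral_enorm _).trans ?_
  rw [← lintegral_const_mul' _ _ enorm_ne_top]
  refine lintegral_mono fun s => ?_
  have h3 := (fderiv ℝ φ (x + s • z)).le_opNorm z
  rw [← norm_gradient] at h3
  rw [mul_comm, ← ofReal_norm, ← ofReal_norm, ← ofReal_norm,
    ← ENNReal.ofReal_mul (norm_nonneg _)]
  exact ENNReal.ofReal_le_ofReal h3

/-- Translating a smooth function by `z` changes it by at most `|z| ‖∇φ‖_1` in `L^1`. -/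
lemma lintegral_translate_sub_le {φ : Space N → ℝ} (h : ContDiff ℝ 1 φ) (z : Space N) :
    ∫⁻ x, ‖φ (x + z) - φ x‖ₑ ≤ ‖z‖ₑ * ∫⁻ x, ‖gradient φ x‖ₑ := by
  have hg : Continuous (gradient φ) :=
    (LinearIsometryEquiv.continuous _).comp (h.continuous_fderiv one_ne_zero)
  calc ∫⁻ x, ‖φ (x + z) - φ x‖ₑ
      ≤ ∫⁻ x, ‖z‖ₑ * ∫⁻ s in Set.Ioc (0 : ℝ) 1, ‖gradient φ (x + s • z)‖ₑ :=
        lintegral_mono fun x => enorm_sub_le_lintegral_gradient h x z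
    _ = ‖z‖ₑ * ∫⁻ s in Set.Ioc (0 : ℝ) 1, ∫⁻ x, ‖gradient φ (x + s • z)‖ₑ := by
        rw [lintegral_const_mul' _ _ enorm_ne_top, lintegral_lintegral_swap]
        exact (hg.comp (by fun_prop : Continuous fun q : Space N × ℝ =>
          q.1 + q.2 • z)).enorm.measurable.aemeasurable
    _ = ‖z‖ₑ * ∫⁻ x, ‖gradient φ x‖ₑ := by
        congr 1
        have : ∀ s : ℝ, ∫⁻ x, ‖gradient φ (x + s • z)‖ₑ = ∫⁻ x, ‖gradient φ x‖ₑ := fun s =>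
          lintegral_add_right_eq_self (fun x => ‖gradient φ x‖ₑ) (s • z)
        simp [this]

end translation

/-! ### Averages over grid cubes -/

section cubes

variable {N : ℕ}

/-- The index of the grid cube of side `ε` that contains `x`. -/
noncomputable def cubeIndex (ε : ℝ) (x : Space N) : Fin N → ℤ := fun i => ⌊x i / ε⌋

/-- The grid cube of side `ε` with index `j`. -/
def cube (N : ℕ) (ε : ℝ) (j : Fin N → ℤ) : Set (Space N) := cubeIndex ε ⁻¹' {j}

lemma measurable_cubeIndex (ε : ℝ) : Measurable (cubeIndex ε : Space N → Fin N → ℤ) :=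
  measurable_pi_lambda _ fun i =>
    Int.measurable_floor.comp ((by fun_prop : Continuous fun x : Space N => x i / ε).measurable)

lemma measurableSet_cube (ε : ℝ) (j : Fin N → ℤ) : MeasurableSet (cube N ε j) :=
  measurable_cubeIndex ε (measurableSet_singleton j)

lemma volume_cube {ε : ℝ} (hε : 0 < ε) (j : Fin N → ℤ) :
    volume (cube N ε j) = ENNReal.ofReal (ε ^ N) := by
  have h1 : cube N ε j = (WithLp.ofLp : Space N → Fin N → ℝ) ⁻¹'
      Set.pi Set.univ fun i => Set.Ico (ε * j i) (ε * (j i + 1)) := by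
    ext x
    simp only [cube, Set.mem_preimage, Set.mem_singleton_iff, Set.mem_pi, Set.mem_univ,
      true_implies, Set.mem_Ico, funext_iff, cubeIndex, Int.floor_eq_iff]
    refine forall_congr' fun i => ?_
    rw [le_div_iff₀ hε, div_lt_iff₀ hε, mul_comm, mul_comm ε (_ + 1)]
  rw [h1, (PiLp.volume_preserving_ofLp (Fin N)).measure_preimage
    (MeasurableSet.univ_pi fun i => measurableSet_Ico).nullMeasurableSet, volume_pi_pi]
  have : ∀ i : Fin N, volume (Set.Ico (ε * j i) (ε * (j i + 1))) = ENNReal.ofReal ε := by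
    intro i; rw [Real.volume_Ico]; congr 1; ring
  simp only [this, Finset.prod_const, Finset.card_univ, Fintype.card_fin]
  rw [ENNReal.ofReal_pow hε.le]

/-- Each coordinate differs by less than `ε`. The bound `Nε` instead of the diameter `√N ε` suffices
and avoids the root. -/
lemma norm_sub_le_of_cubeIndex_eq {ε : ℝ} (hε : 0 < ε) {x y : Space N}
    (h : cubeIndex ε x = cubeIndex ε y) : ‖y - x‖ ≤ N * ε := by
  refine abs_le_of_sq_le_sq' ?_ (by positivity) |>.2
  rw [EuclideanSpace.norm_sq_eq]
  have h1 : ∀ i : Fin N, ‖(y - x) i‖ ^ 2 ≤ ε ^ 2 := by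
    intro i
    have h2 := Int.abs_sub_lt_one_of_floor_eq_floor (congrFun h i)
    rw [← sub_div, abs_div, abs_of_pos hε, div_lt_one hε, abs_sub_comm] at h2
    gcongr
    exact h2.le
  refine (Finset.sum_le_sum fun i _ => h1 i).trans ?_
  simp only [Finset.sum_const, Finset.card_univ, Fintype.card_fin, nsmul_eq_mul, mul_pow]
  gcongr
  rcases Nat.eq_zero_or_pos N with rfl | hN
  · simp
  · have : (1 : ℝ) ≤ N := by exact_mod_cast hN
    nlinarith

/-- Averaging over the grid cubes of side `ε` approximates a smooth function in `L^1`. -/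
lemma lintegral_sub_cube_average_le {φ : Space N → ℝ} (h : ContDiff ℝ 1 φ)
    (hs : HasCompactSupport φ) {ε : ℝ} (hε : 0 < ε) :
    ∫⁻ x, ‖φ x - (ε ^ N)⁻¹ * ∫ y in cube N ε (cubeIndex ε x), φ y‖ₑ ≤
      ENNReal.ofReal (N ^ (N + 1) * ε) * volume (Metric.closedBall (0 : Space N) 1) *
        ∫⁻ x, ‖gradient φ x‖ₑ := by
  have hεN : 0 < ε ^ N := by positivity
  set B := Metric.closedBall (0 : Space N) (N * ε) with hB
  -- The cube containing `x` lies in the ball of radius `Nε` about `x`, so the deviation from the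
  -- average is at most a mean of translation differences; these are then controlled in `L^1` by `Nε
  -- ‖∇φ‖_1`.
  have hpt : ∀ x, ‖φ x - (ε ^ N)⁻¹ * ∫ y in cube N ε (cubeIndex ε x), φ y‖ₑ ≤
      ENNReal.ofReal (ε ^ N)⁻¹ * ∫⁻ z in B, ‖φ (x + z) - φ x‖ₑ := by
    intro x
    set Q := cube N ε (cubeIndex ε x)
    have hQ : volume.real Q = ε ^ N := by
      rw [Measure.real, volume_cube hε, ENNReal.toReal_ofReal hεN.le]
    have hfin : volume Q ≠ ⊤ := by rw [volume_cube hε]; exact ENNReal.ofReal_ne_top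
    have hi : IntegrableOn φ Q := (h.continuous.integrable_of_hasCompactSupport hs).integrableOn
    have e : φ x - (ε ^ N)⁻¹ * ∫ y in Q, φ y = -((ε ^ N)⁻¹ * ∫ y in Q, (φ y - φ x)) := by
      rw [integral_sub hi (integrableOn_const hfin), setIntegral_const, hQ, smul_eq_mul]
      field_simp
      ring
    rw [e, enorm_neg, enorm_mul, Real.enorm_of_nonneg (by positivity)]
    gcongr
    refine (enorm_integral_le_lintegral_enorm _).trans ?_
    rw [← lintegral_indicator (measurableSet_cube _ _),
      ← lintegral_indicator Metric.isClosed_closedBall.measurableSet,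
      ← lintegral_add_left_eq_self _ x]
    refine lintegral_mono fun z => ?_
    by_cases hz : x + z ∈ Q
    · have hzB : z ∈ B := by
        rw [hB, mem_closedBall_zero_iff]
        have := norm_sub_le_of_cubeIndex_eq hε (x := x) (y := x + z)
          (Set.mem_singleton_iff.1 hz).symm
        rwa [add_sub_cancel_left] at this
      rw [Set.indicator_of_mem hz, Set.indicator_of_mem hzB]
    · rw [Set.indicator_of_notMem hz]; exact zero_le
  calc ∫⁻ x, ‖φ x - (ε ^ N)⁻¹ * ∫ y in cube N ε (cubeIndex ε x), φ y‖ₑ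
      ≤ ∫⁻ x, ENNReal.ofReal (ε ^ N)⁻¹ * ∫⁻ z in B, ‖φ (x + z) - φ x‖ₑ := lintegral_mono hpt
    _ = ENNReal.ofReal (ε ^ N)⁻¹ * ∫⁻ z in B, ∫⁻ x, ‖φ (x + z) - φ x‖ₑ := by
        rw [lintegral_const_mul' _ _ ENNReal.ofReal_ne_top, lintegral_lintegral_swap]
        have hc := h.continuous
        exact (by fun_prop : Continuous fun q : Space N × Space N =>
          φ (q.1 + q.2) - φ q.1).enorm.measurable.aemeasurable
    _ ≤ ENNReal.ofReal (ε ^ N)⁻¹ * ∫⁻ _ in B, ENNReal.ofReal (N * ε) * ∫⁻ x, ‖gradient φ x‖ₑ := by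
        gcongr 1
        refine setLIntegral_mono measurable_const fun z hz => ?_
        refine (lintegral_translate_sub_le h z).trans ?_
        gcongr
        rw [hB, mem_closedBall_zero_iff] at hz
        rw [← ofReal_norm]
        exact ENNReal.ofReal_le_ofReal hz
    _ = _ := by
        rw [setLIntegral_const, hB, Measure.addHaar_closedBall' _ _ (by positivity),
          finrank_euclideanSpace_fin]
        -- The three factors are the normalization of the average, the largest translation length,
        -- and the scaling of the volume of the ball of translations; the powers of `ε` cancel down
        -- to one.
        have e : ENNReal.ofReal (N ^ (N + 1) * ε) = ENNReal.ofReal (ε ^ N)⁻¹ *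
            ENNReal.ofReal (N * ε) * ENNReal.ofReal ((N * ε) ^ N) := by
          rw [← ENNReal.ofReal_mul (by positivity), ← ENNReal.ofReal_mul (by positivity)]
          congr 1
          field_simp
          ring
        rw [e]; ring

end cubes

end

/-! ### Finite-rank approximation and compactness of the embedding into `L^1` -/

section

variable {N : ℕ} {Ω : Set (Space N)} {p : ℝ} [hp : Fact (1 < p)]

/-- The average over a grid cube, as a functional on `L^1(Ω)`. -/
noncomputable def cubeAverage (Ω : Set (Space N)) (ε : ℝ) (j : Fin N → ℤ) :
    Lp ℝ 1 (volume.restrict Ω) →L[ℝ] ℝ :=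
  (ε ^ N)⁻¹ • (L1.integralCLM (E := ℝ) (μ := (volume.restrict Ω).restrict (cube N ε j))).comp
    (LpToLpRestrictCLM (Space N) ℝ ℝ (volume.restrict Ω) 1 (cube N ε j))

lemma cubeAverage_apply (ε : ℝ) (j : Fin N → ℤ) (u : Lp ℝ 1 (volume.restrict Ω)) :
    cubeAverage Ω ε j u = (ε ^ N)⁻¹ * ∫ x in cube N ε j, u x ∂(volume.restrict Ω) := by
  rw [cubeAverage, smul_apply, ContinuousLinearMap.comp_apply,
    ← L1.integral_eq, L1.integral_eq_integral, smul_eq_mul]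
  congr 1
  exact integral_congr_ae (LpToLpRestrictCLM_coeFn ℝ _ u)

lemma isCompactOperator_finset_sum {ι X Y : Type*} [TopologicalSpace X] [AddCommMonoid X]
    [AddCommMonoid Y] [TopologicalSpace Y] [ContinuousAdd Y] (s : Finset ι) {f : ι → X → Y}
    (hf : ∀ i ∈ s, IsCompactOperator (f i)) : IsCompactOperator (∑ i ∈ s, f i) := by
  classical
  induction s using Finset.induction_on with
  | empty => simpa using isCompactOperator_zero
  | insert a s ha ih =>
    rw [Finset.sum_insert ha]
    exact (hf a (by simp)).add (ih fun i hi => hf i (by simp [hi]))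

lemma finite_image_cubeIndex (hΩb : Bornology.IsBounded Ω) {ε : ℝ} (hε : 0 < ε) :
    (cubeIndex ε '' Ω).Finite := by
  obtain ⟨R, hR⟩ := hΩb.exists_norm_le
  refine (Set.Finite.pi' (t := fun _ : Fin N => Set.Icc ⌊-R / ε⌋ ⌊R / ε⌋)
    fun _ => Set.finite_Icc _ _).subset ?_
  rintro _ ⟨x, hx, rfl⟩ i
  have h1 := abs_le.1 ((PiLp.norm_apply_le x i).trans (hR x hx))
  exact ⟨Int.floor_mono (by gcongr; exact h1.1), Int.floor_mono (by gcongr; exact h1.2)⟩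

lemma setIntegral_cube_restrict {φ : Space N → ℝ} (hφ : Function.support φ ⊆ Ω) (ε : ℝ)
    (j : Fin N → ℤ) :
    ∫ x in cube N ε j, φ x ∂(volume.restrict Ω) = ∫ x in cube N ε j, φ x := by
  rw [Measure.restrict_restrict (measurableSet_cube ε j)]
  refine (setIntegral_eq_of_subset_of_forall_sdiff_eq_zero (measurableSet_cube ε j)
    Set.inter_subset_left fun x hx => ?_).symm
  by_contra h
  exact hx.2 ⟨hx.1, hφ h⟩

/-- The finite rank operator that replaces a function by its averages over grid cubes. -/
noncomputable def cubeProjection (Ω : Set (Space N)) (ε : ℝ) (S : Finset (Fin N → ℤ))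
    [IsFiniteMeasure (volume.restrict Ω)] :
    Lp ℝ 1 (volume.restrict Ω) →L[ℝ] Lp ℝ 1 (volume.restrict Ω) :=
  ∑ j ∈ S, (cubeAverage Ω ε j).smulRight
    (indicatorConstLp 1 (measurableSet_cube ε j) (measure_ne_top _ _) (1 : ℝ))

lemma isCompactOperator_cubeProjection (ε : ℝ) (S : Finset (Fin N → ℤ))
    [IsFiniteMeasure (volume.restrict Ω)] : IsCompactOperator (cubeProjection Ω ε S) := by
  have h : (cubeProjection Ω ε S : Lp ℝ 1 (volume.restrict Ω) → Lp ℝ 1 (volume.restrict Ω)) =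
      ∑ j ∈ S, ⇑((cubeAverage Ω ε j).smulRight
        (indicatorConstLp 1 (measurableSet_cube ε j) (measure_ne_top _ _) (1 : ℝ))) := by
    ext1 u
    simp only [cubeProjection, sum_apply, Finset.sum_apply]
  rw [h]
  refine isCompactOperator_finset_sum S fun j _ => ?_
  have h1 : IsCompactOperator (cubeAverage Ω ε j) :=
    isCompactOperator_of_locallyCompactSpace_dom (cubeAverage Ω ε j)
  exact h1.clm_comp (ContinuousLinearMap.toSpanSingleton ℝ
    (indicatorConstLp 1 (measurableSet_cube ε j) (measure_ne_top (volume.restrict Ω) _) (1 : ℝ)))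

lemma cubeProjection_ae_eq (hΩ : MeasurableSet Ω) (ε : ℝ) (S : Finset (Fin N → ℤ))
    [IsFiniteMeasure (volume.restrict Ω)] (hS : cubeIndex ε '' Ω ⊆ S)
    (u : Lp ℝ 1 (volume.restrict Ω)) :
    cubeProjection Ω ε S u =ᵐ[volume.restrict Ω] fun x => cubeAverage Ω ε (cubeIndex ε x) u := by
  classical
  have h1 : cubeProjection Ω ε S u = ∑ j ∈ S, cubeAverage Ω ε j u •
      indicatorConstLp 1 (measurableSet_cube ε j) (measure_ne_top _ _) (1 : ℝ) := by
    simp [cubeProjection]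
  rw [h1]
  have h2 : ∀ j, (cubeAverage Ω ε j u • indicatorConstLp 1 (measurableSet_cube ε j)
      (measure_ne_top (volume.restrict Ω) _) (1 : ℝ) : Lp ℝ 1 (volume.restrict Ω))
      =ᵐ[volume.restrict Ω] (cube N ε j).indicator fun _ => cubeAverage Ω ε j u := by
    intro j
    filter_upwards [Lp.coeFn_smul (cubeAverage Ω ε j u) (indicatorConstLp 1
      (measurableSet_cube ε j) (measure_ne_top (volume.restrict Ω) _) (1 : ℝ)),
      indicatorConstLp_coeFn (p := 1) (hs := measurableSet_cube ε j)
        (hμs := measure_ne_top (volume.restrict Ω) _) (c := (1 : ℝ))] with x h3 h4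
    rw [h3, Pi.smul_apply, h4]
    by_cases hx : x ∈ cube N ε j <;> simp [hx]
  have h5 : ∀ᵐ x ∂volume.restrict Ω, ∀ j ∈ S, (cubeAverage Ω ε j u • indicatorConstLp 1
      (measurableSet_cube ε j) (measure_ne_top (volume.restrict Ω) _) (1 : ℝ) :
        Lp ℝ 1 (volume.restrict Ω)) x = (cube N ε j).indicator (fun _ => cubeAverage Ω ε j u) x :=
    (ae_ball_iff S.countable_toSet).2 fun j _ => h2 j
  filter_upwards [h5, Lp.coeFn_finsetSum S fun j => (cubeAverage Ω ε j u • indicatorConstLp 1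
      (measurableSet_cube ε j) (measure_ne_top (volume.restrict Ω) _) (1 : ℝ) :
        Lp ℝ 1 (volume.restrict Ω)), ae_restrict_mem hΩ] with x h6 h7 hx
  rw [h7, Finset.sum_apply, Finset.sum_congr rfl h6]
  rw [Finset.sum_eq_single_of_mem (cubeIndex ε x) (hS ⟨x, hx, rfl⟩)]
  · rw [Set.indicator_of_mem (by rfl)]
  · intro j _ hj
    rw [Set.indicator_of_notMem]
    exact fun h => hj (Set.mem_singleton_iff.1 h).symm

/-- `W_0^{1,p}(Ω)` is continuously embedded in `L^r(Ω)` for `r ≤ p^*`. -/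
theorem exists_eLpNorm_val_le_of_le (hΩb : Bornology.IsBounded Ω) (hpN : p < N) {r : ℝ≥0∞}
    (hr : r ≤ ENNReal.ofReal (N * p / (N - p))) :
    ∃ C, 0 ≤ C ∧ ∀ u : sobolevZero N Ω p,
      eLpNorm (val u) r (volume.restrict Ω) ≤ ENNReal.ofReal (C * gradNorm u) := by
  have h0 : 0 < p := zero_lt_one.trans hp.out
  obtain ⟨C, hC0, hC⟩ := exists_eLpNorm_val_le (Ω := Ω) hpN
  have hfin : volume Ω ≠ ⊤ := hΩb.measure_lt_top.ne
  by_cases hr0 : r = 0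
  · exact ⟨0, le_rfl, fun u => by simp [hr0]⟩
  have hexp : 0 ≤ 1 / r.toReal - 1 / (ENNReal.ofReal (N * p / (N - p))).toReal := by
    rw [sub_nonneg]
    refine one_div_le_one_div_of_le (ENNReal.toReal_pos hr0 (ne_top_of_le_ne_top
      ENNReal.ofReal_ne_top hr)) (ENNReal.toReal_mono ENNReal.ofReal_ne_top hr)
  set D := (volume Ω) ^ (1 / r.toReal - 1 / (ENNReal.ofReal (N * p / (N - p))).toReal)
  have hD : D ≠ ⊤ := ENNReal.rpow_ne_top_of_nonneg hexp hfin
  refine ⟨C * D.toReal, by positivity, fun u => ?_⟩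
  have h1 := eLpNorm_le_eLpNorm_mul_rpow_measure_univ hr (memLp_val u).aestronglyMeasurable
  rw [Measure.restrict_apply_univ] at h1
  refine h1.trans ((mul_le_mul_left (hC u) _).trans_eq ?_)
  rw [mul_right_comm, ENNReal.ofReal_mul (mul_nonneg hC0 (gradNorm_nonneg u)),
    ENNReal.ofReal_toReal hD]

/-- Approximation of the embedding into `L^1` by averages over grid cubes. -/
lemma exists_norm_sub_cubeProjection_le (hΩ : IsOpen Ω) (hΩb : Bornology.IsBounded Ω)
    [IsFiniteMeasure (volume.restrict Ω)]
    (T : sobolevZero N Ω p →L[ℝ] Lp ℝ 1 (volume.restrict Ω))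
    (hT : ∀ u, T u =ᵐ[volume.restrict Ω] val u) :
    ∃ K, 0 ≤ K ∧ ∀ ε, 0 < ε → ∀ S : Finset (Fin N → ℤ), cubeIndex ε '' Ω ⊆ S →
      ∀ u, ‖T u - cubeProjection Ω ε S (T u)‖ ≤ K * ε * gradNorm u := by
  have h0 : 0 < p := zero_lt_one.trans hp.out
  have hfin : volume Ω ≠ ⊤ := hΩb.measure_lt_top.ne
  have hP : (1 : ℝ≥0∞) ≤ ENNReal.ofReal p := by simpa using hp.out.le
  set V := volume (Metric.closedBall (0 : Space N) 1) with hV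
  have hVt : V ≠ ⊤ := measure_closedBall_lt_top.ne
  set D := (volume Ω) ^ (1 / (1 : ℝ≥0∞).toReal - 1 / (ENNReal.ofReal p).toReal) with hD
  have hDt : D ≠ ⊤ := by
    refine ENNReal.rpow_ne_top_of_nonneg ?_ hfin
    rw [ENNReal.toReal_ofReal h0.le, ENNReal.toReal_one, one_div_one, sub_nonneg]
    exact (div_le_one h0).2 hp.out.le
  refine ⟨N ^ (N + 1) * V.toReal * D.toReal, by positivity, fun ε hε S hS => ?_⟩
  -- Both sides are continuous on `W_0^{1,p}(Ω)`, so only test functions matter, for which the cube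
  -- estimate holds on the whole space.
  refine sobolevZero_induction (isClosed_le ?_ (continuous_const.mul continuous_gradNorm)) ?_
  · exact (T.continuous.sub ((cubeProjection Ω ε S).continuous.comp T.continuous)).norm
  intro φ hφ u hu hgu
  have hTu : T u =ᵐ[volume.restrict Ω] φ := (hT u).trans hu
  have havg : ∀ j, cubeAverage Ω ε j (T u) = (ε ^ N)⁻¹ * ∫ y in cube N ε j, φ y := by
    intro j
    rw [cubeAverage_apply, ← setIntegral_cube_restrict hφ.support_subset,
      integral_congr_ae (ae_restrict_of_ae hTu)]
  have hae : (T u - cubeProjection Ω ε S (T u) : Lp ℝ 1 (volume.restrict Ω))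
      =ᵐ[volume.restrict Ω]
      fun x => φ x - (ε ^ N)⁻¹ * ∫ y in cube N ε (cubeIndex ε x), φ y := by
    filter_upwards [Lp.coeFn_sub (T u) (cubeProjection Ω ε S (T u)), hTu,
      cubeProjection_ae_eq hΩ.measurableSet ε S hS (T u)] with x h1 h2 h3
    rw [h1, Pi.sub_apply, h2, h3, havg]
  rw [Lp.norm_def, eLpNorm_congr_ae hae, eLpNorm_one_eq_lintegral_enorm]
  -- The cube estimate involves the `L^1` norm of the gradient; finite volume of `Ω` bounds it by
  -- the `L^p` norm.
  have hgrad : ∫⁻ x, ‖gradient φ x‖ₑ ≤ ENNReal.ofReal (gradNorm u) * D := by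
    have h1 := eLpNorm_le_eLpNorm_mul_rpow_measure_univ (μ := volume.restrict Ω) hP
      (hφ.continuous_gradient.aestronglyMeasurable)
    rw [Measure.restrict_apply_univ,
      ← eLpNorm_congr_ae (p := ENNReal.ofReal p) hgu, eLpNorm_grad,
      eLpNorm_restrict_eq_of_support_subset hφ.support_gradient_subset,
      eLpNorm_one_eq_lintegral_enorm] at h1
    exact h1
  have hfinal := (lintegral_mono' (Measure.restrict_le_self (s := Ω)) le_rfl).trans
    ((lintegral_sub_cube_average_le (hφ.contDiff.of_le (by simp)) hφ.hasCompactSupport hε).trans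
      (mul_le_mul_right hgrad _))
  refine (ENNReal.toReal_mono ?_ hfinal).trans_eq ?_
  · exact ENNReal.mul_ne_top (ENNReal.mul_ne_top ENNReal.ofReal_ne_top hVt)
      (ENNReal.mul_ne_top ENNReal.ofReal_ne_top hDt)
  · rw [ENNReal.toReal_mul, ENNReal.toReal_mul, ENNReal.toReal_mul,
      ENNReal.toReal_ofReal (by positivity), ENNReal.toReal_ofReal (gradNorm_nonneg u)]
    ring

/-- **Rellich's theorem**: the embedding of `W_0^{1,p}(Ω)` in `L^1(Ω)` is compact. -/
theorem isCompactOperator_embedding (hΩ : IsOpen Ω) (hΩb : Bornology.IsBounded Ω)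
    (T : sobolevZero N Ω p →L[ℝ] Lp ℝ 1 (volume.restrict Ω))
    (hT : ∀ u, T u =ᵐ[volume.restrict Ω] val u) : IsCompactOperator T := by
  have : IsFiniteMeasure (volume.restrict Ω) :=
    ⟨by rw [Measure.restrict_apply_univ]; exact hΩb.measure_lt_top⟩
  obtain ⟨K, hK0, hK⟩ := exists_norm_sub_cubeProjection_le hΩ hΩb T hT
  let e : ℕ → ℝ := fun n => 1 / ((n : ℝ) + 1)
  have he : ∀ n, 0 < e n := fun n => by positivity
  let S : ℕ → Finset (Fin N → ℤ) := fun n => (finite_image_cubeIndex hΩb (he n)).toFinset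
  let A : ℕ → sobolevZero N Ω p →L[ℝ] Lp ℝ 1 (volume.restrict Ω) := fun n =>
    (cubeProjection Ω (e n) (S n)).comp T
  -- The embedding is the operator-norm limit of the finite-rank maps of mesh `1/(n+1)`, with error
  -- at most `K/(n+1)`. Boundedness of `Ω` makes the set of relevant cubes finite.
  refine isCompactOperator_of_tendsto (F := A) (l := atTop) ?_ (.of_forall fun n => ?_)
  · rw [tendsto_iff_norm_sub_tendsto_zero]
    have h1 : Tendsto (fun n => K * e n) atTop (𝓝 0) := by
      simpa only [mul_zero] using (tendsto_one_div_add_atTop_nhds_zero_nat (𝕜 := ℝ)).const_mul K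
    refine squeeze_zero (fun _ => norm_nonneg _) (fun n => ?_) h1
    refine ContinuousLinearMap.opNorm_le_bound _ (by have := he n; positivity) fun u => ?_
    rw [sub_apply, norm_sub_rev]
    have h2 := hK (e n) (he n) (S n) (by simp [S]) u
    refine h2.trans ?_
    have := he n
    gcongr
    exact gradNorm_le_norm u
  · exact (isCompactOperator_cubeProjection (e n) (S n)).comp_clm T

end

section

/-! ### Weighted integrals -/

section weight

variable {α : Type*} {mα : MeasurableSpace α} {μ : Measure α}

/-- The measure with density `max w 0`. -/
noncomputable def weightMeasure (μ : Measure α) (w : α → ℝ) : Measure α :=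
  μ.withDensity fun x => ENNReal.ofReal (w x)

lemma weightMeasure_absolutelyContinuous (w : α → ℝ) : weightMeasure μ w ≪ μ :=
  withDensity_absolutelyContinuous _ _

lemma eLpNorm_ofReal_rpow {E : Type*} [NormedAddCommGroup E] {m : ℝ} (hm : 0 < m) (u : α → E) :
    eLpNorm u (ENNReal.ofReal m) μ ^ m = ∫⁻ x, ‖u x‖ₑ ^ m ∂μ := by
  rw [eLpNorm_eq_lintegral_rpow_enorm_toReal (by simpa using hm) ENNReal.ofReal_ne_top,
    ENNReal.toReal_ofReal hm.le, ← ENNReal.rpow_mul, one_div_mul_cancel hm.ne', ENNReal.rpow_one]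

lemma lintegral_weightMeasure_le {w : α → ℝ} {k l : ℝ} (hkl : k.HolderConjugate l)
    (hw : AEStronglyMeasurable w μ) {X : α → ℝ≥0∞} (hX : AEMeasurable X μ) :
    ∫⁻ x, X x ∂weightMeasure μ w ≤
      eLpNorm w (ENNReal.ofReal k) μ * (∫⁻ x, X x ^ l ∂μ) ^ (1 / l) := by
  have hk : 0 < k := hkl.pos
  have hw' : AEMeasurable (fun x => ENNReal.ofReal (w x)) μ := hw.aemeasurable.ennreal_ofReal
  rw [weightMeasure, lintegral_withDensity_eq_lintegral_mul₀ hw' hX]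
  refine (ENNReal.lintegral_mul_le_Lp_mul_Lq μ hkl hw' hX).trans ?_
  gcongr
  rw [eLpNorm_eq_lintegral_rpow_enorm_toReal (by simpa using hk) ENNReal.ofReal_ne_top,
    ENNReal.toReal_ofReal hk.le]
  gcongr with x
  exact Real.ofReal_le_enorm (w x)

/-- Hölder with exponents `k` and `l` trades the weight for an unweighted norm of exponent `r l`.
This is the exponent that has to stay below the critical one. -/
lemma lintegral_rpow_weightMeasure_le {E : Type*} [NormedAddCommGroup E] {w : α → ℝ} {k l r : ℝ}
    (hkl : k.HolderConjugate l) (hw : AEStronglyMeasurable w μ) (hr : 0 < r) {u : α → E}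
    (hu : AEStronglyMeasurable u μ) :
    ∫⁻ x, ‖u x‖ₑ ^ r ∂weightMeasure μ w ≤
      eLpNorm w (ENNReal.ofReal k) μ * eLpNorm u (ENNReal.ofReal (r * l)) μ ^ r := by
  have hl : 0 < l := hkl.symm.pos
  refine (lintegral_weightMeasure_le hkl hw (hu.enorm.pow_const r)).trans_eq ?_
  congr 1
  simp only [← ENNReal.rpow_mul]
  rw [← eLpNorm_ofReal_rpow (by positivity), ← ENNReal.rpow_mul, mul_assoc,
    mul_one_div_cancel hl.ne',
    mul_one]

lemma eLpNorm_weightMeasure_le {E : Type*} [NormedAddCommGroup E] {w : α → ℝ} {k l r : ℝ}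
    (hkl : k.HolderConjugate l) (hw : AEStronglyMeasurable w μ) (hr : 0 < r) {u : α → E}
    (hu : AEStronglyMeasurable u μ) :
    eLpNorm u (ENNReal.ofReal r) (weightMeasure μ w) ≤
      eLpNorm w (ENNReal.ofReal k) μ ^ (1 / r) * eLpNorm u (ENNReal.ofReal (r * l)) μ := by
  rw [← ENNReal.rpow_le_rpow_iff hr, eLpNorm_ofReal_rpow hr, ENNReal.mul_rpow_of_nonneg _ _ hr.le,
    ← ENNReal.rpow_mul, one_div_mul_cancel hr.ne', ENNReal.rpow_one]
  exact lintegral_rpow_weightMeasure_le hkl hw hr hu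

/-- Interpolation of `L^m` between `L^1` and `L^s`. -/
lemma eLpNorm_le_interpolation {E : Type*} [NormedAddCommGroup E] {m s : ℝ} (hm : 1 < m)
    (hms : m < s) {u : α → E} (hu : AEStronglyMeasurable u μ) :
    eLpNorm u (ENNReal.ofReal m) μ ≤ eLpNorm u 1 μ ^ ((s - m) / (s - 1) / m) *
      eLpNorm u (ENNReal.ofReal s) μ ^ (s * ((m - 1) / (s - 1)) / m) := by
  have hm0 : 0 < m := by linarith
  have hs0 : 0 < s := by linarith
  have hs1 : 0 < s - 1 := by linarith
  -- The two quotients are the weights of the convex combination `m = (s-m)/(s-1) · 1 + (m-1)/(s-1)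
  -- · s`.
  have ha : 0 ≤ (s - m) / (s - 1) := div_nonneg (by linarith) hs1.le
  have hb : 0 ≤ (m - 1) / (s - 1) := div_nonneg (by linarith) hs1.le
  rw [← ENNReal.rpow_le_rpow_iff hm0, eLpNorm_ofReal_rpow hm0, ENNReal.mul_rpow_of_nonneg _ _ hm0.le,
    ← ENNReal.rpow_mul, ← ENNReal.rpow_mul, div_mul_cancel₀ _ hm0.ne', div_mul_cancel₀ _ hm0.ne',
    ENNReal.rpow_mul, eLpNorm_ofReal_rpow hs0, eLpNorm_one_eq_lintegral_enorm]
  refine le_trans (lintegral_mono fun x => ?_) (ENNReal.lintegral_mul_norm_pow_le hu.enorm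
    (hu.enorm.pow_const s) ha hb (by rw [← add_div, div_eq_one_iff_eq hs1.ne']; ring))
  rw [← ENNReal.rpow_mul, ← ENNReal.rpow_add_of_nonneg _ _ ha (by positivity)]
  have : (s - m) / (s - 1) + s * ((m - 1) / (s - 1)) = m := by
    field_simp; ring
  rw [this]

variable {w : α → ℝ}

lemma integrable_mul_of_weightMeasure (hw : AEStronglyMeasurable w μ) {X : α → ℝ}
    (h1 : Integrable X (weightMeasure μ w)) (h2 : Integrable X (weightMeasure μ (-w))) :
    Integrable (fun x => w x * X x) μ := by
  rw [weightMeasure, integrable_withDensity_iff_integrable_smul₀'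
    hw.aemeasurable.ennreal_ofReal (by simp)] at h1
  rw [weightMeasure, integrable_withDensity_iff_integrable_smul₀'
    hw.neg.aemeasurable.ennreal_ofReal (by simp)] at h2
  refine (h1.sub h2).congr (.of_forall fun x => ?_)
  simp only [Pi.sub_apply, smul_eq_mul, ENNReal.toReal_ofReal', Pi.neg_apply, ← sub_mul]
  congr 1
  rcases le_total 0 (w x) with h | h
  · rw [max_eq_left h, max_eq_right (by linarith)]; ring
  · rw [max_eq_right h, max_eq_left (by linarith)]; ring

/-- Since `h` may change sign, `w` is split into positive and negative parts. Each defines a genuine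
measure, so the `L^r` theory of integral functionals applies to each separately. -/
lemma integral_mul_eq_weightMeasure (hw : AEStronglyMeasurable w μ) {X : α → ℝ}
    (h1 : Integrable X (weightMeasure μ w)) (h2 : Integrable X (weightMeasure μ (-w))) :
    ∫ x, w x * X x ∂μ =
      ∫ x, X x ∂weightMeasure μ w - ∫ x, X x ∂weightMeasure μ (-w) := by
  have h1' := h1
  have h2' := h2
  rw [weightMeasure, integrable_withDensity_iff_integrable_smul₀'
    hw.aemeasurable.ennreal_ofReal (by simp)] at h1'
  rw [weightMeasure, integrable_withDensity_iff_integrable_smul₀'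
    hw.neg.aemeasurable.ennreal_ofReal (by simp)] at h2'
  rw [weightMeasure, weightMeasure, integral_withDensity_eq_integral_toReal_smul₀
    hw.aemeasurable.ennreal_ofReal (by simp), integral_withDensity_eq_integral_toReal_smul₀
    hw.neg.aemeasurable.ennreal_ofReal (by simp), ← integral_sub h1' h2']
  refine integral_congr_ae (.of_forall fun x => ?_)
  simp only [smul_eq_mul, ENNReal.toReal_ofReal', Pi.neg_apply, ← sub_mul]
  congr 1
  rcases le_total 0 (w x) with h | h
  · rw [max_eq_left h, max_eq_right (by linarith)]; ring
  · rw [max_eq_right h, max_eq_left (by linarith)]; ring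

end weight

/-- Exponents for which `W_0^{1,p}` is compactly embedded in `L^r` with weight in `L^k`. -/
structure AdmissibleExponents (N : ℕ) (p k r l : ℝ) : Prop where
  conj : k.HolderConjugate l
  lt_r : p < r
  lt_critical : r * l < N * p / (N - p)

/-- With `l` conjugate to `k`, the condition `k > N/p` reads `1/l = 1 - 1/k > 1 - p/N = p/p^*`, that
is `p < p^*/l`. Any `r` strictly between these two numbers works. -/
lemma exists_admissibleExponents {N : ℕ} {p k : ℝ} (hp : 1 < p) (hpN : p < N) (hk : N / p < k) :
    ∃ r l, AdmissibleExponents N p k r l := by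
  have hp0 : 0 < p := by linarith
  have hk1 : 1 < k := lt_trans ((one_lt_div hp0).2 hpN) hk
  have hl := Real.HolderConjugate.conjExponent hk1
  set l := k.conjExponent
  have hl0 : 0 < l := hl.symm.pos
  have hlt : p < N * p / (N - p) / l := by
    have hlinv : l⁻¹ = 1 - k⁻¹ := by
      have := hl.inv_add_inv_eq_one; linarith
    have hkinv : k⁻¹ < p / N := by
      rw [← inv_div]
      exact inv_strictAnti₀ (by apply div_pos <;> linarith) hk
    have hNp : 0 < N - p := by linarith
    have hN0 : (0 : ℝ) < N := by linarith
    rw [div_eq_mul_inv _ l, hlinv, div_mul_eq_mul_div, lt_div_iff₀ hNp]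
    have : N * k⁻¹ < p := by
      rw [lt_div_iff₀ hN0] at hkinv; linarith
    nlinarith
  obtain ⟨r, h1, h2⟩ := exists_between hlt
  exact ⟨r, l, hl, h1, (lt_div_iff₀ hl0).1 h2⟩

lemma isFiniteMeasure_weightMeasure {N : ℕ} {Ω : Set (Space N)} (hΩb : Bornology.IsBounded Ω)
    {k : ℝ} (hk : 1 < k) {w : Space N → ℝ}
    (hw : MemLp w (ENNReal.ofReal k) (volume.restrict Ω)) :
    IsFiniteMeasure (weightMeasure (volume.restrict Ω) w) := by
  have : IsFiniteMeasure (volume.restrict Ω) :=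
    ⟨by rw [Measure.restrict_apply_univ]; exact hΩb.measure_lt_top⟩
  exact isFiniteMeasure_withDensity_ofReal
    (hw.integrable (by simpa using hk.le)).hasFiniteIntegral

variable {N : ℕ} {Ω : Set (Space N)} {p : ℝ} [hp : Fact (1 < p)]

namespace AdmissibleExponents

variable {k r l : ℝ} (he : AdmissibleExponents N p k r l)
include he

lemma one_lt : 1 < r := lt_trans hp.out he.lt_r

lemma one_lt_mul : 1 < r * l := by
  have h1 := he.one_lt
  have h2 := he.conj.symm.lt
  nlinarith

/-- Embedding into a weighted `L^r` space. -/
theorem exists_embedding [Fact (1 < r)] (hΩb : Bornology.IsBounded Ω) (hpN : p < N)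
    {w : Space N → ℝ} (hw : MemLp w (ENNReal.ofReal k) (volume.restrict Ω)) :
    ∃ T : sobolevZero N Ω p →L[ℝ] Lp ℝ (ENNReal.ofReal r) (weightMeasure (volume.restrict Ω) w),
      ∀ u, T u =ᵐ[weightMeasure (volume.restrict Ω) w] val u := by
  obtain ⟨C, hC0, hC⟩ := exists_eLpNorm_val_le_of_le (p := p) hΩb hpN
    (ENNReal.ofReal_le_ofReal he.lt_critical.le)
  set W := eLpNorm w (ENNReal.ofReal k) (volume.restrict Ω) ^ (1 / r)
  have hr0 : 0 < r := zero_lt_one.trans he.one_lt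
  have hWt : W ≠ ⊤ := ENNReal.rpow_ne_top_of_nonneg (by positivity) hw.eLpNorm_ne_top
  obtain ⟨T, hT, -⟩ := PLaplace.exists_embedding (Ω := Ω) (p := p) (r := ENNReal.ofReal r)
    (weightMeasure_absolutelyContinuous w) (K := W.toReal * C) (by positivity) fun u => by
      refine (eLpNorm_weightMeasure_le he.conj hw.aestronglyMeasurable hr0
        (memLp_val u).aestronglyMeasurable).trans ((mul_le_mul_right (hC u) _).trans_eq ?_)
      rw [mul_assoc, ENNReal.ofReal_mul ENNReal.toReal_nonneg, ENNReal.ofReal_toReal hWt]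
  exact ⟨T, hT⟩

/-- On bounded sets, the weighted `L^r` norm is controlled by the `L^1` norm. -/
lemma norm_embedding_le [Fact (1 < r)] (hpN : p < N)
    {w : Space N → ℝ} (hw : MemLp w (ENNReal.ofReal k) (volume.restrict Ω))
    {T : sobolevZero N Ω p →L[ℝ] Lp ℝ (ENNReal.ofReal r) (weightMeasure (volume.restrict Ω) w)}
    (hT : ∀ u, T u =ᵐ[weightMeasure (volume.restrict Ω) w] val u)
    {T₁ : sobolevZero N Ω p →L[ℝ] Lp ℝ 1 (volume.restrict Ω)}
    (hT₁ : ∀ u, T₁ u =ᵐ[volume.restrict Ω] val u) :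
    ∃ C a b : ℝ, 0 ≤ C ∧ 0 < a ∧ 0 ≤ b ∧ ∀ u, ‖T u‖ ≤ C * ‖T₁ u‖ ^ a * gradNorm u ^ b := by
  obtain ⟨C, hC0, hC⟩ := exists_eLpNorm_val_le (Ω := Ω) hpN
  have hr0 : 0 < r := zero_lt_one.trans he.one_lt
  set W := eLpNorm w (ENNReal.ofReal k) (volume.restrict Ω) ^ (1 / r)
  have hWt : W ≠ ⊤ := ENNReal.rpow_ne_top_of_nonneg (by positivity) hw.eLpNorm_ne_top
  set s := N * p / (N - p)
  have h1 := he.one_lt_mul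
  have h2 : r * l < s := he.lt_critical
  have hs : 1 < s := h1.trans h2
  set a := (s - r * l) / (s - 1) / (r * l)
  set b := s * ((r * l - 1) / (s - 1)) / (r * l)
  -- The strict inequality `r l < p^*` enters here: a positive power of the `L^1` norm is what
  -- transfers compactness from `L^1` to the weighted space.
  have ha : 0 < a := div_pos (div_pos (by linarith) (by linarith)) (by linarith)
  have hb : 0 ≤ b := div_nonneg (mul_nonneg (by linarith)
    (div_nonneg (by linarith) (by linarith))) (by linarith)
  refine ⟨W.toReal * C ^ b, a, b, by positivity, ha, hb, fun u => ?_⟩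
  have hval := (memLp_val u).aestronglyMeasurable
  have h3 : eLpNorm (val u) (ENNReal.ofReal r) (weightMeasure (volume.restrict Ω) w) ≤
      W * (eLpNorm (T₁ u) 1 (volume.restrict Ω) ^ a * ENNReal.ofReal (C * gradNorm u) ^ b) := by
    rw [eLpNorm_congr_ae (hT₁ u)]
    exact (eLpNorm_weightMeasure_le he.conj hw.aestronglyMeasurable hr0 hval).trans
      (mul_le_mul_right ((eLpNorm_le_interpolation h1 h2 hval).trans
        (mul_le_mul_right (ENNReal.rpow_le_rpow (hC u) hb) _)) _)
  rw [Lp.norm_def (T u), Lp.norm_def (T₁ u), eLpNorm_congr_ae (hT u)]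
  refine (ENNReal.toReal_mono ?_ h3).trans_eq ?_
  · exact ENNReal.mul_ne_top hWt (ENNReal.mul_ne_top
      (ENNReal.rpow_ne_top_of_nonneg ha.le (Lp.eLpNorm_ne_top _))
      (ENNReal.rpow_ne_top_of_nonneg hb ENNReal.ofReal_ne_top))
  · have hg := gradNorm_nonneg u
    rw [ENNReal.toReal_mul, ENNReal.toReal_mul, ← ENNReal.toReal_rpow, ← ENNReal.toReal_rpow,
      ← ENNReal.toReal_rpow,
      ENNReal.toReal_ofReal (mul_nonneg hC0 hg), Real.mul_rpow hC0 hg]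
    ring

/-- The interpolation bound is applied to differences, whose gradient norms stay below `2ρ`, so
`L^1` distances tending to zero force weighted `L^r` distances to do so. -/
lemma cauchySeq_embedding [Fact (1 < r)] (hpN : p < N)
    {w : Space N → ℝ} (hw : MemLp w (ENNReal.ofReal k) (volume.restrict Ω))
    {T : sobolevZero N Ω p →L[ℝ] Lp ℝ (ENNReal.ofReal r) (weightMeasure (volume.restrict Ω) w)}
    (hT : ∀ u, T u =ᵐ[weightMeasure (volume.restrict Ω) w] val u)
    {T₁ : sobolevZero N Ω p →L[ℝ] Lp ℝ 1 (volume.restrict Ω)}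
    (hT₁ : ∀ u, T₁ u =ᵐ[volume.restrict Ω] val u) {u : ℕ → sobolevZero N Ω p} {ρ : ℝ}
    (hρ : ∀ n, gradNorm (u n) ≤ ρ) (hu : CauchySeq fun n => T₁ (u n)) :
    CauchySeq fun n => T (u n) := by
  obtain ⟨C, a, b, hC0, ha, hb, hC⟩ := he.norm_embedding_le hpN hw hT hT₁
  rw [cauchySeq_iff_tendsto_dist_atTop_0] at hu ⊢
  have h1 : Tendsto (fun n : ℕ × ℕ => C * dist (T₁ (u n.1)) (T₁ (u n.2)) ^ a * (2 * ρ) ^ b) atTop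
      (𝓝 0) := by
    have := ((hu.rpow_const (Or.inr ha.le)).const_mul C).mul_const ((2 * ρ) ^ b)
    simpa [Real.zero_rpow ha.ne'] using this
  refine squeeze_zero (fun _ => dist_nonneg) (fun n => ?_) h1
  rw [dist_eq_norm, dist_eq_norm, ← map_sub, ← map_sub]
  refine (hC _).trans ?_
  have h2 : gradNorm (u n.1 - u n.2) ≤ 2 * ρ := by
    rw [gradNorm_sub]
    refine (norm_sub_le _ _).trans ?_
    rw [← gradNorm_eq, ← gradNorm_eq]
    linarith [hρ n.1, hρ n.2]
  have h3 := gradNorm_nonneg (u n.1 - u n.2)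
  gcongr

end AdmissibleExponents

end

/-! ### Weighted potential terms on `W_0^{1,p}` -/

section

variable {N : ℕ} {Ω : Set (Space N)} {p : ℝ} [hp : Fact (1 < p)]

namespace AdmissibleExponents

variable {k r l : ℝ} (he : AdmissibleExponents N p k r l) {Φ : ℝ → ℝ} {Φ' : ℝ → ℝ →L[ℝ] ℝ}
include he

/-- The weighted integral of `Φ(u)` as a difference of integral functionals on `L^r` spaces. -/
lemma exists_weighted_decomposition [Fact (1 < r)] (hΩb : Bornology.IsBounded Ω) (hpN : p < N)
    {w : Space N → ℝ} (hw : MemLp w (ENNReal.ofReal k) (volume.restrict Ω))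
    (hΦ : TameGrowth r Φ Φ') :
    ∃ T : sobolevZero N Ω p →L[ℝ] Lp ℝ (ENNReal.ofReal r) (weightMeasure (volume.restrict Ω) w),
    ∃ S : sobolevZero N Ω p →L[ℝ] Lp ℝ (ENNReal.ofReal r) (weightMeasure (volume.restrict Ω) (-w)),
      (∀ u, T u =ᵐ[weightMeasure (volume.restrict Ω) w] val u) ∧
      (∀ u, S u =ᵐ[weightMeasure (volume.restrict Ω) (-w)] val u) ∧
      ∀ u, IntegrableOn (fun x => w x * Φ (val u x)) Ω ∧
        ∫ x in Ω, w x * Φ (val u x) =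
          ∫ x, Φ (T u x) ∂weightMeasure (volume.restrict Ω) w -
            ∫ x, Φ (S u x) ∂weightMeasure (volume.restrict Ω) (-w) := by
  have := isFiniteMeasure_weightMeasure hΩb he.conj.lt hw
  have := isFiniteMeasure_weightMeasure hΩb he.conj.lt hw.neg
  obtain ⟨T, hT⟩ := he.exists_embedding hΩb hpN hw
  obtain ⟨S, hS⟩ := he.exists_embedding hΩb hpN hw.neg
  refine ⟨T, S, hT, hS, fun u => ?_⟩
  have e1 : (fun x => Φ (T u x)) =ᵐ[weightMeasure (volume.restrict Ω) w] fun x => Φ (val u x) := by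
    filter_upwards [hT u] with x hx
    rw [hx]
  have e2 : (fun x => Φ (S u x)) =ᵐ[weightMeasure (volume.restrict Ω) (-w)]
      fun x => Φ (val u x) := by
    filter_upwards [hS u] with x hx
    rw [hx]
  have i1 := (hΦ.integrable_comp (T u)).congr e1
  have i2 := (hΦ.integrable_comp (S u)).congr e2
  refine ⟨integrable_mul_of_weightMeasure hw.aestronglyMeasurable i1 i2, ?_⟩
  rw [integral_mul_eq_weightMeasure hw.aestronglyMeasurable i1 i2, integral_congr_ae e1,
    integral_congr_ae e2]

lemma integrableOn_weight_mul (hΩb : Bornology.IsBounded Ω) (hpN : p < N)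
    {w : Space N → ℝ} (hw : MemLp w (ENNReal.ofReal k) (volume.restrict Ω))
    (hΦ : TameGrowth r Φ Φ') (u : sobolevZero N Ω p) :
    IntegrableOn (fun x => w x * Φ (val u x)) Ω := by
  have : Fact (1 < r) := ⟨he.one_lt⟩
  obtain ⟨T, S, -, -, h⟩ := he.exists_weighted_decomposition hΩb hpN hw hΦ
  exact (h u).1

lemma differentiable_weighted_integral (hΩb : Bornology.IsBounded Ω) (hpN : p < N)
    {w : Space N → ℝ} (hw : MemLp w (ENNReal.ofReal k) (volume.restrict Ω))
    (hΦ : TameGrowth r Φ Φ') :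
    Differentiable ℝ fun u : sobolevZero N Ω p => ∫ x in Ω, w x * Φ (val u x) := by
  have : Fact (1 < r) := ⟨he.one_lt⟩
  have := isFiniteMeasure_weightMeasure hΩb he.conj.lt hw
  have := isFiniteMeasure_weightMeasure hΩb he.conj.lt hw.neg
  obtain ⟨T, S, -, -, h⟩ := he.exists_weighted_decomposition hΩb hpN hw hΦ
  rw [funext fun u => (h u).2]
  intro u
  exact ((hΦ.hasFDerivAt_integral (T u)).comp u T.hasFDerivAt).differentiableAt.sub
    ((hΦ.hasFDerivAt_integral (S u)).comp u S.hasFDerivAt).differentiableAt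

/-- Weighted integrals converge along midpoints of bounded sequences that are Cauchy in `L^1`. -/
lemma exists_tendsto_weighted_integral (hΩb : Bornology.IsBounded Ω) (hpN : p < N)
    {w : Space N → ℝ} (hw : MemLp w (ENNReal.ofReal k) (volume.restrict Ω))
    (hΦ : TameGrowth r Φ Φ') {T₁ : sobolevZero N Ω p →L[ℝ] Lp ℝ 1 (volume.restrict Ω)}
    (hT₁ : ∀ u, T₁ u =ᵐ[volume.restrict Ω] val u) {u : ℕ → sobolevZero N Ω p} {ρ : ℝ}
    (hρ : ∀ n, gradNorm (u n) ≤ ρ) (hu : CauchySeq fun n => T₁ (u n)) :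
    ∃ a, Tendsto (fun n : ℕ × ℕ =>
      ∫ x in Ω, w x * Φ (val ((1 / 2 : ℝ) • (u n.1 + u n.2)) x)) atTop (𝓝 a) := by
  have : Fact (1 < r) := ⟨he.one_lt⟩
  have := isFiniteMeasure_weightMeasure hΩb he.conj.lt hw
  have := isFiniteMeasure_weightMeasure hΩb he.conj.lt hw.neg
  obtain ⟨T, S, hT, hS, h⟩ := he.exists_weighted_decomposition hΩb hpN hw hΦ
  obtain ⟨ξ, hξ⟩ := cauchySeq_tendsto_of_complete (he.cauchySeq_embedding hpN hw hT hT₁ hρ hu)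
  obtain ⟨ζ, hζ⟩ := cauchySeq_tendsto_of_complete
    (he.cauchySeq_embedding hpN hw.neg hS hT₁ hρ hu)
  -- If the images of the sequence converge to `y`, so do the images of midpoints as both indices
  -- tend to infinity independently. No convergence in `W_0^{1,p}(Ω)` itself is needed.
  have hmid : ∀ {X : Type _} [NormedAddCommGroup X] [NormedSpace ℝ X]
      {L : sobolevZero N Ω p →L[ℝ] X} {y : X}, Tendsto (fun n => L (u n)) atTop (𝓝 y) →
      Tendsto (fun n : ℕ × ℕ => L ((1 / 2 : ℝ) • (u n.1 + u n.2))) atTop (𝓝 y) := by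
    intro X _ _ L y hy
    rw [← prod_atTop_atTop_eq]
    have h0 : Tendsto (fun n : ℕ × ℕ => L (u n.1) + L (u n.2)) (atTop ×ˢ atTop) (𝓝 (y + y)) :=
      (hy.comp tendsto_fst).add (hy.comp tendsto_snd)
    have h1 := h0.const_smul (1 / 2 : ℝ)
    have h2 : (1 / 2 : ℝ) • (y + y) = y := by rw [← two_smul ℝ, smul_smul]; norm_num
    rw [h2] at h1
    refine h1.congr fun n => ?_
    rw [map_smul, map_add]
  refine ⟨∫ x, Φ (ξ x) ∂weightMeasure (volume.restrict Ω) w -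
    ∫ x, Φ (ζ x) ∂weightMeasure (volume.restrict Ω) (-w), ?_⟩
  simp only [(h _).2]
  exact ((hΦ.continuous_integral.tendsto ξ).comp (hmid hξ)).sub
    ((hΦ.continuous_integral.tendsto ζ).comp (hmid hζ))

/-- The weighted integral of `Φ(u)` is bounded by `‖w‖_k` on the unit ball. -/
lemma exists_abs_weighted_integral_le (hΩb : Bornology.IsBounded Ω) (hpN : p < N)
    (hΦ : TameGrowth r Φ Φ') (hΦ0 : Φ 0 = 0) :
    ∃ C, 0 ≤ C ∧ ∀ w : Space N → ℝ, MemLp w (ENNReal.ofReal k) (volume.restrict Ω) →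
      ∀ u : sobolevZero N Ω p, gradNorm u ≤ 1 →
        |∫ x in Ω, w x * Φ (val u x)| ≤
          C * (eLpNorm w (ENNReal.ofReal k) (volume.restrict Ω)).toReal := by
  have hr0 : 0 < r := zero_lt_one.trans he.one_lt
  have : IsFiniteMeasure (volume.restrict Ω) :=
    ⟨by rw [Measure.restrict_apply_univ]; exact hΩb.measure_lt_top⟩
  obtain ⟨C, hC0, hC⟩ := hΦ.exists_abs_le he.one_lt
  obtain ⟨D, hD0, hD⟩ := exists_eLpNorm_val_le_of_le (p := p) hΩb hpN
    (ENNReal.ofReal_le_ofReal he.lt_critical.le)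
  -- By Minkowski and Sobolev this bounds `‖1 + |u|‖_{rl}^r` for all `u` in the unit ball. Hölder is
  -- then applied with the weight `|w|`, so no sign of `w` is required.
  set B : ℝ≥0∞ := (eLpNorm (fun _ : Space N => (1 : ℝ)) (ENNReal.ofReal (r * l))
    (volume.restrict Ω) + ENNReal.ofReal D) ^ r with hB
  have hBt : B ≠ ⊤ := ENNReal.rpow_ne_top_of_nonneg hr0.le
    (ENNReal.add_ne_top.2 ⟨(memLp_const 1).eLpNorm_ne_top, ENNReal.ofReal_ne_top⟩)
  refine ⟨C * B.toReal, by positivity, fun w hw u hu => ?_⟩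
  have hval := (memLp_val u).aestronglyMeasurable
  have hone : AEStronglyMeasurable (fun x => 1 + ‖val u x‖) (volume.restrict Ω) :=
    aestronglyMeasurable_const.add hval.norm
  have h1 : ‖∫ x in Ω, w x * Φ (val u x)‖ₑ ≤ ENNReal.ofReal C *
      (eLpNorm w (ENNReal.ofReal k) (volume.restrict Ω) * B) := by
    have hmeas : AEMeasurable (fun x => ENNReal.ofReal ‖w x‖) (volume.restrict Ω) :=
      hw.aestronglyMeasurable.norm.aemeasurable.ennreal_ofReal
    have hX : AEMeasurable (fun x => ENNReal.ofReal C * ‖1 + ‖val u x‖‖ₑ ^ r)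
      (volume.restrict Ω) := (hone.enorm.pow_const r).const_mul _
    calc ‖∫ x in Ω, w x * Φ (val u x)‖ₑ
        ≤ ∫⁻ x in Ω, ‖w x * Φ (val u x)‖ₑ := enorm_integral_le_lintegral_enorm _
      _ ≤ ∫⁻ x in Ω, ENNReal.ofReal ‖w x‖ * (ENNReal.ofReal C * ‖1 + ‖val u x‖‖ₑ ^ r) := by
          refine lintegral_mono fun x => ?_
          have hx := hC (val u x)
          rw [hΦ0, sub_zero] at hx
          rw [enorm_mul, ← ofReal_norm (w x), ← ofReal_norm (Φ _), ← ofReal_norm (1 + _),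
            Real.norm_of_nonneg (by positivity : 0 ≤ 1 + ‖val u x‖),
            ENNReal.ofReal_rpow_of_nonneg (by positivity) hr0.le, ← ENNReal.ofReal_mul hC0]
          gcongr
          exact hx
      _ = ∫⁻ x, ENNReal.ofReal C * ‖1 + ‖val u x‖‖ₑ ^ r
            ∂weightMeasure (volume.restrict Ω) fun x => ‖w x‖ := by
          rw [weightMeasure, lintegral_withDensity_eq_lintegral_mul₀ hmeas hX]; rfl
      _ = ENNReal.ofReal C * ∫⁻ x, ‖1 + ‖val u x‖‖ₑ ^ r
            ∂weightMeasure (volume.restrict Ω) fun x => ‖w x‖ :=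
          lintegral_const_mul' _ _ ENNReal.ofReal_ne_top
      _ ≤ ENNReal.ofReal C * (eLpNorm (fun x => ‖w x‖) (ENNReal.ofReal k) (volume.restrict Ω) *
            eLpNorm (fun x => 1 + ‖val u x‖) (ENNReal.ofReal (r * l)) (volume.restrict Ω) ^ r) := by
          gcongr
          exact lintegral_rpow_weightMeasure_le he.conj hw.aestronglyMeasurable.norm hr0 hone
      _ ≤ _ := by
          rw [eLpNorm_norm, hB]
          gcongr
          refine (eLpNorm_add_le aestronglyMeasurable_const hval.norm
            (by simpa using he.one_lt_mul.le)).trans ?_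
          rw [eLpNorm_norm]
          gcongr
          refine (hD u).trans (ENNReal.ofReal_le_ofReal ?_)
          nlinarith
  rw [← Real.norm_eq_abs, ← toReal_enorm]
  refine (ENNReal.toReal_mono ?_ h1).trans_eq ?_
  · exact ENNReal.mul_ne_top ENNReal.ofReal_ne_top (ENNReal.mul_ne_top hw.eLpNorm_ne_top hBt)
  · rw [ENNReal.toReal_mul, ENNReal.toReal_mul, ENNReal.toReal_ofReal hC0]; ring

end AdmissibleExponents

/-! ### Minimization on balls -/

lemma one_le_critical (hpN : p < N) : p ≤ N * p / (N - p) := by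
  have h0 : 0 < p := zero_lt_one.trans hp.out
  rw [le_div_iff₀ (by linarith)]
  nlinarith

/-- Poincaré's inequality: the norm of `W_0^{1,p}(Ω)` is controlled by `gradNorm`. -/
lemma exists_norm_le_gradNorm (hΩb : Bornology.IsBounded Ω) (hpN : p < N) :
    ∃ C, 0 ≤ C ∧ ∀ u : sobolevZero N Ω p, ‖u‖ ≤ C * gradNorm u := by
  obtain ⟨C, hC0, hC⟩ := exists_eLpNorm_val_le_of_le (p := p) hΩb hpN
    (ENNReal.ofReal_le_ofReal (one_le_critical hpN))
  refine ⟨max C 1, by positivity, fun u => ?_⟩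
  have hg := gradNorm_nonneg u
  have h1 : ‖u.1.1‖ ≤ C * gradNorm u := by
    rw [Lp.norm_def]
    exact ENNReal.toReal_le_of_le_ofReal (mul_nonneg hC0 hg) (hC u)
  have h2 : ‖u.1.2‖ = gradNorm u := (gradNorm_eq u).symm
  refine max_le (h1.trans ?_) (h2.le.trans ?_)
  · gcongr; exact le_max_left _ _
  · exact le_mul_of_one_le_left hg (le_max_right _ _)

lemma exists_embedding_L1 (hΩb : Bornology.IsBounded Ω) (hpN : p < N) :
    ∃ T₁ : sobolevZero N Ω p →L[ℝ] Lp ℝ 1 (volume.restrict Ω),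
      ∀ u, T₁ u =ᵐ[volume.restrict Ω] val u := by
  obtain ⟨C, hC0, hC⟩ := exists_eLpNorm_val_le_of_le (Ω := Ω) (p := p) hΩb hpN (r := 1) (by
    rw [ENNReal.one_le_ofReal]
    exact hp.out.le.trans (one_le_critical hpN))
  obtain ⟨T, hT, -⟩ := exists_embedding (Ω := Ω) (p := p) (r := 1) Measure.AbsolutelyContinuous.rfl
    hC0 hC
  exact ⟨T, hT⟩

/-- Bounded sequences in `W_0^{1,p}(Ω)` have subsequences that are Cauchy in `L^1(Ω)`. -/
lemma exists_cauchySeq_subseq (hΩ : IsOpen Ω) (hΩb : Bornology.IsBounded Ω) (hpN : p < N)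
    {T₁ : sobolevZero N Ω p →L[ℝ] Lp ℝ 1 (volume.restrict Ω)}
    (hT₁ : ∀ u, T₁ u =ᵐ[volume.restrict Ω] val u) {u : ℕ → sobolevZero N Ω p} {ρ : ℝ}
    (hρ : ∀ n, gradNorm (u n) ≤ ρ) :
    ∃ ns : ℕ → ℕ, StrictMono ns ∧ CauchySeq fun n => T₁ (u (ns n)) := by
  obtain ⟨C, hC0, hC⟩ := exists_norm_le_gradNorm (Ω := Ω) (p := p) hΩb hpN
  have hcomp := isCompactOperator_embedding hΩ hΩb T₁ hT₁
  obtain ⟨K, hK, hsub⟩ := hcomp.image_closedBall_subset_compact (C * ρ)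
    (f := (T₁ : sobolevZero N Ω p →ₗ[ℝ] Lp ℝ 1 (volume.restrict Ω)))
  obtain ⟨y, -, ns, hns, hlim⟩ := hK.tendsto_subseq (x := fun n => T₁ (u n)) fun n =>
    hsub ⟨u n, by
      rw [mem_closedBall_zero_iff]
      refine (hC _).trans ?_
      gcongr
      exact hρ n, rfl⟩
  exact ⟨ns, hns, hlim.cauchySeq⟩

/-- The midpoint of `u` and `v`. -/
lemma gradNorm_midpoint_le {u v : sobolevZero N Ω p} {ρ : ℝ} (hu : gradNorm u ≤ ρ)
    (hv : gradNorm v ≤ ρ) : gradNorm ((1 / 2 : ℝ) • (u + v)) ≤ ρ := by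
  rw [gradNorm_smul, abs_of_pos (by norm_num)]
  linarith [gradNorm_add_le u v]

/-- A minimizing sequence along which `B` converges at midpoints is Cauchy, by uniform
convexity. -/
lemma cauchySeq_of_minimizing (hΩb : Bornology.IsBounded Ω) (hpN : p < N)
    {J B : sobolevZero N Ω p → ℝ} (hJB : ∀ u, J u = 1 / p * ‖u.1.2‖ ^ p - B u) {ρ m a : ℝ}
    (hρ : 0 ≤ ρ) (hm : ∀ u, gradNorm u ≤ ρ → m ≤ J u) {u : ℕ → sobolevZero N Ω p}
    (hu : ∀ n, gradNorm (u n) ≤ ρ) (hJu : Tendsto (fun n => J (u n)) atTop (𝓝 m))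
    (hBu : Tendsto (fun n => B (u n)) atTop (𝓝 a))
    (ha : Tendsto (fun n : ℕ × ℕ => B ((1 / 2 : ℝ) • (u n.1 + u n.2))) atTop (𝓝 a)) :
    CauchySeq u := by
  have h0 : 0 < p := zero_lt_one.trans hp.out
  have hA : Tendsto (fun n => ‖(u n).1.2‖ ^ p) atTop (𝓝 (p * (m + a))) := by
    refine ((hJu.add hBu).const_mul p).congr fun n => ?_
    rw [hJB]; field_simp; ring
  -- In the convexity gap, the `p`-energy of the midpoint is replaced by the lower bound `p (m +
  -- B(midpoint))`, valid because the midpoint is admissible in the ball. This majorant tends to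
  -- `0`, since the energies and `p (m + B(midpoint))` all tend to `p (m + a)`.
  obtain ⟨gap, hgap_eq⟩ : ∃ gap : ℕ × ℕ → ℝ, ∀ n, gap n =
      1 / 2 * ‖(u n.1).1.2‖ ^ p + 1 / 2 * ‖(u n.2).1.2‖ ^ p -
        p * (m + B ((1 / 2 : ℝ) • (u n.1 + u n.2))) := ⟨_, fun _ => rfl⟩
  have hgap : Tendsto gap atTop (𝓝 0) := by
    have h1 : Tendsto (fun n : ℕ × ℕ => n.1) atTop atTop := by
      rw [← prod_atTop_atTop_eq]; exact tendsto_fst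
    have h2 : Tendsto (fun n : ℕ × ℕ => n.2) atTop atTop := by
      rw [← prod_atTop_atTop_eq]; exact tendsto_snd
    have := (((hA.comp h1).const_mul (1 / 2)).add ((hA.comp h2).const_mul (1 / 2))).sub
      ((ha.const_add m).const_mul p)
    rw [show 1 / 2 * (p * (m + a)) + 1 / 2 * (p * (m + a)) - p * (m + a) = 0 by ring] at this
    exact this.congr fun n => (hgap_eq n).symm
  have hdist : Tendsto (fun n : ℕ × ℕ => ‖(u n.1).1.2 - (u n.2).1.2‖ ^ p) atTop (𝓝 0) := by
    rw [Metric.tendsto_nhds]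
    intro ε hε
    -- The parameter makes the first term at most `ε/2`, as the two energies sum to at most `2ρ^p`.
    obtain ⟨C, hC0, hC⟩ := exists_Lp_norm_sub_rpow_le (volume.restrict Ω) (Space N) p
      (ε := ε / 2 / (2 * ρ ^ p + 1)) (by positivity)
    have h1 : Tendsto (fun n => C * gap n) atTop (𝓝 0) := by simpa using hgap.const_mul C
    filter_upwards [h1.eventually (gt_mem_nhds (half_pos hε))] with n hn
    rw [Real.dist_eq, sub_zero, abs_of_nonneg (by positivity)]
    have h2 := hm _ (gradNorm_midpoint_le (hu n.1) (hu n.2))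
    rw [hJB] at h2
    have h3 : p * (m + B ((1 / 2 : ℝ) • (u n.1 + u n.2))) ≤
        ‖((1 / 2 : ℝ) • (u n.1 + u n.2)).1.2‖ ^ p := by
      have h4 : m + B ((1 / 2 : ℝ) • (u n.1 + u n.2)) ≤
        1 / p * ‖((1 / 2 : ℝ) • (u n.1 + u n.2)).1.2‖ ^ p := by linarith
      rwa [div_mul_eq_mul_div, one_mul, le_div_iff₀' h0] at h4
    have hpow : ∀ i, ‖(u i).1.2‖ ^ p ≤ ρ ^ p := fun i => by
      have := hu i
      rw [gradNorm_eq] at this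
      gcongr
    calc ‖(u n.1).1.2 - (u n.2).1.2‖ ^ p
        ≤ ε / 2 / (2 * ρ ^ p + 1) * (‖(u n.1).1.2‖ ^ p + ‖(u n.2).1.2‖ ^ p) +
          C * (1 / 2 * ‖(u n.1).1.2‖ ^ p + 1 / 2 * ‖(u n.2).1.2‖ ^ p -
            ‖((1 / 2 : ℝ) • (u n.1 + u n.2)).1.2‖ ^ p) := hC _ _
      _ ≤ ε / 2 / (2 * ρ ^ p + 1) * (2 * ρ ^ p + 1) + C * gap n := by
          rw [hgap_eq]
          exact add_le_add (mul_le_mul_of_nonneg_left (by linarith [hpow n.1, hpow n.2])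
            (by positivity)) (mul_le_mul_of_nonneg_left (by linarith) hC0)
      _ = ε / 2 + C * gap n := by rw [div_mul_cancel₀ _ (by positivity)]
      _ < ε := by linarith
  obtain ⟨C, hC0, hC⟩ := exists_norm_le_gradNorm (Ω := Ω) (p := p) hΩb hpN
  rw [cauchySeq_iff_tendsto_dist_atTop_0]
  have h1 : Tendsto (fun n : ℕ × ℕ => C * (‖(u n.1).1.2 - (u n.2).1.2‖ ^ p) ^ p⁻¹) atTop
      (𝓝 0) := by
    have := (hdist.rpow_const (p := p⁻¹) (Or.inr (by positivity))).const_mul C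
    rwa [Real.zero_rpow (by positivity), mul_zero] at this
  refine squeeze_zero (fun _ => dist_nonneg) (fun n => ?_) h1
  rw [Real.rpow_rpow_inv (norm_nonneg _) h0.ne', dist_eq_norm, ← gradNorm_sub]
  exact hC _

/-- A functional `‖∇u‖^p / p - B(u)` with `B` compact attains its minimum on every ball. -/
theorem exists_isMinOn_ball (hΩ : IsOpen Ω) (hΩb : Bornology.IsBounded Ω) (hpN : p < N)
    {T₁ : sobolevZero N Ω p →L[ℝ] Lp ℝ 1 (volume.restrict Ω)}
    (hT₁ : ∀ u, T₁ u =ᵐ[volume.restrict Ω] val u) {J B : sobolevZero N Ω p → ℝ}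
    (hJB : ∀ u, J u = 1 / p * ‖u.1.2‖ ^ p - B u) (hJ : Continuous J) {ρ : ℝ} (hρ : 0 ≤ ρ)
    (hB : ∀ u : ℕ → sobolevZero N Ω p, (∀ n, gradNorm (u n) ≤ ρ) →
      (CauchySeq fun n => T₁ (u n)) →
        ∃ a, Tendsto (fun n : ℕ × ℕ => B ((1 / 2 : ℝ) • (u n.1 + u n.2))) atTop (𝓝 a)) :
    ∃ v, gradNorm v ≤ ρ ∧ ∀ u, gradNorm u ≤ ρ → J v ≤ J u := by
  have h0 : 0 < p := zero_lt_one.trans hp.out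
  have hhalf : ∀ u : sobolevZero N Ω p, (1 / 2 : ℝ) • (u + u) = u := fun u => by
    rw [← two_smul ℝ, smul_smul]; norm_num
  have hdiag : Tendsto (fun n : ℕ => (n, n)) atTop (atTop : Filter (ℕ × ℕ)) := by
    rw [← prod_atTop_atTop_eq]; exact tendsto_id.prodMk tendsto_id
  -- If `J` were unbounded below, `B` would tend to infinity along a sequence in the ball, whereas
  -- along a subsequence it converges: on the diagonal the midpoint of `u` and `u` is `u`.
  have hbdd : BddBelow (J '' {u | gradNorm u ≤ ρ}) := by
    by_contra hnot
    rw [not_bddBelow_iff] at hnot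
    have hch : ∀ n : ℕ, ∃ u, gradNorm u ≤ ρ ∧ J u < -n := fun n => by
      obtain ⟨_, ⟨u, hu, rfl⟩, h⟩ := hnot (-n)
      exact ⟨u, hu, h⟩
    choose u hu hJu using hch
    obtain ⟨ns, hns, hc⟩ := exists_cauchySeq_subseq hΩ hΩb hpN hT₁ hu
    obtain ⟨a, ha⟩ := hB (u ∘ ns) (fun n => hu _) hc
    have h1 := ha.comp hdiag
    simp only [Function.comp_def, hhalf] at h1
    obtain ⟨n, hn1, hn2⟩ := ((h1.eventually (gt_mem_nhds (lt_add_one a))).and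
      (eventually_ge_atTop ⌈a + 1⌉₊)).exists
    have h2 := hJu (ns n)
    rw [hJB] at h2
    have h3 : 0 ≤ 1 / p * ‖(u (ns n)).1.2‖ ^ p := by positivity
    have h4 : a + 1 ≤ ns n := (Nat.le_ceil _).trans (by exact_mod_cast hn2.trans (hns.id_le n))
    linarith
  have hne : (J '' {u | gradNorm u ≤ ρ}).Nonempty :=
    ⟨J 0, 0, by simpa using hρ, rfl⟩
  set m := sInf (J '' {u | gradNorm u ≤ ρ})
  have hm : ∀ u, gradNorm u ≤ ρ → m ≤ J u := fun u hu => csInf_le hbdd ⟨u, hu, rfl⟩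
  obtain ⟨y, -, hylim, hymem⟩ := exists_seq_tendsto_sInf hne hbdd
  choose w hw hJw using hymem
  obtain ⟨ns, hns, hc⟩ := exists_cauchySeq_subseq hΩ hΩb hpN hT₁ hw
  set u := fun n => w (ns n)
  have hu : ∀ n, gradNorm (u n) ≤ ρ := fun n => hw _
  obtain ⟨a, ha⟩ := hB u hu hc
  have hJu : Tendsto (fun n => J (u n)) atTop (𝓝 m) := by
    simp only [u, hJw]
    exact hylim.comp hns.tendsto_atTop
  have hBu : Tendsto (fun n => B (u n)) atTop (𝓝 a) := by
    have h1 := ha.comp hdiag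
    simpa only [Function.comp_def, hhalf] using h1
  obtain ⟨v, hv⟩ := cauchySeq_tendsto_of_complete
    (cauchySeq_of_minimizing hΩb hpN hJB hρ hm hu hJu hBu ha)
  refine ⟨v, le_of_tendsto ((continuous_gradNorm.tendsto v).comp hv) (.of_forall hu),
    fun z hz => ?_⟩
  rw [tendsto_nhds_unique ((hJ.tendsto v).comp hv) hJu]
  exact hm z hz

end

section

/-! ### Composition with smooth functions -/

variable {N : ℕ} {Ω : Set (Space N)} {p : ℝ} [hp : Fact (1 < p)]

lemma IsTest.comp {φ : Space N → ℝ} (h : IsTest Ω φ) {θ : ℝ → ℝ} (hθ : ContDiff ℝ ∞ θ)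
    (h0 : θ 0 = 0) : IsTest Ω (θ ∘ φ) :=
  ⟨hθ.comp h.contDiff, h.hasCompactSupport.comp_left h0,
    (closure_mono (Function.support_comp_subset h0 φ)).trans h.tsupport_subset⟩

lemma gradient_comp {φ : Space N → ℝ} {θ : ℝ → ℝ} {x : Space N} (hθ : DifferentiableAt ℝ θ (φ x))
    (hφ : DifferentiableAt ℝ φ x) : gradient (θ ∘ φ) x = deriv θ (φ x) • gradient φ x := by
  have h := (hθ.hasDerivAt.comp_hasFDerivAt x hφ.hasFDerivAt).fderiv
  simp only [gradient, h, map_smul]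

/-- Dominated convergence with majorant `K^r |b|^r`. It handles coefficients `θ'(u_n) - θ'(u)` that
are bounded but converge only almost everywhere. -/
lemma tendsto_eLpNorm_smul_of_ae {α E : Type*} {mα : MeasurableSpace α} {ν : Measure α}
    [NormedAddCommGroup E] [NormedSpace ℝ E] {r : ℝ} (hr : 0 < r) {a : ℕ → α → ℝ} {b : α → E}
    {K : ℝ} (hb : MemLp b (ENNReal.ofReal r) ν) (ha : ∀ n, AEStronglyMeasurable (a n) ν)
    (hK : ∀ n x, |a n x| ≤ K) (hlim : ∀ᵐ x ∂ν, Tendsto (fun n => a n x) atTop (𝓝 0)) :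
    Tendsto (fun n => eLpNorm (fun x => a n x • b x) (ENNReal.ofReal r) ν) atTop (𝓝 0) := by
  have h1 : Tendsto (fun n => ∫⁻ x, ‖a n x • b x‖ₑ ^ r ∂ν) atTop (𝓝 (∫⁻ _, 0 ∂ν)) := by
    refine tendsto_lintegral_of_dominated_convergence'
      (fun x => ENNReal.ofReal K ^ r * ‖b x‖ₑ ^ r)
      (fun n => ((ha n).smul hb.aestronglyMeasurable).enorm.pow_const r)
      (fun n => .of_forall fun x => ?_) ?_ ?_
    · beta_reduce
      rw [enorm_smul, ENNReal.mul_rpow_of_nonneg _ _ hr.le]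
      gcongr
      rw [← ofReal_norm]
      exact ENNReal.ofReal_le_ofReal (hK n x)
    · rw [lintegral_const_mul' _ _ (ENNReal.rpow_ne_top_of_nonneg hr.le ENNReal.ofReal_ne_top),
        ← eLpNorm_ofReal_rpow hr]
      exact ENNReal.mul_ne_top (ENNReal.rpow_ne_top_of_nonneg hr.le ENNReal.ofReal_ne_top)
        (ENNReal.rpow_ne_top_of_nonneg hr.le hb.eLpNorm_ne_top)
    · filter_upwards [hlim] with x hx
      have h2 : Tendsto (fun n => ‖a n x • b x‖ₑ) atTop (𝓝 0) := by
        have := (hx.smul_const (b x)).enorm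
        rwa [zero_smul, enorm_zero] at this
      have := (ENNReal.continuous_rpow_const (y := r)).continuousAt.tendsto.comp h2
      rwa [ENNReal.zero_rpow_of_pos hr] at this
  rw [lintegral_zero] at h1
  have h3 := (ENNReal.continuous_rpow_const (y := 1 / r)).continuousAt.tendsto.comp h1
  rw [ENNReal.zero_rpow_of_pos (by positivity)] at h3
  refine h3.congr fun n => ?_
  rw [Function.comp_apply, ← eLpNorm_ofReal_rpow hr, ← ENNReal.rpow_mul, mul_one_div_cancel hr.ne',
    ENNReal.rpow_one]

/-- `W_0^{1,p}(Ω)` is stable under composition with smooth Lipschitz functions vanishing at `0`. -/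
theorem exists_comp_sobolevZero {θ : ℝ → ℝ} (hθ : ContDiff ℝ ∞ θ) (hθ0 : θ 0 = 0) {K : ℝ}
    (hK : ∀ s, |deriv θ s| ≤ K) (u : sobolevZero N Ω p) :
    ∃ w : sobolevZero N Ω p, val w =ᵐ[volume.restrict Ω] (fun x => θ (val u x)) ∧
      grad w =ᵐ[volume.restrict Ω] fun x => deriv θ (val u x) • grad u x := by
  have h0 : 0 < p := zero_lt_one.trans hp.out
  have hdθ : Differentiable ℝ θ := hθ.differentiable (by simp)
  have hcθ : Continuous (deriv θ) := hθ.continuous_deriv (by simp)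
  have hlip : ∀ s t, |θ s - θ t| ≤ K * |s - t| := fun s t =>
    convex_univ.norm_image_sub_le_of_norm_deriv_le (fun x _ => hdθ x) (fun x _ => hK x)
      (Set.mem_univ t) (Set.mem_univ s)
  have hv := (memLp_val u).aestronglyMeasurable
  have m1 : MemLp (fun x => θ (val u x)) (ENNReal.ofReal p) (volume.restrict Ω) :=
    (memLp_val u).of_le_mul (c := K) (hdθ.continuous.comp_aestronglyMeasurable hv)
      (.of_forall fun x => by simpa [hθ0] using hlip (val u x) 0)
  have m2 : MemLp (fun x => deriv θ (val u x) • grad u x) (ENNReal.ofReal p)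
      (volume.restrict Ω) :=
    (memLp_grad u).of_le_mul (c := K)
      ((hcθ.comp_aestronglyMeasurable hv).smul (memLp_grad u).aestronglyMeasurable)
      (.of_forall fun x => by rw [norm_smul]; gcongr; exact hK _)
  suffices h : ((m1.toLp _, m2.toLp _) : PairSpace N Ω p) ∈ sobolevZero N Ω p from
    ⟨⟨_, h⟩, m1.coeFn_toLp, m2.coeFn_toLp⟩
  obtain ⟨w, hw, hlim⟩ := mem_closure_iff_seq_limit.1 u.2
  choose φ h1 h2 h3 h4 h5 using hw
  have htest : ∀ n, IsTest Ω (φ n) := fun n => ⟨h1 n, h2 n, h3 n⟩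
  let w' : ℕ → sobolevZero N Ω p := fun n =>
    ⟨w n, Submodule.le_topologicalClosure _ ⟨φ n, h1 n, h2 n, h3 n, h4 n, h5 n⟩⟩
  have hw' : Tendsto w' atTop (𝓝 u) := tendsto_subtype_rng.2 hlim
  obtain ⟨ns, hns, hae⟩ := exists_subseq_tendsto_ae hw'
  choose z hz1 hz2 using fun n => ((htest (ns n)).comp hθ hθ0).exists_sobolevZero (p := p)
  have hzval : ∀ n, val (z n) =ᵐ[volume.restrict Ω] fun x => θ (val (w' (ns n)) x) := fun n => by
    filter_upwards [hz1 n, h4 (ns n)] with x hx1 hx2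
    rw [hx1, Function.comp_apply, ← hx2]; rfl
  have hzgrad : ∀ n, grad (z n) =ᵐ[volume.restrict Ω]
      fun x => deriv θ (val (w' (ns n)) x) • grad (w' (ns n)) x := fun n => by
    filter_upwards [hz2 n, h4 (ns n), h5 (ns n)] with x hx1 hx2 hx3
    rw [hx1, gradient_comp (hdθ _) ((h1 _).differentiable (by simp) x), ← hx2, ← hx3]; rfl
  have hsub : Tendsto (fun n => w (ns n)) atTop (𝓝 u.1) := hlim.comp hns.tendsto_atTop
  have l1 := (Lp.tendsto_Lp_iff_tendsto_eLpNorm' _ _).1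
    ((continuous_fst.tendsto u.1).comp hsub)
  have l2 := (Lp.tendsto_Lp_iff_tendsto_eLpNorm' _ _).1
    ((continuous_snd.tendsto u.1).comp hsub)
  have hKmul : ∀ {f : ℕ → ℝ≥0∞}, Tendsto f atTop (𝓝 0) →
      Tendsto (fun n => ENNReal.ofReal K * f n) atTop (𝓝 0) := fun hf => by
    simpa using ENNReal.Tendsto.const_mul hf (Or.inr ENNReal.ofReal_ne_top)
  refine isClosed_closure.mem_of_tendsto (b := atTop) (f := fun n => (z n).1) ?_
    (.of_forall fun n => (z n).2)
  refine Prod.tendsto_iff _ _ |>.2 ⟨?_, ?_⟩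
  · refine (Lp.tendsto_Lp_iff_tendsto_eLpNorm' _ _).2 ?_
    refine tendsto_of_tendsto_of_tendsto_of_le_of_le tendsto_const_nhds (hKmul l1)
      (fun _ => zero_le) fun n => ?_
    refine eLpNorm_le_mul_eLpNorm_of_ae_le_mul ?_ _
    filter_upwards [hzval n, m1.coeFn_toLp] with x hx1 hx2
    rw [Pi.sub_apply, Pi.sub_apply, hx2]
    change ‖val (z n) x - _‖ ≤ _
    rw [hx1]
    exact hlip _ _
  · refine (Lp.tendsto_Lp_iff_tendsto_eLpNorm' _ _).2 ?_
    -- The gradient difference is split as `θ'(u_n)(∇u_n - ∇u) + (θ'(u_n) - θ'(u))∇u`: the first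
    -- part is bounded by `K` times an `L^p` null sequence, and this is the second part.
    have hbd := tendsto_eLpNorm_smul_of_ae h0 (K := 2 * K) (memLp_grad u)
      (a := fun n x => deriv θ (val (w' (ns n)) x) - deriv θ (val u x))
      (fun n => (hcθ.comp_aestronglyMeasurable (memLp_val _).aestronglyMeasurable).sub
        (hcθ.comp_aestronglyMeasurable hv))
      (fun n x => (abs_sub _ _).trans (by linarith [hK (val (w' (ns n)) x), hK (val u x)])) (by
        filter_upwards [hae] with x hx
        have := ((hcθ.tendsto _).comp hx).sub_const (deriv θ (val u x))
        rwa [sub_self] at this)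
    have hsum := (hKmul l2).add hbd
    rw [add_zero] at hsum
    refine tendsto_of_tendsto_of_tendsto_of_le_of_le tendsto_const_nhds hsum
      (fun _ => zero_le) fun n => ?_
    have hgm := (memLp_grad (w' (ns n))).aestronglyMeasurable
    have hcm := hcθ.comp_aestronglyMeasurable (memLp_val (w' (ns n))).aestronglyMeasurable
    refine (eLpNorm_congr_ae (g := (fun x => deriv θ (val (w' (ns n)) x) •
      (grad (w' (ns n)) x - grad u x)) +
        fun x => (deriv θ (val (w' (ns n)) x) - deriv θ (val u x)) • grad u x) ?_).trans_le ?_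
    · filter_upwards [hzgrad n, m2.coeFn_toLp] with x hx1 hx2
      rw [Pi.sub_apply, Pi.add_apply, hx2]
      change grad (z n) x - _ = _
      rw [hx1, smul_sub, sub_smul]
      abel
    · refine (eLpNorm_add_le (hcm.smul (hgm.sub (memLp_grad u).aestronglyMeasurable))
        (((hcm.sub (hcθ.comp_aestronglyMeasurable hv))).smul
          (memLp_grad u).aestronglyMeasurable) (Fact.out)).trans ?_
      refine add_le_add (eLpNorm_le_mul_eLpNorm_of_ae_le_mul (.of_forall fun x => ?_) _) le_rfl
      rw [Pi.smul_apply', norm_smul]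
      exact mul_le_mul_of_nonneg_right (hK _) (norm_nonneg _)

/-! ### Smooth truncation -/

/-- A smooth nondecreasing function that vanishes on `[-t, ∞)` and has slope `1` on
`(-∞, -t-η]`. -/
noncomputable def cutoff (t η s : ℝ) : ℝ :=
  ∫ τ in (-t)..s, Real.smoothTransition ((-t - τ) / η)

section cutoff

variable {t η : ℝ}

lemma continuous_cutoff_deriv (t η : ℝ) :
    Continuous fun τ : ℝ => Real.smoothTransition ((-t - τ) / η) :=
  Real.smoothTransition.continuous.comp (by fun_prop)

lemma hasDerivAt_cutoff (t η s : ℝ) :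
    HasDerivAt (cutoff t η) (Real.smoothTransition ((-t - s) / η)) s :=
  ((continuous_cutoff_deriv t η).integral_hasStrictDerivAt (-t) s).hasDerivAt

lemma deriv_cutoff (t η : ℝ) :
    deriv (cutoff t η) = fun s => Real.smoothTransition ((-t - s) / η) :=
  funext fun s => (hasDerivAt_cutoff t η s).deriv

lemma contDiff_cutoff (t η : ℝ) : ContDiff ℝ ∞ (cutoff t η) := by
  rw [contDiff_infty_iff_deriv, deriv_cutoff]
  exact ⟨fun s => (hasDerivAt_cutoff t η s).differentiableAt,
    Real.smoothTransition.contDiff.comp (by fun_prop)⟩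

lemma cutoff_of_ge (hη : 0 < η) {s : ℝ} (hs : -t ≤ s) : cutoff t η s = 0 := by
  rw [cutoff, intervalIntegral.integral_congr (g := fun _ => (0 : ℝ)),
    intervalIntegral.integral_zero]
  intro τ hτ
  rw [Set.uIcc_of_le hs] at hτ
  exact Real.smoothTransition.zero_of_nonpos (div_nonpos_of_nonpos_of_nonneg (by linarith [hτ.1])
    hη.le)

lemma cutoff_nonpos {s : ℝ} (hs : s ≤ -t) : cutoff t η s ≤ 0 := by
  rw [cutoff, intervalIntegral.integral_symm, neg_nonpos]
  exact intervalIntegral.integral_nonneg hs fun τ _ => Real.smoothTransition.nonneg _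

/-- The slope is at most one. Consequently `s - cutoff t η s ≤ -t`, so for `t ≥ 0` the truncated
value stays on the half line where `G` and `F` are Lipschitz. -/
lemma add_le_cutoff {s : ℝ} (hs : s ≤ -t) : s + t ≤ cutoff t η s := by
  rw [cutoff, intervalIntegral.integral_symm]
  have := intervalIntegral.integral_mono_on (μ := volume) hs
    ((continuous_cutoff_deriv t η).intervalIntegrable _ _) intervalIntegrable_const
    fun τ _ => Real.smoothTransition.le_one ((-t - τ) / η)
  rw [intervalIntegral.integral_const, smul_eq_mul] at this
  linarith

/-- Smoothing loses at most the width `η` of the transition layer. At depth `2η` below `-t` the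
cutoff is therefore at most `-η`. -/
lemma cutoff_le (hη : 0 < η) {s : ℝ} (hs : s ≤ -t - η) : cutoff t η s ≤ s + t + η := by
  have hi := fun a b => (continuous_cutoff_deriv t η).intervalIntegrable (μ := volume) a b
  have h1 : cutoff t η s = cutoff t η (-t - η) + ∫ τ in (-t - η)..s,
      Real.smoothTransition ((-t - τ) / η) :=
    (intervalIntegral.integral_add_adjacent_intervals (hi _ _) (hi _ _)).symm
  have h2 : ∫ τ in (-t - η)..s, Real.smoothTransition ((-t - τ) / η) = s - (-t - η) := by
    rw [intervalIntegral.integral_congr (g := fun _ => (1 : ℝ))]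
    · simp
    · intro τ hτ
      rw [Set.uIcc_of_ge hs] at hτ
      refine Real.smoothTransition.one_of_one_le ?_
      rw [le_div_iff₀ hη]; linarith [hτ.2]
  rw [h1, h2]
  linarith [cutoff_nonpos (t := t) (η := η) (s := -t - η) (by linarith)]

end cutoff

end

section

/-! ### Lower bound for minimizers -/

/-- Fast geometric convergence. -/
lemma le_mul_pow_of_recursive {y : ℕ → ℝ} (hy : ∀ n, 0 ≤ y n) {E Y α : ℝ} (hα : 1 < α) (hE : 0 ≤ E)
    (hY : 0 < Y) (h0 : y 0 ≤ Y) (hrec : ∀ n, y (n + 1) ≤ E * 2 ^ n * y n ^ α)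
    (hsmall : E * Y ^ (α - 1) ≤ (2 : ℝ) ^ (-1 / (α - 1))) (n : ℕ) :
    y n ≤ Y * ((2 : ℝ) ^ (-1 / (α - 1))) ^ n := by
  -- The ratio is determined by `b^(α-1) = 1/2`, so that the superlinear gain `(b^n)^(α-1)` cancels
  -- the growth factor `2^n` exactly.
  set b : ℝ := (2 : ℝ) ^ (-1 / (α - 1)) with hb
  have hb0 : 0 < b := by positivity
  have hbα : b ^ (α - 1) = 1 / 2 := by
    rw [hb, ← Real.rpow_mul (by norm_num), div_mul_cancel₀ _ (by linarith), Real.rpow_neg_one]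
    norm_num
  induction n with
  | zero => simpa using h0
  | succ n ih =>
    have h1 : y n ^ α ≤ (Y * b ^ n) ^ α := Real.rpow_le_rpow (hy n) ih (by linarith)
    have h2 : (Y * b ^ n) ^ α = Y * b ^ n * (Y ^ (α - 1) * (1 / 2) ^ n) := by
      have h3 : (b ^ n) ^ (α - 1) = (1 / 2) ^ n := by
        rw [← hbα, ← Real.rpow_natCast, ← Real.rpow_mul hb0.le, ← Real.rpow_natCast,
          ← Real.rpow_mul hb0.le, mul_comm]
      have h4 : (Y * b ^ n) ^ α = Y * b ^ n * (Y * b ^ n) ^ (α - 1) := by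
        rw [← Real.rpow_one_add' (by positivity) (by linarith)]
        congr 1; ring
      rw [h4, Real.mul_rpow hY.le (by positivity), h3]
    have h5 : (2 : ℝ) ^ n * (1 / 2) ^ n = 1 := by rw [← mul_pow]; norm_num
    calc y (n + 1) ≤ E * 2 ^ n * (Y * b ^ n * (Y ^ (α - 1) * (1 / 2) ^ n)) := by
          refine (hrec n).trans ?_
          rw [← h2]; gcongr
      _ = Y * b ^ n * (E * Y ^ (α - 1)) * (2 ^ n * (1 / 2) ^ n) := by ring
      _ ≤ Y * b ^ n * b * (2 ^ n * (1 / 2) ^ n) := by gcongr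
      _ = Y * b ^ (n + 1) := by rw [h5]; ring

/-! ### Hölder and Chebyshev estimates on level sets -/

section Holder

variable {α : Type*} {mα : MeasurableSpace α} {ν : Measure α}

lemma integral_weight_sub_le {w : α → ℝ} {k l : ℝ} (hkl : k.HolderConjugate l)
    (hw : AEStronglyMeasurable w ν) {X Y z : α → ℝ} (hX : Integrable (fun x => w x * X x) ν)
    (hY : Integrable (fun x => w x * Y x) ν) (hz : AEStronglyMeasurable z ν) {L δ M : ℝ}
    (hL : 0 ≤ L) (hδ : 0 ≤ δ) (hM : 0 ≤ M) (hXY : ∀ᵐ x ∂ν, |X x - Y x| ≤ L * |z x|)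
    (hwδ : eLpNorm w (ENNReal.ofReal k) ν ≤ ENNReal.ofReal δ)
    (hzM : eLpNorm z (ENNReal.ofReal l) ν ≤ ENNReal.ofReal M) :
    ∫ x, w x * X x ∂ν - ∫ x, w x * Y x ∂ν ≤ L * δ * M := by
  rw [← integral_sub hX hY]
  have h1 : ∫⁻ x, ‖w x‖ₑ * ‖z x‖ₑ ∂ν ≤ ENNReal.ofReal δ * ENNReal.ofReal M := by
    refine (ENNReal.lintegral_mul_le_Lp_mul_Lq ν hkl hw.enorm hz.enorm).trans ?_
    have hk : eLpNorm w (ENNReal.ofReal k) ν = (∫⁻ x, ‖w x‖ₑ ^ k ∂ν) ^ (1 / k) := by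
      rw [← eLpNorm_ofReal_rpow hkl.pos, ← ENNReal.rpow_mul, mul_one_div_cancel hkl.pos.ne',
        ENNReal.rpow_one]
    have hl : eLpNorm z (ENNReal.ofReal l) ν = (∫⁻ x, ‖z x‖ₑ ^ l ∂ν) ^ (1 / l) := by
      rw [← eLpNorm_ofReal_rpow hkl.symm.pos, ← ENNReal.rpow_mul,
        mul_one_div_cancel hkl.symm.pos.ne', ENNReal.rpow_one]
    rw [← hk, ← hl]
    gcongr
  have h2 : ENNReal.ofReal ‖∫ x, (w x * X x - w x * Y x) ∂ν‖ ≤ ENNReal.ofReal (L * δ * M) := by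
    rw [ofReal_norm]
    refine (enorm_integral_le_lintegral_enorm _).trans ?_
    calc ∫⁻ x, ‖w x * X x - w x * Y x‖ₑ ∂ν
        ≤ ∫⁻ x, ENNReal.ofReal L * (‖w x‖ₑ * ‖z x‖ₑ) ∂ν := by
          refine lintegral_mono_ae ?_
          filter_upwards [hXY] with x hx
          rw [← mul_sub, enorm_mul, mul_left_comm]
          gcongr
          rw [← ofReal_norm (z x), ← ENNReal.ofReal_mul hL, ← ofReal_norm]
          exact ENNReal.ofReal_le_ofReal hx
      _ ≤ ENNReal.ofReal L * (ENNReal.ofReal δ * ENNReal.ofReal M) := by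
          rw [lintegral_const_mul' _ _ ENNReal.ofReal_ne_top]
          gcongr
      _ = _ := by rw [← ENNReal.ofReal_mul hδ, ← ENNReal.ofReal_mul hL, mul_assoc]
  exact (Real.le_norm_self _).trans ((ENNReal.ofReal_le_ofReal_iff (by positivity)).1 h2)

/-- Hölder's inequality for a function supported in a set `A`. -/
lemma eLpNorm_le_mul_measure_rpow [IsFiniteMeasure ν] {A : Set α} (hA : MeasurableSet A) {z : α → ℝ}
    (hz : AEStronglyMeasurable z ν) (hzA : ∀ᵐ x ∂ν, x ∉ A → z x = 0) {l s M : ℝ} (hl : 0 < l)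
    (hls : l ≤ s) (hM : 0 ≤ M) (hzM : eLpNorm z (ENNReal.ofReal s) ν ≤ ENNReal.ofReal M) :
    eLpNorm z (ENNReal.ofReal l) ν ≤ ENNReal.ofReal (M * ν.real A ^ (1 / l - 1 / s)) := by
  have hs : 0 < s := hl.trans_le hls
  have h1 : z =ᵐ[ν] A.indicator z := by
    filter_upwards [hzA] with x hx
    by_cases hxA : x ∈ A
    · rw [Set.indicator_of_mem hxA]
    · rw [Set.indicator_of_notMem hxA, hx hxA]
  rw [eLpNorm_congr_ae h1, eLpNorm_indicator_eq_eLpNorm_restrict hA]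
  have hexp : 0 ≤ 1 / l - 1 / s := sub_nonneg.2 (one_div_le_one_div_of_le hl hls)
  refine (eLpNorm_le_eLpNorm_mul_rpow_measure_univ (ENNReal.ofReal_le_ofReal hls)
    hz.restrict).trans ?_
  rw [ENNReal.toReal_ofReal hl.le, ENNReal.toReal_ofReal hs.le, Measure.restrict_apply_univ,
    ENNReal.ofReal_mul hM, ← ENNReal.ofReal_rpow_of_nonneg measureReal_nonneg hexp,
    ofReal_measureReal]
  gcongr
  exact (eLpNorm_restrict_le _ _ _ _).trans hzM

/-- Chebyshev's inequality. -/
lemma mul_measureReal_rpow_le [IsFiniteMeasure ν] {A : Set α} (hA : MeasurableSet A) {z : α → ℝ}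
    {η s M : ℝ} (hη : 0 < η) (hs : 0 < s) (hM : 0 ≤ M) (hzA : ∀ᵐ x ∂ν, x ∈ A → η ≤ |z x|)
    (hzM : eLpNorm z (ENNReal.ofReal s) ν ≤ ENNReal.ofReal M) :
    η * ν.real A ^ (1 / s) ≤ M := by
  have h1 : eLpNorm (A.indicator fun _ => η) (ENNReal.ofReal s) ν ≤
      eLpNorm z (ENNReal.ofReal s) ν := by
    refine eLpNorm_mono_ae ?_
    filter_upwards [hzA] with x hx
    by_cases hxA : x ∈ A
    · rw [Set.indicator_of_mem hxA, Real.norm_of_nonneg hη.le]; exact hx hxA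
    · rw [Set.indicator_of_notMem hxA, norm_zero]; positivity
  rw [eLpNorm_indicator_const hA (by simpa using hs) ENNReal.ofReal_ne_top,
    ENNReal.toReal_ofReal hs.le, ← ofReal_measureReal,
    ENNReal.ofReal_rpow_of_nonneg measureReal_nonneg (by positivity), ← ofReal_norm,
    Real.norm_of_nonneg hη.le, ← ENNReal.ofReal_mul hη.le] at h1
  exact (ENNReal.ofReal_le_ofReal_iff hM).1 (h1.trans hzM)

end Holder

end

/-! ### Truncation of minimizers and De Giorgi iteration -/

section

/-- On `[0, 1]` a power larger than one only decreases numbers. With `a` the slope of the cutoff,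
this says that cutting a gradient into `a∇v` and `(1-a)∇v` does not increase the total `p`-energy.
-/
lemma rpow_add_one_sub_rpow_le {p : ℝ} (hp1 : 1 < p) {a : ℝ} (ha : 0 ≤ a) (ha1 : a ≤ 1) :
    a ^ p + (1 - a) ^ p ≤ 1 := by
  have h1 := Real.rpow_le_rpow_of_exponent_ge' ha ha1 zero_le_one hp1.le
  have h2 := Real.rpow_le_rpow_of_exponent_ge' (sub_nonneg.2 ha1) (by linarith) zero_le_one hp1.le
  rw [Real.rpow_one] at h1 h2
  linarith

variable {N : ℕ} {Ω : Set (Space N)} {p : ℝ} [hp : Fact (1 < p)]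

lemma gradNorm_rpow (u : sobolevZero N Ω p) : gradNorm u ^ p = ∫ x in Ω, ‖grad u x‖ ^ p := by
  rw [integral_grad_rpow, gradNorm_eq]

/-- Splitting of `v` at the level `-t`. -/
lemma exists_cutoff_decomposition (v : sobolevZero N Ω p) {t η : ℝ} (ht : 0 ≤ t) (hη : 0 < η) :
    ∃ z u : sobolevZero N Ω p,
      val z =ᵐ[volume.restrict Ω] (fun x => cutoff t η (val v x)) ∧
      val u =ᵐ[volume.restrict Ω] (fun x => val v x - cutoff t η (val v x)) ∧
      gradNorm z ^ p + gradNorm u ^ p ≤ gradNorm v ^ p := by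
  have hd : ∀ s, HasDerivAt (fun s => s - cutoff t η s)
      (1 - Real.smoothTransition ((-t - s) / η)) s := fun s =>
    (hasDerivAt_id s).sub (hasDerivAt_cutoff t η s)
  have h0 : cutoff t η 0 = 0 := cutoff_of_ge hη (by linarith)
  have ha0 := fun s => Real.smoothTransition.nonneg ((-t - s) / η)
  have ha1 := fun s => Real.smoothTransition.le_one ((-t - s) / η)
  obtain ⟨z, hz1, hz2⟩ := exists_comp_sobolevZero (contDiff_cutoff t η) h0 (K := 1)
    (fun s => by rw [deriv_cutoff, abs_of_nonneg (ha0 s)]; exact ha1 s) v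
  obtain ⟨u, hu1, hu2⟩ := exists_comp_sobolevZero (θ := fun s => s - cutoff t η s)
    (contDiff_id.sub (contDiff_cutoff t η)) (by simp [h0]) (K := 1)
    (fun s => by
      rw [(hd s).deriv, abs_of_nonneg (by linarith [ha1 s])]; linarith [ha0 s]) v
  refine ⟨z, u, hz1, hu1, ?_⟩
  have hi : ∀ w : sobolevZero N Ω p, IntegrableOn (fun x => ‖grad w x‖ ^ p) Ω := fun w =>
    integrable_norm_rpow_Lp w.1.2
  rw [gradNorm_rpow, gradNorm_rpow, gradNorm_rpow, ← integral_add (hi z) (hi u)]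
  refine integral_mono_ae ((hi z).add (hi u)) (hi v) ?_
  filter_upwards [hz2, hu2] with x hx1 hx2
  rw [hx1, hx2, deriv_cutoff, (hd _).deriv, norm_smul, norm_smul,
    Real.norm_of_nonneg (ha0 _), Real.norm_of_nonneg (sub_nonneg.2 (ha1 _)),
    Real.mul_rpow (ha0 _) (norm_nonneg _),
    Real.mul_rpow (sub_nonneg.2 (ha1 _)) (norm_nonneg _), ← add_mul]
  exact mul_le_of_le_one_left (by positivity) (rpow_add_one_sub_rpow_le hp.out (ha0 _) (ha1 _))

lemma measurableSet_val_le (v : sobolevZero N Ω p) (t : ℝ) :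
    MeasurableSet {x | val v x ≤ t} :=
  measurableSet_le (Lp.stronglyMeasurable v.1.1).measurable measurable_const

namespace AdmissibleExponents

variable {k r l : ℝ} (he : AdmissibleExponents N p k r l)

include he

/-- Decay of the level sets of a minimizer in a ball. -/
lemma exists_levelSet_decay (hΩb : Bornology.IsBounded Ω) (hpN : p < N) {q μ : ℝ} (hq : 0 < q)
    (hμ : 0 < μ) : ∃ D, 0 < D ∧ ∀ δ, 0 ≤ δ → ∀ c h : Space N → ℝ,
      MemLp c (ENNReal.ofReal k) (volume.restrict Ω) →
      MemLp h (ENNReal.ofReal k) (volume.restrict Ω) →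
      eLpNorm c (ENNReal.ofReal k) (volume.restrict Ω) ≤ ENNReal.ofReal δ →
      eLpNorm h (ENNReal.ofReal k) (volume.restrict Ω) ≤ ENNReal.ofReal δ →
      ∀ (ρ : ℝ) (v : sobolevZero N Ω p), gradNorm v ≤ ρ →
        (∀ u : sobolevZero N Ω p, gradNorm u ≤ ρ → energy q μ c h v ≤ energy q μ c h u) →
        ∀ t η : ℝ, 0 ≤ t → 0 < η →
          (η * (volume.restrict Ω).real {x | val v x ≤ -t - 2 * η} ^
            (1 / (N * p / (N - p)))) ^ (p - 1) ≤
          D * δ * (volume.restrict Ω).real {x | val v x ≤ -t} ^ (1 / l - 1 / (N * p / (N - p))) := by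
  have hp1 : 1 < p := hp.out
  have h0 : 0 < p := by linarith
  have hl0 : 0 < l := he.conj.symm.pos
  have hls : l ≤ N * p / (N - p) := by
    have := he.lt_critical
    have := he.one_lt
    nlinarith
  set s := N * p / (N - p)
  have hs0 : 0 < s := hl0.trans_le hls
  have : IsFiniteMeasure (volume.restrict Ω) :=
    ⟨by rw [Measure.restrict_apply_univ]; exact hΩb.measure_lt_top⟩
  obtain ⟨S, hS0, hS⟩ := exists_eLpNorm_val_le (Ω := Ω) hpN
  obtain ⟨L₁, hL₁0, hL₁⟩ := exists_bound_nonpos (continuous_g hp1 hq hμ) (fun s => g_of_le)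
  obtain ⟨L₂, hL₂0, hL₂⟩ := exists_bound_nonpos (continuous_f hp1 hμ) (fun s => f_of_le)
  -- The Sobolev constant `S` is only known to be nonnegative; `S + 1` keeps `D` positive, as is
  -- needed to divide by it later.
  refine ⟨(S + 1) ^ (p - 1) * (p * (L₁ + L₂) * (S + 1)), by positivity,
    fun δ hδ c h hc hh hcδ hhδ ρ v hvρ hmin t η ht hη => ?_⟩
  obtain ⟨z, u, hz, hu, hzu⟩ := exists_cutoff_decomposition v ht hη
  have hz0 := gradNorm_nonneg z
  have hu0 := gradNorm_nonneg u
  have hv0 := gradNorm_nonneg v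
  have huv : gradNorm u ≤ gradNorm v := by
    rw [← Real.rpow_le_rpow_iff hu0 hv0 h0]
    have : 0 ≤ gradNorm z ^ p := by positivity
    linarith
  -- Truncation decreases the gradient norm, so `u` is an admissible competitor in the same ball. No
  -- Euler–Lagrange equation is involved.
  have hcomp := hmin u (huv.trans hvρ)
  set m := (volume.restrict Ω).real {x | val v x ≤ -t} with hm
  have hm0 : 0 ≤ m := measureReal_nonneg
  set κ := 1 / l - 1 / s
  have hMz : 0 ≤ (S + 1) * gradNorm z := by positivity
  have hzs : eLpNorm (val z) (ENNReal.ofReal s) (volume.restrict Ω) ≤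
      ENNReal.ofReal ((S + 1) * gradNorm z) :=
    (hS z).trans (ENNReal.ofReal_le_ofReal (by gcongr; linarith))
  have hzl := eLpNorm_le_mul_measure_rpow (measurableSet_val_le v (-t))
    (memLp_val z).aestronglyMeasurable (by
      filter_upwards [hz] with x hx hxA
      rw [hx]
      exact cutoff_of_ge hη (not_le.1 hxA).le) hl0 hls hMz hzs
  -- Wherever `v` and `u` differ, both are nonpositive, so only the bounds of `g` and `f` on the
  -- negative half line matter.
  have hdiff : ∀ {Φ φ : ℝ → ℝ} {C : ℝ}, (∀ s, HasDerivAt Φ (φ s) s) → 0 < C →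
      (∀ s ≤ 0, |φ s| ≤ C) → ∀ᵐ x ∂volume.restrict Ω,
        |Φ (val v x) - Φ (val u x)| ≤ C * |val z x| := fun {Φ φ C} hΦ hC hφ => by
    filter_upwards [hz, hu] with x hx1 hx2
    rw [hx1, hx2]
    rcases le_total (-t) (val v x) with hvt | hvt
    · rw [cutoff_of_ge hη hvt, sub_zero, sub_self, abs_zero, mul_zero]
    · have h1 := add_le_cutoff (η := η) hvt
      have := abs_sub_le_of_bound_nonpos hΦ hφ (s := val v x - cutoff t η (val v x))
        (t := val v x) (by linarith) (by linarith)
      rwa [sub_sub_cancel] at this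
  have hTG := tameGrowth_G hp1 hq hμ he.lt_r
  have hTF := tameGrowth_F hp1 hμ he.lt_r
  have i1 := integral_weight_sub_le he.conj hc.aestronglyMeasurable
    (he.integrableOn_weight_mul hΩb hpN hc hTG v) (he.integrableOn_weight_mul hΩb hpN hc hTG u)
    (memLp_val z).aestronglyMeasurable hL₁0.le hδ (by positivity)
    (hdiff (hasDerivAt_G hp1 hq hμ) hL₁0 hL₁) hcδ hzl
  have i2 := integral_weight_sub_le he.conj hh.aestronglyMeasurable
    (he.integrableOn_weight_mul hΩb hpN hh hTF v) (he.integrableOn_weight_mul hΩb hpN hh hTF u)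
    (memLp_val z).aestronglyMeasurable hL₂0.le hδ (by positivity)
    (hdiff (hasDerivAt_F hp1 hμ) hL₂0 hL₂) hhδ hzl
  have key : gradNorm z ^ p ≤ p * (L₁ + L₂) * (S + 1) * δ * m ^ κ * gradNorm z := by
    simp only [energy, ← gradNorm_rpow] at hcomp
    have e1 : 1 / p * gradNorm z ^ p ≤ 1 / p * (gradNorm v ^ p - gradNorm u ^ p) := by
      gcongr; linarith
    have e2 : 1 / p * gradNorm z ^ p ≤ L₁ * δ * ((S + 1) * gradNorm z * m ^ κ) +
        L₂ * δ * ((S + 1) * gradNorm z * m ^ κ) := by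
      rw [mul_sub] at e1; linarith
    have e3 := mul_le_mul_of_nonneg_left e2 h0.le
    rw [← mul_assoc, mul_one_div_cancel h0.ne', one_mul] at e3
    exact e3.trans_eq (by ring)
  -- The energy inequality has a factor `gradNorm z` on the right because the Lipschitz bound is
  -- linear in `z`; dividing by it leaves the power `p - 1`.
  have key' : gradNorm z ^ (p - 1) ≤ p * (L₁ + L₂) * (S + 1) * δ * m ^ κ := by
    rcases hz0.eq_or_lt with hz0 | hz0
    · rw [← hz0, Real.zero_rpow (by linarith)]; positivity
    · rw [Real.rpow_sub_one hz0.ne', div_le_iff₀ hz0]; exact key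
  have hcheb := mul_measureReal_rpow_le (measurableSet_val_le v (-t - 2 * η)) hη hs0 hMz (by
    filter_upwards [hz] with x hx hxA
    replace hxA : val v x ≤ -t - 2 * η := hxA
    have := cutoff_le (t := t) hη (s := val v x) (by linarith)
    rw [hx, abs_of_nonpos (by linarith)]
    linarith) hzs
  calc _ ≤ ((S + 1) * gradNorm z) ^ (p - 1) :=
        Real.rpow_le_rpow (by positivity) hcheb (by linarith)
    _ = (S + 1) ^ (p - 1) * gradNorm z ^ (p - 1) := Real.mul_rpow (by positivity) hz0
    _ ≤ (S + 1) ^ (p - 1) * (p * (L₁ + L₂) * (S + 1) * δ * m ^ κ) := by gcongr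
    _ = _ := by ring

/-- Minimizers in a ball are larger than `-1/μ` if the coefficients are small. -/
theorem exists_forall_minimizer_gt (hΩb : Bornology.IsBounded Ω) (hpN : p < N) {q μ : ℝ}
    (hq : 0 < q) (hμ : 0 < μ) : ∃ δ, 0 < δ ∧ ∀ c h : Space N → ℝ,
      MemLp c (ENNReal.ofReal k) (volume.restrict Ω) →
      MemLp h (ENNReal.ofReal k) (volume.restrict Ω) →
      eLpNorm c (ENNReal.ofReal k) (volume.restrict Ω) ≤ ENNReal.ofReal δ →
      eLpNorm h (ENNReal.ofReal k) (volume.restrict Ω) ≤ ENNReal.ofReal δ →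
      ∀ (ρ : ℝ) (v : sobolevZero N Ω p), gradNorm v ≤ ρ →
        (∀ u : sobolevZero N Ω p, gradNorm u ≤ ρ → energy q μ c h v ≤ energy q μ c h u) →
        ∀ᵐ x ∂volume.restrict Ω, -1 / μ < val v x := by
  have hp1 : 0 < p - 1 := sub_pos.2 hp.out
  have h0 : 0 < p := by linarith
  have hl0 : 0 < l := he.conj.symm.pos
  have : IsFiniteMeasure (volume.restrict Ω) :=
    ⟨by rw [Measure.restrict_apply_univ]; exact hΩb.measure_lt_top⟩
  obtain ⟨D, hD0, hD⟩ := he.exists_levelSet_decay hΩb hpN hq hμ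
  have hcrit := he.lt_critical
  have hlr := he.lt_r
  set s := N * p / (N - p)
  have hs0 : 0 < s := by nlinarith [he.one_lt]
  -- In terms of `y(t) = |{v ≤ -t}|^{1/s}` the measure power `1/l - 1/s` becomes `s/l - 1`, and
  -- taking the root of order `p - 1` gives `α`. It exceeds one because `p < r < s/l`, which makes
  -- the recursion superlinear.
  set α := (s / l - 1) / (p - 1) with hαdef
  have hα : 1 < α := by
    rw [hαdef, one_lt_div hp1]
    have : r < s / l := by rwa [lt_div_iff₀ hl0]
    linarith
  set Y := (volume.restrict Ω).real Set.univ ^ (1 / s) + 1 with hY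
  have hY0 : 0 < Y := by positivity
  set b : ℝ := (2 : ℝ) ^ (-1 / (α - 1)) with hb
  have hb0 : 0 < b := by positivity
  have hb1 : b < 1 := Real.rpow_lt_one_of_one_lt_of_neg (by norm_num)
    (div_neg_of_neg_of_pos (by norm_num) (by linarith))
  -- Chosen so that the smallness condition `8μe Y^(α-1) ≤ b` of the iteration holds with equality.
  -- The corresponding `δ` solves `Dδ = e^(p-1)`; it involves neither `ρ` nor `v`, since `Y` bounds
  -- `y` by the volume of `Ω` alone.
  set e := b / (8 * μ * Y ^ (α - 1)) with hedef
  have he0 : 0 < e := by positivity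
  refine ⟨e ^ (p - 1) / D, by positivity, fun c h hc hh hcδ hhδ ρ v hvρ hmin => ?_⟩
  have hdec := hD _ (by positivity) c h hc hh hcδ hhδ ρ v hvρ hmin
  set y : ℝ → ℝ := fun t => (volume.restrict Ω).real {x | val v x ≤ -t} ^ (1 / s) with hydef
  have hy0 : ∀ t, 0 ≤ y t := fun t => by positivity
  have hstep : ∀ t η, 0 ≤ t → 0 < η → η * y (t + 2 * η) ≤ e * y t ^ α := fun t η ht hη => by
    have h1 := hdec t η ht hη
    rw [mul_div_cancel₀ _ hD0.ne'] at h1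
    rw [← Real.rpow_le_rpow_iff (by positivity) (by positivity) hp1,
      Real.mul_rpow he0.le (by positivity), ← Real.rpow_mul (hy0 t), hydef]
    beta_reduce
    rw [neg_add', ← Real.rpow_mul measureReal_nonneg]
    convert h1 using 3
    rw [hαdef]
    field_simp
  -- The levels rise from `1/(2μ)` to `1/μ`. The increment `2^{-(n+2)}/μ` equals `2η` with `η =
  -- 2^{-(n+3)}/μ`, and dividing by this `η` produces the factor `8μ 2^n` of the recursion.
  set T : ℕ → ℝ := fun n => 1 / μ * (1 - (1 / 2) ^ (n + 1)) with hT
  have hT0 : ∀ n, 0 ≤ T n := fun n => mul_nonneg (by positivity)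
    (sub_nonneg.2 (pow_le_one₀ (by norm_num) (by norm_num)))
  have hrec : ∀ n, y (T (n + 1)) ≤ 8 * μ * e * 2 ^ n * y (T n) ^ α := fun n => by
    have h1 := hstep (T n) (1 / μ * (1 / 2) ^ (n + 3)) (hT0 n) (by positivity)
    rw [show T n + 2 * (1 / μ * (1 / 2) ^ (n + 3)) = T (n + 1) by simp only [hT]; ring] at h1
    have h2 : 8 * μ * 2 ^ n * (1 / μ * (1 / 2) ^ (n + 3)) = 1 := by
      have : (2 : ℝ) ^ n * (1 / 2) ^ n = 1 := by rw [← mul_pow]; norm_num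
      calc _ = 8 * (1 / 2) ^ 3 * (μ * (1 / μ)) * ((2 : ℝ) ^ n * (1 / 2) ^ n) := by ring
        _ = 1 := by rw [this, mul_one_div_cancel hμ.ne']; norm_num
    calc y (T (n + 1)) = 8 * μ * 2 ^ n * (1 / μ * (1 / 2) ^ (n + 3) * y (T (n + 1))) := by
          rw [← mul_assoc, h2, one_mul]
      _ ≤ 8 * μ * 2 ^ n * (e * y (T n) ^ α) := by gcongr
      _ = _ := by ring
  have hbound := le_mul_pow_of_recursive (y := fun n => y (T n)) (fun n => hy0 _) hα
    (E := 8 * μ * e) (by positivity) hY0 (by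
      have : y (T 0) ≤ (volume.restrict Ω).real Set.univ ^ (1 / s) :=
        Real.rpow_le_rpow measureReal_nonneg (measureReal_mono (Set.subset_univ _)) (by positivity)
      linarith) hrec (by
      have : 8 * μ * e * Y ^ (α - 1) = b := by
        rw [hedef]; field_simp
      exact this.le)
  have hle : ∀ n, y (1 / μ) ≤ Y * b ^ n := fun n => by
    refine le_trans ?_ (hbound n)
    refine Real.rpow_le_rpow measureReal_nonneg (measureReal_mono fun x hx => ?_) (by positivity)
    have hpow : (0 : ℝ) ≤ (1 / 2) ^ (n + 1) := by positivity
    have : T n ≤ 1 / μ := mul_le_of_le_one_right (by positivity) (by linarith)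
    change val v x ≤ -T n
    replace hx : val v x ≤ -(1 / μ) := hx
    linarith
  have hzero : y (1 / μ) ≤ 0 := by
    refine ge_of_tendsto' (f := fun n => Y * b ^ n) (x := atTop) ?_ hle
    simpa using (tendsto_pow_atTop_nhds_zero_of_lt_one hb0.le hb1).const_mul Y
  have hzero' : y (1 / μ) = 0 := le_antisymm hzero (hy0 _)
  rw [hydef] at hzero'
  beta_reduce at hzero'
  rw [Real.rpow_eq_zero measureReal_nonneg (by positivity), measureReal_eq_zero_iff] at hzero'
  rw [ae_iff]
  simpa only [not_lt, neg_div] using hzero'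

end AdmissibleExponents

end

section

/-! ### The mountain-pass geometry -/

variable {N : ℕ} {Ω : Set (Space N)} {p : ℝ} [hp : Fact (1 < p)]

@[simp] lemma energy_zero {q μ : ℝ} {c h : Space N → ℝ} :
    energy q μ c h (0 : sobolevZero N Ω p) = 0 := by
  have h0 : 0 < p := zero_lt_one.trans hp.out
  have h1 : ∫ x in Ω, c x * G p q μ (val (0 : sobolevZero N Ω p) x) = 0 := by
    refine integral_eq_zero_of_ae ?_
    filter_upwards [val_zero (Ω := Ω) (p := p)] with x hx
    simp [hx]
  have h2 : ∫ x in Ω, h x * F p μ (val (0 : sobolevZero N Ω p) x) = 0 := by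
    refine integral_eq_zero_of_ae ?_
    filter_upwards [val_zero (Ω := Ω) (p := p)] with x hx
    simp [hx]
  rw [energy, ← gradNorm_rpow, h1, h2, gradNorm_zero, Real.zero_rpow h0.ne']
  simp

lemma differentiable_integral_grad_rpow (hΩb : Bornology.IsBounded Ω) :
    Differentiable ℝ fun u : sobolevZero N Ω p => ∫ x in Ω, ‖grad u x‖ ^ p := by
  have : IsFiniteMeasure (volume.restrict Ω) :=
    ⟨by rw [Measure.restrict_apply_univ]; exact hΩb.measure_lt_top⟩
  intro u
  let T : sobolevZero N Ω p →L[ℝ] Lp (Space N) (ENNReal.ofReal p) (volume.restrict Ω) :=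
    (ContinuousLinearMap.snd ℝ _ _).comp (sobolevZero N Ω p).subtypeL
  exact (((tameGrowth_norm_rpow (E := Space N) hp.out).hasFDerivAt_integral (T u)).comp u
    T.hasFDerivAt).differentiableAt

/-- If `J ≥ β` on a sphere separating `0` from `v₀`, the mountain-pass level is at least `β`. -/
lemma le_mountainPassLevel {J : sobolevZero N Ω p → ℝ} (hJ : Continuous J) {ρ β : ℝ} (hρ : 0 ≤ ρ)
    (hsphere : ∀ u, gradNorm u = ρ → β ≤ J u) {v₀ : sobolevZero N Ω p} (hv₀ : ρ ≤ gradNorm v₀) :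
    β ≤ mountainPassLevel J v₀ := by
  have : Nonempty (Path (0 : sobolevZero N Ω p) v₀) := PathConnectedSpace.joined _ _
  refine le_ciInf fun γ => ?_
  -- Compactness of the path makes the real supremum genuine; an unbounded one would take the
  -- default value `0`.
  have hbdd : BddAbove (Set.range fun t : unitInterval => J (γ t)) :=
    (isCompact_range (hJ.comp γ.continuous)).bddAbove
  obtain ⟨t, ht⟩ := mem_range_of_exists_le_of_exists_ge
    (continuous_gradNorm.comp γ.continuous) (c := ρ) ⟨0, by simpa using hρ⟩ ⟨1, by simpa using hv₀⟩
  exact (hsphere _ ht).trans (le_ciSup hbdd t)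

/-- A smooth function with compact support in `Ω` that is `1` on a set charged by `c`. -/
lemma exists_isTest_one_on (hΩ : IsOpen Ω) {c : Space N → ℝ}
    (hc : IntegrableOn c Ω) (hc0 : 0 ≤ᵐ[volume.restrict Ω] c) (hcne : ¬ c =ᵐ[volume.restrict Ω] 0) :
    ∃ φ, IsTest Ω φ ∧ (∀ x, φ x ∈ Set.Icc (0 : ℝ) 1) ∧ ∃ K, MeasurableSet K ∧ K ⊆ Ω ∧
      (∀ x ∈ K, φ x = 1) ∧ 0 < ∫ x in K, c x := by
  set c' := hc.aestronglyMeasurable.mk c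
  have hcc' : c =ᵐ[volume.restrict Ω] c' := hc.aestronglyMeasurable.ae_eq_mk
  have hm : MeasurableSet {x | 0 < c' x} :=
    measurableSet_lt measurable_const hc.aestronglyMeasurable.stronglyMeasurable_mk.measurable
  have hpos : 0 < volume (Ω ∩ {x | 0 < c' x}) := by
    rw [pos_iff_ne_zero, Set.inter_comm, ← Measure.restrict_apply hm]
    intro h0
    apply hcne
    rw [measure_eq_zero_iff_ae_notMem] at h0
    filter_upwards [h0, hc0, hcc'] with x h1 h2 h3
    refine le_antisymm ?_ h2
    rw [h3]
    exact not_lt.1 h1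
  -- Inner regularity yields a compact set of positive measure on which `c` is positive almost
  -- everywhere; a smooth bump between it and a compact neighbourhood in `Ω` is the required
  -- function.
  obtain ⟨K, hKE, hK, hKpos⟩ := (hΩ.measurableSet.inter hm).exists_lt_isCompact hpos
  have hKΩ : K ⊆ Ω := hKE.trans Set.inter_subset_left
  obtain ⟨K', hK', hKK', hK'Ω⟩ := exists_compact_between hK hΩ hKΩ
  obtain ⟨φ, hφ0, hφ1, hφ⟩ := exists_contMDiffMap_zero_one_of_isClosed (n := (⊤ : ℕ∞))
    (modelWithCornersSelf ℝ (Space N)) (isOpen_interior (s := K')).isClosed_compl hK.isClosed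
    (Set.disjoint_compl_left_iff_subset.2 hKK')
  have hsupp : tsupport φ ⊆ K' := by
    refine closure_minimal (fun x hx => ?_) hK'.isClosed
    by_contra h
    exact hx (hφ0 fun h' => h (interior_subset h'))
  refine ⟨φ, ⟨φ.contMDiff.contDiff, hK'.of_isClosed_subset (isClosed_tsupport _) hsupp,
    hsupp.trans hK'Ω⟩, hφ, K, hK.measurableSet, hKΩ, fun x hx => hφ1 hx, ?_⟩
  have hle : volume.restrict K ≤ volume.restrict Ω := Measure.restrict_mono_set _ hKΩ
  rw [setIntegral_pos_iff_support_of_nonneg_ae (ae_mono hle hc0) (hc.mono_set hKΩ)]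
  refine hKpos.trans_le ?_
  have : (K : Set (Space N)) ≤ᵐ[volume] (Function.support c ∩ K : Set (Space N)) := by
    have h1 := (ae_restrict_iff' hK.measurableSet).1 (ae_mono hle hcc')
    filter_upwards [h1] with x hx hxK
    refine ⟨?_, hxK⟩
    rw [Function.mem_support, hx hxK]
    exact (hKE hxK).2.ne'
  exact measure_mono_ae this

namespace AdmissibleExponents

variable {k r l : ℝ} (he : AdmissibleExponents N p k r l)

include he

lemma differentiable_energy (hΩb : Bornology.IsBounded Ω) (hpN : p < N) {q μ : ℝ} (hq : 0 < q)
    (hμ : 0 < μ) {c h : Space N → ℝ} (hc : MemLp c (ENNReal.ofReal k) (volume.restrict Ω))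
    (hh : MemLp h (ENNReal.ofReal k) (volume.restrict Ω)) :
    Differentiable ℝ (energy q μ c h : sobolevZero N Ω p → ℝ) :=
  (((differentiable_integral_grad_rpow hΩb).const_mul (1 / p)).sub
    (he.differentiable_weighted_integral hΩb hpN hc (tameGrowth_G hp.out hq hμ he.lt_r))).sub
    (he.differentiable_weighted_integral hΩb hpN hh (tameGrowth_F hp.out hμ he.lt_r))

/-- On the unit sphere the gradient term is exactly `1/p`, and `δ` is chosen so that the two
potential terms together consume at most half of it. -/
lemma exists_le_energy_of_gradNorm_eq_one (hΩb : Bornology.IsBounded Ω) (hpN : p < N) {q μ : ℝ}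
    (hq : 0 < q) (hμ : 0 < μ) : ∃ δ, 0 < δ ∧ ∀ c h : Space N → ℝ,
      MemLp c (ENNReal.ofReal k) (volume.restrict Ω) →
      MemLp h (ENNReal.ofReal k) (volume.restrict Ω) →
      eLpNorm c (ENNReal.ofReal k) (volume.restrict Ω) ≤ ENNReal.ofReal δ →
      eLpNorm h (ENNReal.ofReal k) (volume.restrict Ω) ≤ ENNReal.ofReal δ →
      ∀ u : sobolevZero N Ω p, gradNorm u = 1 → 1 / (2 * p) ≤ energy q μ c h u := by
  have h0 : 0 < p := zero_lt_one.trans hp.out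
  obtain ⟨C₁, hC₁0, hC₁⟩ := he.exists_abs_weighted_integral_le hΩb hpN
    (tameGrowth_G hp.out hq hμ he.lt_r) (G_zero p q μ)
  obtain ⟨C₂, hC₂0, hC₂⟩ := he.exists_abs_weighted_integral_le hΩb hpN
    (tameGrowth_F hp.out hμ he.lt_r) (F_zero p μ)
  refine ⟨1 / (2 * p * (C₁ + C₂ + 1)), by positivity, fun c h hc hh hcδ hhδ u hu => ?_⟩
  set δ := 1 / (2 * p * (C₁ + C₂ + 1)) with hδ
  have hδ0 : 0 < δ := by positivity
  have h1 := (hC₁ c hc u hu.le).trans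
    (mul_le_mul_of_nonneg_left (ENNReal.toReal_le_of_le_ofReal hδ0.le hcδ) hC₁0)
  have h2 := (hC₂ h hh u hu.le).trans
    (mul_le_mul_of_nonneg_left (ENNReal.toReal_le_of_le_ofReal hδ0.le hhδ) hC₂0)
  have h3 : (C₁ + C₂ + 1) * δ = 1 / (2 * p) := by rw [hδ]; field_simp
  have h4 : 1 / p = 1 / (2 * p) + 1 / (2 * p) := by field_simp; norm_num
  rw [energy, ← gradNorm_rpow, hu, Real.one_rpow, mul_one]
  linarith [le_abs_self (∫ x in Ω, c x * G p q μ (val u x)),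
    le_abs_self (∫ x in Ω, h x * F p μ (val u x))]

/-- Along `T φ` the gradient term and the `h`-term are at most a constant times `T^p`, while the
`c`-term is at least `G(T) ∫_K c`, because `φ = 1` on `K` and `c`, `G(Tφ)` are nonnegative.
Superlinearity of `G` wins, whatever the sign of `h`. -/
lemma exists_energy_nonpos (hΩ : IsOpen Ω) (hΩb : Bornology.IsBounded Ω) (hpN : p < N) {q μ : ℝ}
    (hq : 0 < q) (hμ : 0 < μ) {c h : Space N → ℝ}
    (hc : MemLp c (ENNReal.ofReal k) (volume.restrict Ω))
    (hh : MemLp h (ENNReal.ofReal k) (volume.restrict Ω)) (hc0 : 0 ≤ᵐ[volume.restrict Ω] c)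
    (hcne : ¬ c =ᵐ[volume.restrict Ω] 0) (ρ : ℝ) :
    ∃ u : sobolevZero N Ω p, ρ < gradNorm u ∧ energy q μ c h u ≤ 0 := by
  have h0 : 0 < p := zero_lt_one.trans hp.out
  have : IsFiniteMeasure (volume.restrict Ω) :=
    ⟨by rw [Measure.restrict_apply_univ]; exact hΩb.measure_lt_top⟩
  have hk : 1 ≤ ENNReal.ofReal k := by simpa using he.conj.lt.le
  have hhi := hh.integrable hk
  obtain ⟨φ, hφ, hφ01, K, hK, hKΩ, hφK, ha⟩ :=
    exists_isTest_one_on hΩ (hc.integrable hk) hc0 hcne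
  set a := ∫ x in K, c x
  obtain ⟨u, hu, -⟩ := hφ.exists_sobolevZero (p := p)
  -- A vanishing gradient norm would force `φ = 0` almost everywhere by Sobolev, although `φ = 1` on
  -- `K` and `K` is not a null set, as `∫_K c > 0`.
  have hu0 : 0 < gradNorm u := by
    refine (gradNorm_nonneg u).lt_of_ne' fun hu0 => ?_
    obtain ⟨S, hS0, hS⟩ := exists_eLpNorm_val_le (Ω := Ω) hpN
    have h1 := hS u
    have hs : ENNReal.ofReal (N * p / (N - p)) ≠ 0 := by
      simpa using h0.trans_le (one_le_critical hpN)
    rw [hu0, mul_zero, ENNReal.ofReal_zero, nonpos_iff_eq_zero,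
      eLpNorm_eq_zero_iff (memLp_val u).aestronglyMeasurable hs] at h1
    have h2 : ∀ᵐ x ∂volume.restrict K, False := by
      filter_upwards [ae_mono (Measure.restrict_mono_set _ hKΩ) (hu.symm.trans h1),
        ae_restrict_mem hK] with x hx1 hx2
      rw [hφK x hx2] at hx1
      exact one_ne_zero hx1
    rw [ae_iff, not_false_eq_true] at h2
    exact ha.ne' (setIntegral_measure_zero c (by simpa using h2))
  obtain ⟨C, hC0, hC⟩ := exists_F_le hp.out hμ
  set H := ∫ x in Ω, |h x|
  set A := gradNorm u ^ p
  -- The slope makes `G(T) a` dominate both `(A/p) T^p` from the gradient and `C H T^p` from the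
  -- `h`-term; the last condition places the point outside the ball of radius `ρ`.
  obtain ⟨T, hTG, hT1, hTρ⟩ := ((eventually_mul_rpow_le_G hp.out hq hμ ((A / p + C * H) / a)).and
    ((eventually_ge_atTop 1).and (eventually_gt_atTop (ρ / gradNorm u)))).exists
  have hT0 : 0 < T := by linarith
  refine ⟨T • u, ?_, ?_⟩
  · rw [gradNorm_smul, abs_of_pos hT0]
    rwa [div_lt_iff₀ hu0] at hTρ
  have hval : val (T • u) =ᵐ[volume.restrict Ω] fun x => T * φ x := by
    filter_upwards [val_smul T u, hu] with x hx1 hx2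
    rw [hx1, Pi.smul_apply, hx2, smul_eq_mul]
  have hφT : ∀ x, 0 ≤ T * φ x ∧ T * φ x ≤ T := fun x =>
    ⟨mul_nonneg hT0.le (hφ01 x).1, mul_le_of_le_one_right hT0.le (hφ01 x).2⟩
  have i1 : G p q μ T * a ≤ ∫ x in Ω, c x * G p q μ (val (T • u) x) := by
    have hint := he.integrableOn_weight_mul hΩb hpN hc (tameGrowth_G hp.out hq hμ he.lt_r) (T • u)
    have hle : volume.restrict K ≤ volume.restrict Ω := Measure.restrict_mono_set _ hKΩ
    have hnn : 0 ≤ᵐ[volume.restrict Ω] fun x => c x * G p q μ (val (T • u) x) := by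
      filter_upwards [hc0, hval] with x hx1 hx2
      rw [hx2]
      exact mul_nonneg hx1 (G_nonneg hp.out hμ (hφT x).1)
    refine le_trans (le_of_eq ?_) (setIntegral_mono_set hint hnn hKΩ.eventuallyLE)
    rw [mul_comm, ← integral_mul_const]
    refine integral_congr_ae ?_
    filter_upwards [ae_mono hle hval, ae_restrict_mem hK] with x hx1 hx2
    rw [hx1, hφK x hx2, mul_one]
  have i2 : -(C * T ^ p * H) ≤ ∫ x in Ω, h x * F p μ (val (T • u) x) := by
    have hle : ‖∫ x in Ω, h x * F p μ (val (T • u) x)‖ ≤ ∫ x in Ω, C * T ^ p * |h x| := by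
      refine norm_integral_le_of_norm_le (hhi.abs.const_mul _) ?_
      filter_upwards [hval] with x hx
      rw [hx, norm_mul, mul_comm]
      exact mul_le_mul_of_nonneg_right (hC T hT1 _ (hφT x).1 (hφT x).2) (abs_nonneg _)
    rw [integral_const_mul] at hle
    exact (abs_le.1 hle).1
  have i3 : (A / p + C * H) * T ^ p ≤ G p q μ T * a := by
    have := mul_le_mul_of_nonneg_right hTG ha.le
    rwa [mul_right_comm, div_mul_cancel₀ _ ha.ne'] at this
  have i4 : gradNorm (T • u) ^ p = T ^ p * A := by
    rw [gradNorm_smul, abs_of_pos hT0, Real.mul_rpow hT0.le hu0.le]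
  rw [energy, ← gradNorm_rpow, i4]
  have i5 : 1 / p * (T ^ p * A) = A / p * T ^ p := by ring
  rw [i5]
  linarith

/-- The energy attains its minimum on balls. -/
lemma exists_isMinOn_energy (hΩ : IsOpen Ω) (hΩb : Bornology.IsBounded Ω) (hpN : p < N) {q μ : ℝ}
    (hq : 0 < q) (hμ : 0 < μ) {c h : Space N → ℝ}
    (hc : MemLp c (ENNReal.ofReal k) (volume.restrict Ω))
    (hh : MemLp h (ENNReal.ofReal k) (volume.restrict Ω)) {ρ : ℝ} (hρ : 0 ≤ ρ) :
    ∃ v : sobolevZero N Ω p, gradNorm v ≤ ρ ∧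
      ∀ u : sobolevZero N Ω p, gradNorm u ≤ ρ → energy q μ c h v ≤ energy q μ c h u := by
  obtain ⟨T₁, hT₁⟩ := exists_embedding_L1 (Ω := Ω) (p := p) hΩb hpN
  refine exists_isMinOn_ball hΩ hΩb hpN hT₁ (B := fun u => (∫ x in Ω, c x * G p q μ (val u x)) +
    ∫ x in Ω, h x * F p μ (val u x)) (fun u => ?_)
    (he.differentiable_energy hΩb hpN hq hμ hc hh).continuous hρ fun u hu hT => ?_
  · rw [energy, integral_grad_rpow, sub_sub]
  · obtain ⟨a, ha⟩ := he.exists_tendsto_weighted_integral hΩb hpN hc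
      (tameGrowth_G hp.out hq hμ he.lt_r) hT₁ hu hT
    obtain ⟨b, hb⟩ := he.exists_tendsto_weighted_integral hΩb hpN hh
      (tameGrowth_F hp.out hμ he.lt_r) hT₁ hu hT
    exact ⟨a + b, ha.add hb⟩

end AdmissibleExponents

end

end PLaplace

/-! ### The second critical point -/

theorem theorem3p1 (N : ℕ) (hN : 3 ≤ N) (Ω : Set (PLaplace.Space N)) (hΩ : IsOpen Ω)
    (hΩb : Bornology.IsBounded Ω) (p : ℝ) [Fact (1 < p)] (hpN : p < N) (q : ℝ) (hq : 0 < q)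
    (μ : ℝ) (hμ : 0 < μ) (k : ℝ) (hk : N / p < k) :
    ∃ δ : ℝ, 0 < δ ∧ ∃ ρ₀ β₀ : ℝ, ∀ c h : PLaplace.Space N → ℝ,
      MemLp c (ENNReal.ofReal k) (volume.restrict Ω) →
      MemLp h (ENNReal.ofReal k) (volume.restrict Ω) →
      0 ≤ᵐ[volume.restrict Ω] c → ¬ c =ᵐ[volume.restrict Ω] 0 →
      eLpNorm c (ENNReal.ofReal k) (volume.restrict Ω) ≤ ENNReal.ofReal δ →
      eLpNorm h (ENNReal.ofReal k) (volume.restrict Ω) ≤ ENNReal.ofReal δ →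
      -- the functional is given by convergent integrals
      (∀ u : PLaplace.sobolevZero N Ω p,
        IntegrableOn (fun x => c x * PLaplace.G p q μ (PLaplace.val u x)) Ω ∧
        IntegrableOn (fun x => h x * PLaplace.F p μ (PLaplace.val u x)) Ω) ∧
      -- the geometry holds
      PLaplace.MountainPassGeometry
        (PLaplace.energy q μ c h : PLaplace.sobolevZero N Ω p → ℝ) ρ₀ β₀ ∧
      -- and, for whatever radius it holds, there is a second critical point in the ball
      ∀ ρ β : ℝ,
        PLaplace.MountainPassGeometry
          (PLaplace.energy q μ c h : PLaplace.sobolevZero N Ω p → ℝ) ρ β →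
        ∃ v : PLaplace.sobolevZero N Ω p,
          PLaplace.gradNorm v < ρ ∧
          PLaplace.IsCritical (PLaplace.energy q μ c h) v ∧
          PLaplace.energy q μ c h v ≤ 0 ∧
          (∀ᵐ x ∂(volume.restrict Ω), -1 / μ < PLaplace.val v x) ∧
          IsLocalMin (PLaplace.energy q μ c h) v ∧
          (∀ u : PLaplace.sobolevZero N Ω p, PLaplace.gradNorm u ≤ ρ →
            PLaplace.energy q μ c h v ≤ PLaplace.energy q μ c h u) ∧
          ∀ v₀ : PLaplace.sobolevZero N Ω p, ρ < PLaplace.gradNorm v₀ →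
            PLaplace.energy q μ c h v₀ ≤ 0 →
            0 < PLaplace.mountainPassLevel (PLaplace.energy q μ c h) v₀ ∧
            ∀ w : PLaplace.sobolevZero N Ω p,
              PLaplace.IsCritical (PLaplace.energy q μ c h) w →
              PLaplace.energy q μ c h w
                = PLaplace.mountainPassLevel (PLaplace.energy q μ c h) v₀ →
              w ≠ v := by
  obtain ⟨r, l, he⟩ := PLaplace.exists_admissibleExponents (N := N) (Fact.out : 1 < p) hpN hk
  obtain ⟨δ₁, hδ₁0, hδ₁⟩ := he.exists_forall_minimizer_gt hΩb hpN hq hμ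
  obtain ⟨δ₂, hδ₂0, hδ₂⟩ := he.exists_le_energy_of_gradNorm_eq_one hΩb hpN hq hμ
  have hp0 : 0 < p := zero_lt_one.trans Fact.out
  -- One threshold gives the lower bound `-1/μ` for minimizers in balls of any radius, the other the
  -- geometry on the unit sphere.
  refine ⟨min δ₁ δ₂, lt_min hδ₁0 hδ₂0, 1, 1 / (2 * p), fun c h hc hh hc0 hcne hcδ hhδ => ?_⟩
  have hle₁ : ENNReal.ofReal (min δ₁ δ₂) ≤ ENNReal.ofReal δ₁ :=
    ENNReal.ofReal_le_ofReal (min_le_left _ _)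
  have hle₂ : ENNReal.ofReal (min δ₁ δ₂) ≤ ENNReal.ofReal δ₂ :=
    ENNReal.ofReal_le_ofReal (min_le_right _ _)
  have hdiff := he.differentiable_energy hΩb hpN hq hμ hc hh
  refine ⟨fun u => ⟨he.integrableOn_weight_mul hΩb hpN hc
      (PLaplace.tameGrowth_G Fact.out hq hμ he.lt_r) u,
      he.integrableOn_weight_mul hΩb hpN hh (PLaplace.tameGrowth_F Fact.out hμ he.lt_r) u⟩,
    ⟨one_pos, by positivity, hδ₂ c h hc hh (hcδ.trans hle₂) (hhδ.trans hle₂),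
      he.exists_energy_nonpos hΩ hΩb hpN hq hμ hc hh hc0 hcne 1⟩, fun ρ β hgeo => ?_⟩
  obtain ⟨v, hvρ, hmin⟩ := he.exists_isMinOn_energy hΩ hΩb hpN hq hμ hc hh hgeo.rho_pos.le
  have hv0 : PLaplace.energy q μ c h v ≤ 0 :=
    (hmin 0 (by simpa using hgeo.rho_pos.le)).trans_eq PLaplace.energy_zero
  -- On the sphere the energy is at least `β > 0`, whereas `v` does no worse than `0`, where the
  -- energy vanishes.
  have hlt : PLaplace.gradNorm v < ρ :=
    hvρ.lt_of_ne fun h => (hv0.trans_lt hgeo.beta_pos).not_ge (hgeo.sphere v h)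
  have hloc : IsLocalMin (PLaplace.energy q μ c h) v := by
    filter_upwards [PLaplace.continuous_gradNorm.continuousAt.eventually_lt_const hlt] with u hu
    exact hmin u hu.le
  refine ⟨v, hlt, ?_, hv0, hδ₁ c h hc hh (hcδ.trans hle₁) (hhδ.trans hle₁) ρ v hvρ hmin, hloc,
    hmin, fun v₀ hv₀ _ => ?_⟩
  · have := (hdiff v).hasFDerivAt
    rwa [hloc.fderiv_eq_zero] at this
  have hlevel := hgeo.beta_pos.trans_le
    (PLaplace.le_mountainPassLevel hdiff.continuous hgeo.rho_pos.le hgeo.sphere hv₀.le)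
  refine ⟨hlevel, fun w _ hw hwv => ?_⟩
  rw [← hw, hwv] at hlevel
  exact hlevel.not_ge hv0
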